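/- **Setting.** Let $s\ge 1$, let $\mathcal F=\bigoplus_{n\ge 0}\mathcal F_n$ be the bosonic Fock space over $L^2(\mathbb R^s)$, where $\mathcal F_n$ is the $n$-fold symmetric tensor power of $L^2(\mathbb R^s)$, let $a^*(h),a(h)$ be the creation and annihilation operators and let $N$ be the particle number operator. For $h$ in the space $\mathcal D(\mathbb R^s)$ of complex-valued, smooth, compactly supported functions let $\phi(h)$ be the (self-adjoint) closure of $a^*(h)+a(h)$ on the vectors with finite particle number, and let $R(\lambda,h)=(i\lambda+\phi(h))^{-1}$, $\lambda\in\mathbb R\setminus\{0\}$. * $\mathfrak R$ is the C*-algebra of operators on $\mathcal F$ generated by all $R(\lambda,h)$, $\lambda\in\mathbb R\setminus\{0\}$, $h\in\mathcal D(\mathbb R^s)$. An operator $R\in\mathfrak R$ is a tensor of degree $m\in\mathbb Z$ if $e^{iuN}Re^{-iuN}=e^{ium}R$ for all $u\in\mathbb R$. The algebra $\mathfrak A$ consists of the tensors of degree $0$ in $\mathfrak R$, and $\mathfrak R_M$, $M\in\mathbb N_0$, is the norm closed linear span of the tensors in $\mathfrak R$ of degrees $m$ with $|m|\le M$. * $\overline{\mathfrak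 A}$, the (extended) algebra of observables, consists of all bounded operators $A$ on $\mathcal F$ with $A\upharpoonright\bigoplus_{k=0}^n\mathcal F_k\in\mathfrak A\upharpoonright\bigoplus_{k=0}^n\mathcal F_k$ for every $n\in\mathbb N_0$. * $\overline{\mathfrak F}$, the (extended) field algebra, is the norm closure of the set of all bounded operators $F$ on $\mathcal F$ for which there is some $M\in\mathbb N_0$ with $F\upharpoonright\bigoplus_{k=0}^n\mathcal F_k\in\mathfrak R_M\upharpoonright\bigoplus_{k=0}^n\mathcal F_k$ for every $n\in\mathbb N_0$. * $\mathfrak N$ is the von Neumann algebra generated by $N$. For a unitary $V$ on $\mathcal F$ put $\operatorname{Ad}V(T)=VTV^*$. * Fix $f\in\mathcal D(\mathbb R^s)$ with $\|f\|_2=1$, put $N_f=a^*(f)a(f)$, let $W_f=a^*(f)(1+N_f)^{-1/2}$, which is an isometry, and let $\rho_f(A)=W_fAW_f^*$ for $A\in\overline{\mathfrak A}$. * Maps $\rho_1,\rho_2:\overline{\mathfrak A}\to\overline{\mathfrak A}$ which are linear, multiplicative and *-preserving (morphisms) are called equivalent, $\rho_1\simeq\rho_2$, if there is a partial isometry $X\in\overline{\mathfrak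 A}$ with $XX^*=\rho_1(1)$, $X^*X=\rho_2(1)$ and $\rho_1(A)X=X\rho_2(A)$ for all $A\in\overline{\mathfrak A}$. **Lemma 4.1.** Let $G$ be a group and let $U$ be a unitary representation of $G$ on $\mathcal F$ (a homomorphism from $G$ to the unitary operators) such that every $U(g)$ commutes with $N$ and $\operatorname{Ad}U(g)(\overline{\mathfrak A})=\overline{\mathfrak A}$ for all $g\in G$. Put ${}^g\!\rho_f=\operatorname{Ad}U(g)\circ\rho_f\circ\operatorname{Ad}U(g)^*$. The following are equivalent. 1. $\rho_f$ is covariant with regard to the action of $G$: ${}^g\!\rho_f\simeq\rho_f$ for all $g\in G$. 2. There is a unitary representation $g\mapsto Z_{f,N}(g)$ of $G$ with values in $\mathfrak N$ such that $W_f\,\operatorname{Ad}U(g)(W_f^*)\,Z_{f,N}(g)^*\in\overline{\mathfrak A}$ for all $g\in G$. 3. There is a unitary representation $g\mapsto U_N(g)$ of $G$ with values in $\mathfrak N$ such that $g\mapsto V(g)=U(g)U_N(g)$ is a unitary representation of $G$ with $\operatorname{Ad}V(g)(\overline{\mathfrak F})=\overline{\mathfrak F}$ for all $g\in G$. Moreover,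 for every unitary representation $U_N$ of $G$ with values in $\mathfrak N$ one has $\operatorname{Ad}(U(g)U_N(g))(A)=\operatorname{Ad}U(g)(A)$ for all $g\in G$ and $A\in\overline{\mathfrak A}$; so in (3) the adjoint action of $V$ extends that of $U$ from $\overline{\mathfrak A}$ to $\overline{\mathfrak F}$. -/

import Mathlib

open scoped InnerProductSpace ComplexConjugate ComplexOrder

set_option linter.unusedSectionVars false

noncomputable section

namespace BoseFock

variable {H : Type*} [NormedAddCommGroup H] [InnerProductSpace ℂ H]

/-- The scalar product of the symmetric tensors `f₀ ⊗ₛ ⋯ ⊗ₛ fₙ₋₁` and `g₀ ⊗ₛ ⋯ ⊗ₛ gₙ₋₁`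
(each being the symmetrization projection of the corresponding simple tensor). -/
def symKernel {n : ℕ} (f g : Fin n → H) : ℂ :=
  (n.factorial : ℂ)⁻¹ * ∑ σ : Equiv.Perm (Fin n), ∏ i, ⟪f i, g (σ i)⟫_ℂ

/-- Formal complex linear combinations of `n`-tuples of vectors in `H`; the tuple
`(f₀, …, fₙ₋₁)` stands for `f₀ ⊗ₛ ⋯ ⊗ₛ fₙ₋₁`. -/
abbrev PreTensor (n : ℕ) (H : Type*) : Type _ := (Fin n → H) →₀ ℂ


theorem symKernel_conj {n : ℕ} (f g : Fin n → H) : conj (symKernel g f) = symKernel f g := by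
  simp only [symKernel, map_mul, map_inv₀, map_natCast, map_sum, map_prod, inner_conj_symm]
  congr 1
  rw [← Equiv.sum_comp (Equiv.inv (Equiv.Perm (Fin n)))]
  refine Finset.sum_congr rfl fun σ _ => ?_
  rw [← Equiv.prod_comp σ]
  simp

/-- The symmetrized kernel is an average over both arguments. -/
theorem symKernel_eq {n : ℕ} (f g : Fin n → H) :
    symKernel f g = ((n.factorial : ℂ)⁻¹) ^ 2 *
      ∑ τ : Equiv.Perm (Fin n), ∑ σ : Equiv.Perm (Fin n), ∏ i, ⟪f (τ i), g (σ i)⟫_ℂ := by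
  have h : ∀ τ : Equiv.Perm (Fin n), ∑ σ : Equiv.Perm (Fin n), ∏ i, ⟪f (τ i), g (σ i)⟫_ℂ =
      ∑ σ : Equiv.Perm (Fin n), ∏ i, ⟪f i, g (σ i)⟫_ℂ := by
    intro τ
    rw [← Equiv.sum_comp (Equiv.mulRight τ)]
    refine Finset.sum_congr rfl fun σ _ => ?_
    rw [← Equiv.prod_comp τ (fun i => ⟪f i, g (σ i)⟫_ℂ)]
    simp
  simp only [h, symKernel, Finset.sum_const, Finset.card_univ, Fintype.card_perm, Fintype.card_fin,
    nsmul_eq_mul]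
  have : (n.factorial : ℂ) ≠ 0 := by exact_mod_cast n.factorial_ne_zero
  field_simp

theorem posSemidef_prod {n : ℕ} {ι : Type*} [Finite ι] (v : ι → Fin n → H) :
    (Matrix.of fun a b : ι => ∏ i, ⟪v a i, v b i⟫_ℂ).PosSemidef := by
  have key : ∀ s : Finset (Fin n),
      (Matrix.of fun a b : ι => ∏ i ∈ s, ⟪v a i, v b i⟫_ℂ).PosSemidef := by
    intro s
    induction s using Finset.cons_induction with
    | empty =>
      have h := Matrix.posSemidef_gram ℂ (fun _ : ι => (1 : ℂ))
      have e : (Matrix.of fun a b : ι => ∏ i ∈ (∅ : Finset (Fin n)), ⟪v a i, v b i⟫_ℂ) =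
          Matrix.gram ℂ (fun _ : ι => (1 : ℂ)) := by
        ext a b
        simp
      rw [e]
      exact h
    | cons k s hk ih =>
      have h := (Matrix.posSemidef_gram ℂ (fun a : ι => v a k)).hadamard ih
      have e : (Matrix.of fun a b : ι => ∏ i ∈ Finset.cons k s hk, ⟪v a i, v b i⟫_ℂ) =
          Matrix.hadamard (Matrix.gram ℂ (fun a : ι => v a k))
            (Matrix.of fun a b : ι => ∏ i ∈ s, ⟪v a i, v b i⟫_ℂ) := by
        ext a b
        simp [Finset.prod_insert hk]
      rw [e]
      exact h
  exact key Finset.univ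

theorem symKernel_nonneg {n : ℕ} (c : (Fin n → H) →₀ ℂ) :
    0 ≤ c.sum fun f a => c.sum fun g b => conj a * b * symKernel f g := by
  have h := (posSemidef_prod (fun p : c.support × Equiv.Perm (Fin n) =>
    fun i => (p.1 : Fin n → H) (p.2 i))).dotProduct_mulVec_nonneg (fun p => c p.1)
  have e : (c.sum fun f a => c.sum fun g b => conj a * b * symKernel f g) =
      (((n.factorial : ℝ)⁻¹ ^ 2 : ℝ) : ℂ) *
        ∑ p : c.support × Equiv.Perm (Fin n), ∑ q : c.support × Equiv.Perm (Fin n),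
          conj (c p.1) * ((∏ i, ⟪(p.1 : Fin n → H) (p.2 i), (q.1 : Fin n → H) (q.2 i)⟫_ℂ) *
            c q.1) := by
    simp only [Fintype.sum_prod_type, Finsupp.sum]
    rw [← Finset.sum_coe_sort c.support, Finset.mul_sum]
    refine Finset.sum_congr rfl fun f _ => ?_
    rw [← Finset.sum_coe_sort c.support, Finset.sum_comm, Finset.mul_sum]
    refine Finset.sum_congr rfl fun g _ => ?_
    rw [symKernel_eq]
    simp only [Finset.mul_sum]
    refine Finset.sum_congr rfl fun τ _ => Finset.sum_congr rfl fun σ _ => ?_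
    push_cast
    ring
  rw [e]
  refine mul_nonneg (by exact_mod_cast by positivity) ?_
  simpa [dotProduct, Matrix.mulVec, Finset.mul_sum] using h

/-- The positive semidefinite scalar product on formal combinations of symmetric tensors. -/
instance instCore (n : ℕ) : PreInnerProductSpace.Core ℂ (PreTensor n H) where
  inner c d := Finsupp.sum c fun f a => Finsupp.sum d fun g b => conj a * b * symKernel f g
  conj_inner_symm c d := by
    rw [Finsupp.sum_comm]
    simp only [map_finsuppSum]
    refine Finsupp.sum_congr fun f _ => Finsupp.sum_congr fun g _ => ?_
    simp only [map_mul, symKernel_conj, Complex.conj_conj]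
    ring
  re_inner_nonneg c := (Complex.nonneg_iff.1 (symKernel_nonneg (H := H) c)).1
  add_left c d e := by
    refine Finsupp.sum_add_index' ?_ ?_ <;> simp [← Finsupp.sum_add, add_mul]
  smul_left c d r := by
    refine (Finsupp.sum_smul_index ?_).trans ?_ <;> simp [Finsupp.mul_sum, mul_assoc]

instance (n : ℕ) : SeminormedAddCommGroup (PreTensor n H) :=
  InnerProductSpace.Core.toSeminormedAddCommGroup (𝕜 := ℂ)

instance (n : ℕ) : InnerProductSpace ℂ (PreTensor n H) := .ofCore (instCore n)

/-- The formal symmetric tensor `f₀ ⊗ₛ ⋯ ⊗ₛ fₙ₋₁`. -/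
def preTensor {n : ℕ} (f : Fin n → H) : PreTensor n H := Finsupp.single f (1 : ℂ)

theorem inner_preTensor {n : ℕ} (f g : Fin n → H) :
    ⟪preTensor f, preTensor g⟫_ℂ = symKernel f g := by
  change Finsupp.sum _ _ = _
  simp [preTensor]

/-- Prepending a factor: `g ↦ √(n+1) h ⊗ₛ g`. -/
def preCreation (n : ℕ) (h : H) : PreTensor n H →ₗ[ℂ] PreTensor (n + 1) H :=
  Finsupp.linearCombination ℂ fun g : Fin n → H =>
    ((√(n + 1 : ℝ) : ℝ) : ℂ) • preTensor (Fin.cons h g : Fin (n + 1) → H)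

/-- Contracting one factor: `g ↦ (n+1)^{-1/2} ∑ⱼ ⟨h, gⱼ⟩ g₀ ⊗ₛ ⋯ ĝⱼ ⋯ ⊗ₛ gₙ`. -/
def preAnnihilation (n : ℕ) (h : H) : PreTensor (n + 1) H →ₗ[ℂ] PreTensor n H :=
  Finsupp.linearCombination ℂ fun g : Fin (n + 1) → H =>
    (((√(n + 1 : ℝ))⁻¹ : ℝ) : ℂ) • ∑ j, ⟪h, g j⟫_ℂ • preTensor (j.removeNth g)

theorem preCreation_preTensor (n : ℕ) (h : H) (g : Fin n → H) :
    preCreation n h (preTensor g) =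
      ((√(n + 1 : ℝ) : ℝ) : ℂ) • preTensor (Fin.cons h g : Fin (n + 1) → H) := by
  simp [preCreation, preTensor]

theorem preAnnihilation_preTensor (n : ℕ) (h : H) (g : Fin (n + 1) → H) :
    preAnnihilation n h (preTensor g) =
      (((√(n + 1 : ℝ))⁻¹ : ℝ) : ℂ) • ∑ j, ⟪h, g j⟫_ℂ • preTensor (j.removeNth g) := by
  simp [preAnnihilation, preTensor]

/-- Expansion of the kernel along the first factor. -/
theorem symKernel_cons (n : ℕ) (h : H) (f : Fin n → H) (g : Fin (n + 1) → H) :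
    symKernel (Fin.cons h f : Fin (n + 1) → H) g =
      ((n + 1 : ℕ) : ℂ)⁻¹ * ∑ j, ⟪h, g j⟫_ℂ * symKernel f (j.removeNth g) := by
  have key : ∀ j : Fin (n + 1), ∑ e : Equiv.Perm (Fin n),
      ∏ i, ⟪f i, g (Equiv.swap 0 j (e i).succ)⟫_ℂ =
      ∑ e : Equiv.Perm (Fin n), ∏ i, ⟪f i, j.removeNth g (e i)⟫_ℂ := by
    intro j
    refine Fin.cases ?_ (fun k => ?_) j
    · simp [Fin.removeNth]
    · rcases n with _ | n
      · exact k.elim0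
      rw [← Equiv.sum_comp (Equiv.mulLeft k.cycleRange) (fun e : Equiv.Perm (Fin (n + 1)) =>
        ∏ i, ⟪f i, k.succ.removeNth g (e i)⟫_ℂ)]
      refine Finset.sum_congr rfl fun e _ => Finset.prod_congr rfl fun i _ => ?_
      simp [Fin.removeNth, Fin.succAbove_cycleRange]
  simp only [symKernel]
  rw [← Equiv.sum_comp Equiv.Perm.decomposeFin.symm, Fintype.sum_prod_type]
  simp only [Fin.prod_univ_succ, Fin.cons_zero, Fin.cons_succ,
    Equiv.Perm.decomposeFin_symm_apply_zero, Equiv.Perm.decomposeFin_symm_apply_succ]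
  simp only [← Finset.mul_sum, key, Nat.factorial_succ, Nat.cast_mul, mul_inv]
  rw [mul_assoc]
  congr 1
  rw [Finset.mul_sum]
  exact Finset.sum_congr rfl fun j _ => by ring

theorem inner_self_eq_ofReal {E : Type*} [SeminormedAddCommGroup E] [InnerProductSpace ℂ E] (x : E) :
    ⟪x, x⟫_ℂ = ((‖x‖ ^ 2 : ℝ) : ℂ) := by
  rw [inner_self_eq_norm_sq_to_K]
  push_cast
  rfl

theorem preTensor_induction {n : ℕ} {p : PreTensor n H → Prop} (h0 : p 0)
    (hadd : ∀ x y, p x → p y → p (x + y)) (hs : ∀ (a : ℂ) g, p (a • preTensor g)) (x) : p x := by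
  induction x using Finsupp.induction_linear with
  | zero => exact h0
  | add c d hc hd => exact hadd _ _ hc hd
  | single g a =>
    have : (Finsupp.single g a : PreTensor n H) = a • preTensor g := by simp [preTensor]
    rw [this]
    exact hs a g

theorem inner_preCreation (n : ℕ) (h : H) (x : PreTensor n H) (y : PreTensor (n + 1) H) :
    ⟪preCreation n h x, y⟫_ℂ = ⟪x, preAnnihilation n h y⟫_ℂ := by
  induction x using preTensor_induction with
  | h0 => simp
  | hadd x x' hx hx' => simp only [map_add, inner_add_left, hx, hx']
  | hs a f =>
    induction y using preTensor_induction with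
    | h0 => simp
    | hadd y y' hy hy' => simp only [map_add, inner_add_right, hy, hy']
    | hs b g =>
      simp only [map_smul, preCreation_preTensor, preAnnihilation_preTensor, inner_smul_left,
        inner_smul_right, inner_sum, inner_preTensor, symKernel_cons, Complex.conj_ofReal]
      have h1 : (((√(n + 1 : ℝ))⁻¹ : ℝ) : ℂ) =
          ((√(n + 1 : ℝ) : ℝ) : ℂ) * ((n + 1 : ℕ) : ℂ)⁻¹ := by
        have h2 : (√(n + 1 : ℝ))⁻¹ = √(n + 1 : ℝ) * ((n + 1 : ℕ) : ℝ)⁻¹ := by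
          have h3 : √(n + 1 : ℝ) ≠ 0 := by positivity
          have h4 : √(n + 1 : ℝ) * √(n + 1 : ℝ) = n + 1 := Real.mul_self_sqrt (by positivity)
          rw [eq_mul_inv_iff_mul_eq₀ (by positivity), inv_mul_eq_iff_eq_mul₀ h3]
          push_cast
          exact h4.symm
        rw [h2]
        push_cast
        rfl
      rw [h1]
      simp only [Finset.mul_sum]
      exact Finset.sum_congr rfl fun j _ => by ring

theorem preAnnihilation_preCreation_zero (h : H) (x : PreTensor 0 H) :
    preAnnihilation 0 h (preCreation 0 h x) = ⟪h, h⟫_ℂ • x := by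
  induction x using preTensor_induction with
  | h0 => simp
  | hadd x x' hx hx' => simp only [map_add, smul_add, hx, hx']
  | hs a f =>
    simp [map_smul, preCreation_preTensor, preAnnihilation_preTensor, smul_comm a]

theorem preAnnihilation_preCreation_succ (n : ℕ) (h : H) (x : PreTensor (n + 1) H) :
    preAnnihilation (n + 1) h (preCreation (n + 1) h x) =
      ⟪h, h⟫_ℂ • x + preCreation n h (preAnnihilation n h x) := by
  induction x using preTensor_induction with
  | h0 => simp
  | hadd x x' hx hx' => simp only [map_add, smul_add, hx, hx']; abel
  | hs a f =>
    have h1 : ∀ m : ℕ, ((√(m + 1 : ℝ) : ℝ) : ℂ) * (((√(m + 1 : ℝ))⁻¹ : ℝ) : ℂ) = 1 := by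
      intro m
      rw [← Complex.ofReal_mul, mul_inv_cancel₀ (by positivity), Complex.ofReal_one]
    have h2 : ∀ i : Fin (n + 1), (i.succ.removeNth (Fin.cons h f : Fin (n + 2) → H)) =
        (Fin.cons h (i.removeNth f) : Fin (n + 1) → H) := by
      intro i
      ext k
      refine Fin.cases ?_ (fun k => ?_) k <;> simp [Fin.removeNth]
    simp only [map_smul, preCreation_preTensor, preAnnihilation_preTensor, map_sum]
    rw [smul_smul _ _ (∑ j, _), h1, one_smul, Fin.sum_univ_succ]
    simp only [Fin.cons_zero, Fin.cons_succ, h2, smul_comm _ ((√(n + 1 : ℝ) : ℝ) : ℂ),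
      ← Finset.smul_sum]
    rw [smul_comm ((√(n + 1 : ℝ) : ℝ) : ℂ) a, smul_smul ((√(n + 1 : ℝ) : ℝ) : ℂ), h1, one_smul,
      smul_add, smul_comm a]
    simp

theorem norm_preCreation_le (n : ℕ) (h : H) (x : PreTensor n H) :
    ‖preCreation n h x‖ ≤ √(n + 1 : ℝ) * ‖h‖ * ‖x‖ := by
  have key : ∀ n : ℕ, ∀ x : PreTensor n H,
      ‖preCreation n h x‖ ^ 2 ≤ (n + 1 : ℝ) * ‖h‖ ^ 2 * ‖x‖ ^ 2 := by
    intro n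
    induction n with
    | zero =>
      intro x
      have e : (((‖preCreation 0 h x‖ ^ 2 : ℝ)) : ℂ) = ((‖h‖ ^ 2 * ‖x‖ ^ 2 : ℝ) : ℂ) := by
        rw [← inner_self_eq_ofReal, inner_preCreation, preAnnihilation_preCreation_zero,
          inner_smul_right, inner_self_eq_ofReal, inner_self_eq_ofReal, Complex.ofReal_mul]
      have e' := Complex.ofReal_injective e
      rw [e']
      simp
    | succ n ih =>
      intro x
      have e : (((‖preCreation (n + 1) h x‖ ^ 2 : ℝ)) : ℂ) =
          ((‖h‖ ^ 2 * ‖x‖ ^ 2 + ‖preAnnihilation n h x‖ ^ 2 : ℝ) : ℂ) := by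
        rw [← inner_self_eq_ofReal, inner_preCreation, preAnnihilation_preCreation_succ,
          inner_add_right, inner_smul_right, ← inner_conj_symm x (preCreation _ _ _),
          inner_preCreation, inner_conj_symm, inner_self_eq_ofReal, inner_self_eq_ofReal,
          inner_self_eq_ofReal, Complex.ofReal_add, Complex.ofReal_mul]
      have e' := Complex.ofReal_injective e
      rw [e']
      have h1 : ‖preAnnihilation n h x‖ ^ 2 ≤
          ‖preCreation n h (preAnnihilation n h x)‖ * ‖x‖ := by
        have : ‖(⟪preAnnihilation n h x, preAnnihilation n h x⟫_ℂ)‖ =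
            ‖preAnnihilation n h x‖ ^ 2 := by
          rw [inner_self_eq_ofReal, Complex.norm_of_nonneg (by positivity)]
        rw [← this, ← inner_preCreation]
        exact norm_inner_le_norm _ _
      have h2 := ih (preAnnihilation n h x)
      have h3 : ‖preAnnihilation n h x‖ ^ 2 ≤ (n + 1 : ℝ) * ‖h‖ ^ 2 * ‖x‖ ^ 2 := by
        set a := ‖preAnnihilation n h x‖
        set b := ‖preCreation n h (preAnnihilation n h x)‖
        by_cases ha : a = 0
        · rw [ha, zero_pow two_ne_zero]; positivity
        have ha' : 0 < a ^ 2 := pow_pos (lt_of_le_of_ne (norm_nonneg _) (Ne.symm ha)) 2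
        have h4 : (a ^ 2) ^ 2 ≤ b ^ 2 * ‖x‖ ^ 2 := by
          rw [← mul_pow]; exact pow_le_pow_left₀ (by positivity) h1 2
        have h5 : b ^ 2 * ‖x‖ ^ 2 ≤ (n + 1 : ℝ) * ‖h‖ ^ 2 * a ^ 2 * ‖x‖ ^ 2 :=
          mul_le_mul_of_nonneg_right h2 (by positivity)
        have h6 : a ^ 2 * a ^ 2 ≤ a ^ 2 * ((n + 1 : ℝ) * ‖h‖ ^ 2 * ‖x‖ ^ 2) := by nlinarith
        exact le_of_mul_le_mul_left h6 ha'
      push_cast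
      nlinarith
  have h0 := key n x
  have : ((n + 1 : ℝ) * ‖h‖ ^ 2 * ‖x‖ ^ 2) = (√(n + 1 : ℝ) * ‖h‖ * ‖x‖) ^ 2 := by
    rw [mul_pow, mul_pow, Real.sq_sqrt (by positivity)]
  rw [this] at h0
  exact (sq_le_sq₀ (norm_nonneg _) (by positivity)).1 h0

/-- The `n`-particle space: the Hilbert space spanned by symmetric tensors of `n` vectors. -/
def NParticle (n : ℕ) (H : Type*) [NormedAddCommGroup H] [InnerProductSpace ℂ H] : Type _ :=
  UniformSpace.Completion (PreTensor n H)

instance (n : ℕ) : NormedAddCommGroup (NParticle n H) :=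
  inferInstanceAs (NormedAddCommGroup (UniformSpace.Completion (PreTensor n H)))

instance (n : ℕ) : InnerProductSpace ℂ (NParticle n H) :=
  inferInstanceAs (InnerProductSpace ℂ (UniformSpace.Completion (PreTensor n H)))

instance (n : ℕ) : CompleteSpace (NParticle n H) :=
  inferInstanceAs (CompleteSpace (UniformSpace.Completion (PreTensor n H)))

/-- The canonical map from formal combinations of symmetric tensors to the `n`-particle space. -/
def NParticle.of (n : ℕ) : PreTensor n H →ₗᵢ[ℂ] NParticle n H :=
  UniformSpace.Completion.toComplₗᵢ

theorem NParticle.denseRange_of (n : ℕ) : DenseRange (NParticle.of (H := H) n) :=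
  UniformSpace.Completion.denseRange_coe

/-- The symmetric tensor product `f₀ ⊗ₛ ⋯ ⊗ₛ fₙ₋₁`. -/
def symTensor {n : ℕ} (f : Fin n → H) : NParticle n H := NParticle.of n (preTensor f)

theorem inner_symTensor {n : ℕ} (f g : Fin n → H) :
    ⟪symTensor f, symTensor g⟫_ℂ = symKernel f g := by
  rw [symTensor, symTensor, LinearIsometry.inner_map_map, inner_preTensor]

/-- The restriction of the creation operator `a*(h)` to the `n`-particle space, determined by
`a*(h) (g₀ ⊗ₛ ⋯ ⊗ₛ gₙ₋₁) = √(n+1) h ⊗ₛ g₀ ⊗ₛ ⋯ ⊗ₛ gₙ₋₁`. -/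
def creation (n : ℕ) (h : H) : NParticle n H →L[ℂ] NParticle (n + 1) H :=
  ContinuousLinearMap.completion (α := PreTensor n H) (β := PreTensor (n + 1) H)
    ((preCreation n h).mkContinuous (√(n + 1 : ℝ) * ‖h‖) (norm_preCreation_le n h))

/-- The restriction of the annihilation operator `a(h)`, the adjoint of `a*(h)`, to the
`(n+1)`-particle space. (On the vacuum, `a(h)` vanishes.) -/
def annihilation (n : ℕ) (h : H) : NParticle (n + 1) H →L[ℂ] NParticle n H :=
  ContinuousLinearMap.adjoint (creation n h)

theorem creation_of (n : ℕ) (h : H) (x : PreTensor n H) :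
    creation n h (NParticle.of n x) = NParticle.of (n + 1) (preCreation n h x) :=
  ContinuousLinearMap.completion_apply_coe
    ((preCreation n h).mkContinuous (√(n + 1 : ℝ) * ‖h‖) (norm_preCreation_le n h)) x

theorem annihilation_of (n : ℕ) (h : H) (x : PreTensor (n + 1) H) :
    annihilation n h (NParticle.of (n + 1) x) = NParticle.of n (preAnnihilation n h x) := by
  refine (NParticle.denseRange_of n).eq_of_inner_right ℂ fun y => ?_
  rw [annihilation, ContinuousLinearMap.adjoint_inner_right, creation_of,
    LinearIsometry.inner_map_map, LinearIsometry.inner_map_map, inner_preCreation]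

theorem creation_symTensor (n : ℕ) (h : H) (g : Fin n → H) :
    creation n h (symTensor g) =
      ((√(n + 1 : ℝ) : ℝ) : ℂ) • symTensor (Fin.cons h g : Fin (n + 1) → H) := by
  rw [symTensor, creation_of, preCreation_preTensor, map_smul, symTensor]

/-- The restriction of `N_h = a*(h) a(h)` to the `n`-particle space. -/
def modeNumber (h : H) : (n : ℕ) → (NParticle n H →L[ℂ] NParticle n H)
  | 0 => 0
  | n + 1 => creation n h ∘L annihilation n h

theorem annihilation_creation (n : ℕ) (h : H) (x : NParticle n H) :
    annihilation n h (creation n h x) = ⟪h, h⟫_ℂ • x + modeNumber h n x := by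
  have key : (annihilation n h ∘ creation n h) = fun x => ⟪h, h⟫_ℂ • x + modeNumber h n x := by
    refine (NParticle.denseRange_of n).equalizer
      ((annihilation n h).continuous.comp (creation n h).continuous)
      (Continuous.add (continuous_const_smul _) (modeNumber h n).continuous) ?_
    ext x
    simp only [Function.comp_apply, creation_of, annihilation_of]
    cases n with
    | zero => simp [modeNumber, preAnnihilation_preCreation_zero]
    | succ n =>
      simp only [preAnnihilation_preCreation_succ, modeNumber, map_add, map_smul,
        ContinuousLinearMap.comp_apply, annihilation_of, creation_of]
  exact congrFun key x

theorem modeNumber_nonneg (h : H) (n : ℕ) : (modeNumber h n).IsPositive := by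
  cases n with
  | zero => exact ContinuousLinearMap.isPositive_zero
  | succ n =>
    have := ContinuousLinearMap.isPositive_self_comp_adjoint (creation n h)
    exact this

/-- The restriction of `(1 + N_h)^{-1/2}` to the `n`-particle space (functional calculus). -/
def invSqrtModeNumber (h : H) (n : ℕ) : NParticle n H →L[ℂ] NParticle n H :=
  cfc (fun x : ℝ => (1 + x) ^ (-(1 / 2) : ℝ)) (modeNumber h n)

/-- The restriction of `W_h = a*(h) (1 + N_h)^{-1/2}` to the `n`-particle space. -/
def raising (h : H) (n : ℕ) : NParticle n H →L[ℂ] NParticle (n + 1) H :=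
  creation n h ∘L invSqrtModeNumber h n

theorem invSqrt_mul (h : H) (n : ℕ) :
    invSqrtModeNumber h n * ((1 + modeNumber h n) * invSqrtModeNumber h n) = 1 := by
  have hp := modeNumber_nonneg h n
  have hsa : IsSelfAdjoint (modeNumber h n) := hp.isSelfAdjoint
  have hnn : 0 ≤ modeNumber h n := (ContinuousLinearMap.nonneg_iff_isPositive _).2 hp
  have hspec : ∀ x ∈ spectrum ℝ (modeNumber h n), 0 ≤ x := fun x hx =>
    spectrum_nonneg_of_nonneg hnn hx
  have hc : ContinuousOn (fun x : ℝ => (1 + x) ^ (-(1 / 2) : ℝ)) (spectrum ℝ (modeNumber h n)) := by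
    refine ContinuousOn.rpow_const (by fun_prop) fun x hx => Or.inl ?_
    have := hspec x hx
    positivity
  have h1 : (1 + modeNumber h n) = cfc (fun x : ℝ => 1 + x) (modeNumber h n) := by
    rw [cfc_const_add (R := ℝ) 1 (fun x => x) _ (by fun_prop), cfc_id' ℝ (modeNumber h n)]
    simp
  rw [h1, invSqrtModeNumber, ← cfc_mul _ _ _ (by fun_prop) hc, ← cfc_mul _ _ _ hc (by fun_prop)]
  rw [← cfc_one ℝ (modeNumber h n)]
  refine cfc_congr fun x hx => ?_
  have h0 : (0 : ℝ) < 1 + x := by have := hspec x hx; positivity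
  have h2 : (1 + x) ^ (-(1 / 2) : ℝ) * (1 + x) ^ (-(1 / 2) : ℝ) = (1 + x)⁻¹ := by
    rw [← Real.rpow_add h0, ← Real.rpow_neg_one]; norm_num
  change (1 + x) ^ (-(1 / 2) : ℝ) * ((1 + x) * (1 + x) ^ (-(1 / 2) : ℝ)) = 1
  rw [mul_left_comm, h2, mul_inv_cancel₀ h0.ne']

theorem norm_raising (h : H) (hh : ‖h‖ = 1) (n : ℕ) (x : NParticle n H) :
    ‖raising h n x‖ = ‖x‖ := by
  have hB : IsSelfAdjoint (invSqrtModeNumber h n) := cfc_predicate _ _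
  have e : ⟪raising h n x, raising h n x⟫_ℂ = ⟪x, x⟫_ℂ := by
    have e1 : (invSqrtModeNumber h n) ((1 + modeNumber h n) ((invSqrtModeNumber h n) x)) = x :=
      congrArg (fun T : NParticle n H →L[ℂ] NParticle n H => T x) (invSqrt_mul h n)
    have e2 : ⟪x, x⟫_ℂ = ⟪x, (invSqrtModeNumber h n) ((1 + modeNumber h n)
        ((invSqrtModeNumber h n) x))⟫_ℂ := by rw [e1]
    rw [e2]
    simp only [raising, ContinuousLinearMap.comp_apply]
    rw [← ContinuousLinearMap.adjoint_inner_right, ← annihilation, annihilation_creation,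
      inner_self_eq_ofReal h, hh]
    rw [← ContinuousLinearMap.adjoint_inner_left, ← ContinuousLinearMap.star_eq_adjoint, hB.star_eq]
    simp
  rw [inner_self_eq_ofReal, inner_self_eq_ofReal] at e
  have e' := Complex.ofReal_injective e
  exact (sq_eq_sq₀ (norm_nonneg _) (norm_nonneg _)).1 e'

/-- The bosonic Fock space: the Hilbert space direct sum of all `n`-particle spaces. -/
def Fock (H : Type*) [NormedAddCommGroup H] [InnerProductSpace ℂ H] : Type _ :=
  lp (fun n : ℕ => NParticle n H) 2

instance : NormedAddCommGroup (Fock H) :=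
  inferInstanceAs (NormedAddCommGroup (lp (fun n : ℕ => NParticle n H) 2))

instance : InnerProductSpace ℂ (Fock H) :=
  inferInstanceAs (InnerProductSpace ℂ (lp (fun n : ℕ => NParticle n H) 2))

instance : CompleteSpace (Fock H) :=
  inferInstanceAs (CompleteSpace (lp (fun n : ℕ => NParticle n H) 2))

namespace Fock

/-- The `n`-particle component of a vector in Fock space. -/
def sector (ψ : Fock H) (n : ℕ) : NParticle n H :=
  (show lp (fun n : ℕ => NParticle n H) 2 from ψ).1 n

theorem memℓp_iff (ψ : ∀ n, NParticle n H) : Memℓp ψ 2 ↔ Summable fun n => ‖ψ n‖ ^ 2 := by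
  rw [memℓp_gen_iff (by norm_num)]
  simp

/-- The vector with given components. -/
def mk (ψ : ∀ n, NParticle n H) (hψ : Summable fun n => ‖ψ n‖ ^ 2) : Fock H :=
  (⟨ψ, (memℓp_iff ψ).2 hψ⟩ : lp (fun n : ℕ => NParticle n H) 2)

@[simp] theorem sector_mk (ψ : ∀ n, NParticle n H) (hψ) (n : ℕ) : (mk ψ hψ).sector n = ψ n := rfl

@[simp] theorem sector_zero (n : ℕ) : (0 : Fock H).sector n = 0 := rfl

@[simp] theorem sector_add (ψ χ : Fock H) (n : ℕ) :
    (ψ + χ).sector n = ψ.sector n + χ.sector n := rfl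

@[simp] theorem sector_smul (c : ℂ) (ψ : Fock H) (n : ℕ) :
    (c • ψ).sector n = c • ψ.sector n := rfl

theorem ext {ψ χ : Fock H} (h : ∀ n, ψ.sector n = χ.sector n) : ψ = χ :=
  Subtype.ext (funext h)

theorem summable_sq (ψ : Fock H) : Summable fun n => ‖ψ.sector n‖ ^ 2 :=
  (memℓp_iff _).1 (lp.memℓp (show lp (fun n : ℕ => NParticle n H) 2 from ψ))

theorem norm_sq (ψ : Fock H) : ‖ψ‖ ^ 2 = ∑' n, ‖ψ.sector n‖ ^ 2 := by
  have := lp.norm_rpow_eq_tsum (p := 2) (by norm_num)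
    (show lp (fun n : ℕ => NParticle n H) 2 from ψ)
  simp only [ENNReal.toReal_ofNat, Real.rpow_ofNat] at this
  exact this

theorem hasSum_inner (ψ χ : Fock H) :
    HasSum (fun n => ⟪ψ.sector n, χ.sector n⟫_ℂ) ⟪ψ, χ⟫_ℂ :=
  lp.hasSum_inner (𝕜 := ℂ) (show lp (fun n : ℕ => NParticle n H) 2 from ψ) χ

end Fock

/-- The bounded operators on Fock space. -/
abbrev Operators (H : Type*) [NormedAddCommGroup H] [InnerProductSpace ℂ H] : Type _ :=
  Fock H →L[ℂ] Fock H

/-- The subspace `⨁_{k ≤ n} F_k` of vectors with at most `n` particles. -/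
def lowParticles (n : ℕ) (H : Type*) [NormedAddCommGroup H] [InnerProductSpace ℂ H] :
    Submodule ℂ (Fock H) where
  carrier := {ψ | ∀ k, n < k → ψ.sector k = 0}
  zero_mem' _ _ := rfl
  add_mem' {ψ χ} hψ hχ k hk := by rw [Fock.sector_add, hψ k hk, hχ k hk, add_zero]
  smul_mem' c ψ hψ k hk := by rw [Fock.sector_smul, hψ k hk, smul_zero]

/-- The subspace of vectors with finite particle number. -/
def finiteParticles (H : Type*) [NormedAddCommGroup H] [InnerProductSpace ℂ H] :
    Submodule ℂ (Fock H) where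
  carrier := {ψ | ∃ n, ψ ∈ lowParticles n H}
  zero_mem' := ⟨0, zero_mem _⟩
  add_mem' := by
    rintro ψ χ ⟨m, hm⟩ ⟨n, hn⟩
    exact ⟨max m n, add_mem (fun k hk => hm k (by omega)) (fun k hk => hn k (by omega))⟩
  smul_mem' := by
    rintro c ψ ⟨n, hn⟩
    exact ⟨n, Submodule.smul_mem _ _ hn⟩

/-- The components of `a*(h) ψ`. -/
def creationComponents (h : H) (ψ : Fock H) : ∀ n, NParticle n H
  | 0 => 0
  | n + 1 => creation n h (ψ.sector n)

/-- The components of `a(h) ψ`. -/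
def annihilationComponents (h : H) (ψ : Fock H) (n : ℕ) : NParticle n H :=
  annihilation n h (ψ.sector (n + 1))

/-- The field operator `φ(h) = a*(h) + a(h)` on the vectors with finite particle number. -/
def fieldMap (h : H) : finiteParticles H →ₗ[ℂ] Fock H where
  toFun ψ := Fock.mk (fun n => creationComponents h ψ n + annihilationComponents h ψ n) <| by
    obtain ⟨ψ, m, hm⟩ := ψ
    refine summable_of_ne_finset_zero (s := Finset.range (m + 2)) fun k hk => ?_
    rw [Finset.mem_range, not_lt] at hk
    obtain ⟨k, rfl⟩ : ∃ j, k = j + 1 := ⟨k - 1, by omega⟩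
    simp only [creationComponents, annihilationComponents, hm k (by omega),
      hm (k + 1 + 1) (by omega), map_zero, add_zero, norm_zero, ne_eq, OfNat.ofNat_ne_zero,
      not_false_eq_true, zero_pow]
  map_add' := fun ψ χ => Fock.ext fun n => by
    cases n <;>
    simp only [creationComponents, annihilationComponents, Fock.sector_mk, Fock.sector_add,
      Submodule.coe_add, map_add] <;> abel
  map_smul' := fun c ψ => Fock.ext fun n => by
    cases n <;>
    simp only [creationComponents, annihilationComponents, Fock.sector_mk, Fock.sector_smul,
      Submodule.coe_smul, map_smul, smul_add, RingHom.id_apply, smul_zero]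

/-- The field operator, as a densely defined operator on Fock space. -/
def fieldOp (h : H) : Fock H →ₗ.[ℂ] Fock H := ⟨finiteParticles H, fieldMap h⟩

/-- The particle number operator `N`, with its natural domain. -/
def numberOp (H : Type*) [NormedAddCommGroup H] [InnerProductSpace ℂ H] :
    Fock H →ₗ.[ℂ] Fock H where
  domain :=
    { carrier := {ψ | Summable fun n : ℕ => ‖(n : ℂ) • ψ.sector n‖ ^ 2}
      zero_mem' := by
        simp only [Set.mem_ofPred_eq, Fock.sector_zero, smul_zero, norm_zero, ne_eq,
          OfNat.ofNat_ne_zero, not_false_eq_true, zero_pow]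
        exact summable_zero
      add_mem' := fun {ψ χ} hψ hχ => by
        refine Summable.of_nonneg_of_le (fun n => by positivity) (fun n => ?_)
          ((hψ.add hχ).mul_left 2)
        rw [Fock.sector_add, smul_add]
        have h1 := norm_add_le ((n : ℂ) • ψ.sector n) ((n : ℂ) • χ.sector n)
        nlinarith [norm_nonneg ((n : ℂ) • ψ.sector n + (n : ℂ) • χ.sector n),
          sq_nonneg (‖(n : ℂ) • ψ.sector n‖ - ‖(n : ℂ) • χ.sector n‖)]
      smul_mem' := fun c ψ hψ => by
        refine (hψ.mul_left (‖c‖ ^ 2)).congr fun n => ?_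
        rw [Fock.sector_smul, smul_comm, norm_smul c, mul_pow] }
  toFun :=
    { toFun := fun ψ => Fock.mk (fun n : ℕ => (n : ℂ) • (ψ : Fock H).sector n) ψ.2
      map_add' := fun ψ χ => Fock.ext fun n => by
        simp only [Fock.sector_mk, Fock.sector_add, Submodule.coe_add, smul_add]
      map_smul' := fun c ψ => Fock.ext fun n => by
        simp only [Fock.sector_mk, Fock.sector_smul, Submodule.coe_smul, RingHom.id_apply,
          smul_comm c] }

theorem norm_phase_smul (u : ℝ) (n : ℕ) (x : NParticle n H) :
    ‖Complex.exp (Complex.I * u * n) • x‖ = ‖x‖ := by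
  rw [norm_smul, Complex.norm_exp]
  simp

/-- The unitary operator `e^{iuN}`, acting on the `n`-particle space by the factor `e^{iun}`. -/
def gaugeUnitary (u : ℝ) : Operators H :=
  LinearMap.mkContinuous
    { toFun := fun ψ => Fock.mk (fun n : ℕ => Complex.exp (Complex.I * u * n) • ψ.sector n) <| by
        simp only [norm_phase_smul]
        exact ψ.summable_sq
      map_add' := fun ψ χ => Fock.ext fun n => by
        simp only [Fock.sector_mk, Fock.sector_add, smul_add]
      map_smul' := fun c ψ => Fock.ext fun n => by
        simp only [Fock.sector_mk, Fock.sector_smul, RingHom.id_apply, smul_comm c] }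
    1 fun ψ => by
      rw [one_mul, ← sq_le_sq₀ (norm_nonneg _) (norm_nonneg _), Fock.norm_sq, Fock.norm_sq]
      refine le_of_eq (tsum_congr fun n => ?_)
      simp only [LinearMap.coe_mk, AddHom.coe_mk, Fock.sector_mk, norm_phase_smul]

/-- The components of `W_h ψ`, where `W_h = a*(h) (1 + N_h)^{-1/2}`. -/
def raisingComponents (h : H) (ψ : Fock H) : ∀ n, NParticle n H
  | 0 => 0
  | n + 1 => raising h n (ψ.sector n)

/-- The isometry `W_h = a*(h) (1 + N_h)^{-1/2}` of Fock space, for a unit vector `h`. -/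
def isometryW (h : H) (hh : ‖h‖ = 1) : Operators H :=
  LinearMap.mkContinuous
    { toFun := fun ψ => Fock.mk (raisingComponents h ψ) <| by
        rw [← summable_nat_add_iff 1]
        simp only [raisingComponents, norm_raising h hh]
        exact ψ.summable_sq
      map_add' := fun ψ χ => Fock.ext fun n => by
        cases n <;>
        simp only [raisingComponents, Fock.sector_mk, Fock.sector_add, map_add, add_zero]
      map_smul' := fun c ψ => Fock.ext fun n => by
        cases n <;>
        simp only [raisingComponents, Fock.sector_mk, Fock.sector_smul, RingHom.id_apply, map_smul,
          smul_zero] }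
    1 fun ψ => by
      rw [one_mul, ← sq_le_sq₀ (norm_nonneg _) (norm_nonneg _), Fock.norm_sq, Fock.norm_sq]
      refine le_of_eq ?_
      rw [Summable.tsum_eq_zero_add (Fock.summable_sq _)]
      simp only [LinearMap.coe_mk, AddHom.coe_mk, Fock.sector_mk, raisingComponents,
        norm_raising h hh, norm_zero, ne_eq, OfNat.ofNat_ne_zero, not_false_eq_true, zero_pow,
        zero_add]

theorem norm_creation_le (n : ℕ) (h : H) (x : NParticle n H) :
    ‖creation n h x‖ ≤ √(n + 1 : ℝ) * ‖h‖ * ‖x‖ := by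
  refine (NParticle.denseRange_of n).induction_on
    (p := fun x => ‖creation n h x‖ ≤ √(n + 1 : ℝ) * ‖h‖ * ‖x‖) x ?_ fun y => ?_
  · exact isClosed_le (creation n h).continuous.norm (continuous_const.mul continuous_norm)
  · rw [creation_of, LinearIsometry.norm_map, LinearIsometry.norm_map]
    exact norm_preCreation_le n h y

/-- The embedding of the `n`-particle space into Fock space. -/
def inSector (n : ℕ) (x : NParticle n H) : Fock H :=
  Fock.mk (Pi.single n x) <| summable_of_ne_finset_zero (s := {n}) fun k hk => by
    rw [Pi.single_eq_of_ne (by simpa using hk), norm_zero, zero_pow two_ne_zero]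

theorem inSector_self (n : ℕ) (x : NParticle n H) : (inSector n x).sector n = x :=
  Pi.single_eq_same (M := fun n => NParticle n H) n x

theorem inSector_ne {n k : ℕ} (x : NParticle n H) (hk : k ≠ n) : (inSector n x).sector k = 0 :=
  Pi.single_eq_of_ne (M := fun n => NParticle n H) hk x

theorem inSector_smul (n : ℕ) (c : ℂ) (x : NParticle n H) :
    inSector n (c • x) = c • inSector n x := Fock.ext fun k => by
  by_cases hk : k = n
  · subst hk
    rw [Fock.sector_smul, inSector_self, inSector_self]
  · rw [Fock.sector_smul, inSector_ne _ hk, inSector_ne _ hk, smul_zero]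

theorem inner_inSector (n : ℕ) (x : NParticle n H) (ψ : Fock H) :
    ⟪inSector n x, ψ⟫_ℂ = ⟪x, ψ.sector n⟫_ℂ := by
  refine (Fock.hasSum_inner _ _).unique ?_
  convert hasSum_single n fun k hk => ?_ using 1
  · rw [inSector_self]
  · rw [inSector_ne _ hk, inner_zero_left]

theorem single_mem_finite (n : ℕ) (x : NParticle n H) : inSector n x ∈ finiteParticles H :=
  ⟨n, fun _ hk => inSector_ne x hk.ne'⟩

theorem dense_finiteParticles : Dense (finiteParticles H : Set (Fock H)) := by
  rw [Submodule.dense_iff_topologicalClosure_eq_top, Submodule.topologicalClosure_eq_top_iff,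
    Submodule.eq_bot_iff]
  intro ψ hψ
  refine Fock.ext fun n => ?_
  have h := hψ _ (single_mem_finite n (ψ.sector n))
  rw [inner_inSector, inner_self_eq_zero] at h
  exact h

theorem fieldMap_zero (h : H) (ψ : finiteParticles H) :
    (fieldMap h ψ).sector 0 = annihilation 0 h ((ψ : Fock H).sector 1) := zero_add _

theorem fieldMap_succ (h : H) (ψ : finiteParticles H) (n : ℕ) :
    (fieldMap h ψ).sector (n + 1) = creation n h ((ψ : Fock H).sector n) +
      annihilation (n + 1) h ((ψ : Fock H).sector (n + 2)) := rfl

theorem fieldMap_inSector_zero (h : H) (x : NParticle 0 H) :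
    fieldMap h ⟨inSector 0 x, single_mem_finite 0 x⟩ = inSector 1 (creation 0 h x) := by
  refine Fock.ext fun n => ?_
  rcases n with _ | _ | n
  · rw [fieldMap_zero, inSector_ne _ one_ne_zero, inSector_ne _ zero_ne_one, map_zero]
  · rw [fieldMap_succ, inSector_self, inSector_ne _ (by omega), map_zero, add_zero, inSector_self]
  · rw [fieldMap_succ, inSector_ne _ (by omega), inSector_ne _ (by omega), map_zero, map_zero,
      add_zero, inSector_ne _ (by omega)]

theorem fieldMap_inSector_succ (h : H) (m : ℕ) (x : NParticle (m + 1) H) :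
    fieldMap h ⟨inSector (m + 1) x, single_mem_finite (m + 1) x⟩ =
      inSector (m + 2) (creation (m + 1) h x) + inSector m (annihilation m h x) := by
  refine Fock.ext fun n => ?_
  rw [Fock.sector_add]
  rcases n with _ | n
  · rw [fieldMap_zero, inSector_ne _ (by omega : 0 ≠ m + 2)]
    refine Eq.trans ?_ (zero_add _).symm
    by_cases hm : m = 0
    · subst hm
      rw [inSector_self, inSector_self]
    · rw [inSector_ne _ (by omega), inSector_ne _ (by omega), map_zero]
  · rw [fieldMap_succ]
    congr 1
    · by_cases hn : n = m + 1
      · subst hn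
        rw [inSector_self, inSector_self]
      · rw [inSector_ne _ hn, inSector_ne _ (by omega), map_zero]
    · by_cases hn : n + 1 = m
      · subst hn
        rw [inSector_self, inSector_self]
      · rw [inSector_ne _ (by omega), inSector_ne _ hn, map_zero]

theorem fieldMap_symmetric (h : H) (ψ χ : finiteParticles H) :
    ⟪fieldMap h ψ, (χ : Fock H)⟫_ℂ = ⟪(ψ : Fock H), fieldMap h χ⟫_ℂ := by
  obtain ⟨ψ, m, hm⟩ := ψ
  obtain ⟨χ, k, hk⟩ := χ
  have hc : Summable fun n => ⟪creation n h (ψ.sector n), χ.sector (n + 1)⟫_ℂ :=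
    summable_of_ne_finset_zero (s := Finset.range (m + 1)) fun n hn => by
      rw [hm n (by simpa using hn), map_zero, inner_zero_left]
  have hd : Summable fun n => ⟪annihilation n h (ψ.sector (n + 1)), χ.sector n⟫_ℂ :=
    summable_of_ne_finset_zero (s := Finset.range (m + 1)) fun n hn => by
      rw [hm (n + 1) (by simp at hn; omega), map_zero, inner_zero_left]
  have e1 : ∀ n, ⟪ψ.sector n, annihilation n h (χ.sector (n + 1))⟫_ℂ = ⟪creation n h (ψ.sector n), χ.sector (n + 1)⟫_ℂ :=
    fun n => ContinuousLinearMap.adjoint_inner_right _ _ _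
  have e2 : ∀ n, ⟪ψ.sector (n + 1), creation n h (χ.sector n)⟫_ℂ = ⟪annihilation n h (ψ.sector (n + 1)), χ.sector n⟫_ℂ :=
    fun n => (ContinuousLinearMap.adjoint_inner_left _ _ _).symm
  rw [← (Fock.hasSum_inner _ _).tsum_eq, ← (Fock.hasSum_inner _ _).tsum_eq,
    Summable.tsum_eq_zero_add (Fock.hasSum_inner _ _).summable,
    Summable.tsum_eq_zero_add (Fock.hasSum_inner _ _).summable]
  simp only [fieldMap_zero, fieldMap_succ, inner_add_left, inner_add_right, e1, e2]
  rw [Summable.tsum_add hc ((summable_nat_add_iff 1).2 hd),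
    Summable.tsum_add hd ((summable_nat_add_iff 1).2 hc)]
  have t1 := Summable.tsum_eq_zero_add hc
  have t2 := Summable.tsum_eq_zero_add hd
  linear_combination t1 - t2

theorem fieldOp_isClosable (h : H) : (fieldOp h).IsClosable := by
  have h1 : (fieldOp h).IsFormalAdjoint (fieldOp h) := fun ψ χ => fieldMap_symmetric h ψ χ
  exact (LinearPMap.adjoint_isClosed (T := fieldOp h) dense_finiteParticles).isClosable.leIsClosable
    (h1.le_adjoint dense_finiteParticles)

/-- No vector is orthogonal to the range of `iλ + φ(h)`. -/
theorem eq_zero_of_orthogonal (lam : ℝ) (hlam : lam ≠ 0) (h : H) (η : Fock H)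
    (hη : ∀ ψ : finiteParticles H,
      ⟪(Complex.I * lam) • (ψ : Fock H) + fieldMap h ψ, η⟫_ℂ = 0) : η = 0 := by
  set t : ℕ → ℂ := fun n => ⟪creation n h (η.sector n), η.sector (n + 1)⟫_ℂ with ht
  have hz : ∀ n, ⟪(Complex.I * lam) • η.sector n, η.sector n⟫_ℂ = -(Complex.I * (lam * ‖η.sector n‖ ^ 2 : ℝ)) := by
    intro n
    rw [inner_smul_left, inner_self_eq_ofReal]
    simp [mul_assoc]
  have h0 : -(Complex.I * (lam * ‖η.sector 0‖ ^ 2 : ℝ)) + t 0 = 0 := by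
    have := hη ⟨_, single_mem_finite 0 (η.sector 0)⟩
    rwa [fieldMap_inSector_zero, ← inSector_smul, inner_add_left, inner_inSector,
      inner_inSector, hz] at this
  have hs : ∀ n, -(Complex.I * (lam * ‖η.sector (n + 1)‖ ^ 2 : ℝ)) + (t (n + 1) + conj (t n)) = 0 := by
    intro n
    have := hη ⟨_, single_mem_finite (n + 1) (η.sector (n + 1))⟩
    rw [fieldMap_inSector_succ, ← inSector_smul, inner_add_left, inner_add_left, inner_inSector,
      inner_inSector, inner_inSector, hz] at this
    rw [ht, inner_conj_symm, ← this, ← ContinuousLinearMap.adjoint_inner_left]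
    rfl
  have him : ∀ n, (t n).im = lam * ∑ k ∈ Finset.range (n + 1), ‖η.sector k‖ ^ 2 := by
    intro n
    induction n with
    | zero =>
      have := congrArg Complex.im h0
      simp [-Complex.ofReal_mul] at this
      simp
      linarith
    | succ n ih =>
      have := congrArg Complex.im (hs n)
      simp [-Complex.ofReal_mul] at this
      rw [Finset.sum_range_succ, mul_add, ← ih]
      linarith
  by_contra hne
  obtain ⟨m, hm⟩ : ∃ m, η.sector m ≠ 0 := by
    by_contra hall
    push Not at hall
    exact hne (Fock.ext hall)
  set c : ℝ := |lam| * ‖η.sector m‖ ^ 2 with hc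
  have hcpos : 0 < c := by have := abs_pos.2 hlam; have := norm_pos_iff.2 hm; positivity
  have hb : ∀ n, m ≤ n → c ≤ √(n + 1 : ℝ) * (‖h‖ * (‖η.sector n‖ ^ 2 + ‖η.sector (n + 1)‖ ^ 2)) := by
    intro n hn
    have h1 : c ≤ |(t n).im| := by
      rw [him, abs_mul, hc]
      refine mul_le_mul_of_nonneg_left ?_ (abs_nonneg _)
      rw [abs_of_nonneg (Finset.sum_nonneg fun _ _ => by positivity)]
      exact Finset.single_le_sum (f := fun k => ‖η.sector k‖ ^ 2) (fun _ _ => by positivity)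
        (Finset.mem_range.2 (by omega))
    have h2 : ‖t n‖ ≤ √(n + 1 : ℝ) * ‖h‖ * ‖η.sector n‖ * ‖η.sector (n + 1)‖ :=
      (norm_inner_le_norm _ _).trans
        (mul_le_mul_of_nonneg_right (norm_creation_le n h (η.sector n)) (norm_nonneg _))
    have h3 : √(n + 1 : ℝ) * ‖h‖ * ‖η.sector n‖ * ‖η.sector (n + 1)‖ ≤
        √(n + 1 : ℝ) * (‖h‖ * (‖η.sector n‖ ^ 2 + ‖η.sector (n + 1)‖ ^ 2)) := by
      rw [mul_assoc, mul_assoc]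
      refine mul_le_mul_of_nonneg_left (mul_le_mul_of_nonneg_left ?_ (norm_nonneg _)) (by positivity)
      nlinarith [sq_nonneg (‖η.sector n‖ - ‖η.sector (n + 1)‖), sq_nonneg (‖η.sector n‖), sq_nonneg (‖η.sector (n + 1)‖)]
    exact h1.trans ((Complex.abs_im_le_norm _).trans (h2.trans h3))
  have hsum : Summable fun n : ℕ => ‖h‖ * (‖η.sector n‖ ^ 2 + ‖η.sector (n + 1)‖ ^ 2) :=
    ((Fock.summable_sq η).add ((summable_nat_add_iff 1).2 (Fock.summable_sq η))).mul_left _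
  have hdiv : Summable fun n : ℕ => c * (1 / ((n + m + 1 : ℕ) : ℝ)) := by
    refine Summable.of_nonneg_of_le (fun n => by positivity) (fun n => ?_)
      ((summable_nat_add_iff m).2 hsum)
    have h1 := hb (n + m) (by omega)
    have h2 : (1 : ℝ) ≤ ((n + m + 1 : ℕ) : ℝ) := by push_cast; linarith [n.cast_nonneg (α := ℝ), m.cast_nonneg (α := ℝ)]
    have h3 : √(((n + m : ℕ) : ℝ) + 1) ≤ ((n + m + 1 : ℕ) : ℝ) := by
      rw [Real.sqrt_le_left (by positivity)]
      push_cast at h2 ⊢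
      nlinarith
    rw [mul_one_div, div_le_iff₀ (by positivity)]
    refine h1.trans ?_
    rw [mul_comm (‖h‖ * _)]
    exact mul_le_mul_of_nonneg_right h3 (by positivity)
  have hdiv' : Summable fun n : ℕ => 1 / ((n + (m + 1) : ℕ) : ℝ) :=
    (summable_mul_left_iff hcpos.ne').1 hdiv
  exact Real.not_summable_one_div_natCast ((summable_nat_add_iff (f := fun n : ℕ => 1 / (n : ℝ)) (m + 1)).1 hdiv')

/-- `R = (z + T)⁻¹` for a partially defined operator `T`. -/
def IsResolventOf {E : Type*} [NormedAddCommGroup E] [NormedSpace ℂ E] (T : E →ₗ.[ℂ] E) (z : ℂ)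
    (R : E →L[ℂ] E) : Prop :=
  (∀ ψ : E, ∃ hψ : R ψ ∈ T.domain, z • R ψ + T ⟨R ψ, hψ⟩ = ψ) ∧
    ∀ ψ : T.domain, R (z • (ψ : E) + T ψ) = ψ

theorem exists_isResolventOf {E : Type*} [NormedAddCommGroup E] [InnerProductSpace ℂ E]
    [CompleteSpace E] (S : E →ₗ.[ℂ] E) (hclos : S.IsClosable)
    (hsym : ∀ ψ χ : S.domain, ⟪S ψ, (χ : E)⟫_ℂ = ⟪(ψ : E), S χ⟫_ℂ) (lam : ℝ) (hlam : lam ≠ 0)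
    (hrg : ∀ η : E, (∀ ψ : S.domain, ⟪(Complex.I * lam) • (ψ : E) + S ψ, η⟫_ℂ = 0) → η = 0) :
    ∃ R : E →L[ℂ] E, IsResolventOf S.closure (Complex.I * lam) R := by
  set T := S.closure with hT
  set z : ℂ := Complex.I * lam with hz
  have hG : T.graph = S.graph.topologicalClosure :=
    hclos.graph_closure_eq_closure_graph.symm
  let L : T.graph →L[ℂ] E :=
    (z • ContinuousLinearMap.fst ℂ (E) (E) +
      ContinuousLinearMap.snd ℂ (E) (E)) ∘L T.graph.subtypeL
  have hcl : IsClosed (T.graph : Set (E × E)) := by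
    rw [hG]; exact Submodule.isClosed_topologicalClosure _
  have : CompleteSpace T.graph := hcl.completeSpace_coe
  have hlow : ∀ p ∈ T.graph, |lam| * ‖p.1‖ ≤ ‖z • p.1 + p.2‖ := by
    have hcl' : IsClosed {p : E × E | |lam| * ‖p.1‖ ≤ ‖z • p.1 + p.2‖} :=
      isClosed_le (by fun_prop) (by fun_prop)
    intro p hp
    rw [hG] at hp
    refine closure_minimal (t := {p : E × E | |lam| * ‖p.1‖ ≤ ‖z • p.1 + p.2‖})
      ?_ hcl' hp
    rintro ⟨x, y⟩ hxy
    obtain ⟨ψ, h1, h2⟩ := LinearPMap.mem_graph_iff _ |>.1 hxy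
    simp only at h1 h2
    subst h1 h2
    have hreal : (⟪(ψ : E), S ψ⟫_ℂ).im = 0 := by
      have := hsym ψ ψ
      rw [← inner_conj_symm] at this
      exact Complex.conj_eq_iff_im.1 this
    have e : (⟪(ψ : E), z • (ψ : E) + S ψ⟫_ℂ).im = lam * ‖(ψ : E)‖ ^ 2 := by
      rw [inner_add_right, inner_smul_right, inner_self_eq_ofReal, Complex.add_im, hreal, hz]
      simp [← Complex.ofReal_pow]
    have h3 : |lam| * ‖(ψ : E)‖ ^ 2 ≤
        ‖(ψ : E)‖ * ‖z • (ψ : E) + S ψ‖ := by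
      have h4 := (Complex.abs_im_le_norm _).trans
        (norm_inner_le_norm (𝕜 := ℂ) (ψ : E) (z • (ψ : E) + S ψ))
      rwa [e, abs_mul, abs_of_nonneg (sq_nonneg ‖(ψ : E)‖)] at h4
    change |lam| * ‖(ψ : E)‖ ≤ ‖z • (ψ : E) + S ψ‖
    rcases (norm_nonneg (ψ : E)).eq_or_lt with h5 | h5
    · rw [← h5, mul_zero]; exact norm_nonneg _
    · refine le_of_mul_le_mul_left ?_ h5
      linarith
  have hLapp : ∀ p : T.graph, L p = z • (p : E × E).1 + (p : E × E).2 :=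
    fun p => rfl
  have hlamp := abs_pos.2 hlam
  have hzn : ‖z‖ = |lam| := by rw [hz]; simp
  have hanti : ∀ p : T.graph, ‖p‖ ≤ (|lam|⁻¹ + 2) * ‖L p‖ := by
    intro p
    have h1 := hlow p p.2
    rw [← hLapp] at h1
    have h2 : ‖(p : E × E).2‖ ≤ ‖L p‖ + |lam| * ‖(p : E × E).1‖ := by
      have : (p : E × E).2 = L p - z • (p : E × E).1 := by rw [hLapp]; abel
      rw [this]
      refine (norm_sub_le _ _).trans ?_
      rw [norm_smul, hzn]
    have h3 : ‖(p : E × E).1‖ ≤ |lam|⁻¹ * ‖L p‖ := by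
      rw [inv_mul_eq_div, le_div_iff₀ hlamp, mul_comm]; exact h1
    have h4 : 0 ≤ |lam|⁻¹ * ‖L p‖ := by positivity
    change max ‖(p : E × E).1‖ ‖(p : E × E).2‖ ≤ _
    refine max_le ?_ ?_ <;> nlinarith [norm_nonneg (L p)]
  have hanti' : AntilipschitzWith (Real.toNNReal (|lam|⁻¹ + 2)) L := by
    refine ContinuousLinearMap.antilipschitz_of_bound L fun p => ?_
    rw [Real.coe_toNNReal _ (by positivity)]
    exact hanti p
  have hrange : L.range = ⊤ := by
    have hclosed : IsClosed (L.range : Set (E)) := by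
      have := hanti'.isClosed_range L.uniformContinuous
      exact this
    rw [← hclosed.submodule_topologicalClosure_eq, Submodule.topologicalClosure_eq_top_iff,
      Submodule.eq_bot_iff]
    intro η hη
    refine hrg η fun ψ => ?_
    refine hη _ ⟨⟨((ψ : E), S ψ), ?_⟩, rfl⟩
    rw [hG]
    exact Submodule.le_topologicalClosure _ (LinearPMap.mem_graph _ ψ)
  have hker : L.ker = ⊥ := LinearMap.ker_eq_bot.2 hanti'.injective
  let e := ContinuousLinearEquiv.ofBijective L hker hrange
  have he : ∀ p, e p = L p := fun p => rfl
  refine ⟨ContinuousLinearMap.fst ℂ (E) (E) ∘L T.graph.subtypeL ∘L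
    (e.symm : E →L[ℂ] T.graph), fun ψ => ?_, fun ψ => ?_⟩
  · obtain ⟨χ, h1, h2⟩ := LinearPMap.mem_graph_iff _ |>.1 (e.symm ψ).2
    have h3 : L (e.symm ψ) = ψ := e.apply_symm_apply ψ
    have h4 : T ⟨(e.symm ψ : E × E).1, h1 ▸ χ.2⟩ = (e.symm ψ : E × E).2 := by
      rw [← h2]
      congr 1
      exact Subtype.ext h1.symm
    refine ⟨(h1 ▸ χ.2 : (e.symm ψ : E × E).1 ∈ T.domain), ?_⟩
    rw [hLapp] at h3
    change z • (e.symm ψ : E × E).1 + T ⟨(e.symm ψ : E × E).1, _⟩ = ψ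
    rw [h4, h3]
  · have h1 : e.symm (z • (ψ : E) + T ψ) = ⟨((ψ : E), T ψ), LinearPMap.mem_graph _ ψ⟩ := by
      rw [ContinuousLinearEquiv.symm_apply_eq, he, hLapp]
    change ((e.symm (z • (ψ : E) + T ψ) : T.graph) : E × E).1 = ψ
    rw [h1]

theorem exists_resolvent (lam : ℝ) (hlam : lam ≠ 0) (h : H) :
    ∃ R : Operators H, IsResolventOf (fieldOp h).closure (Complex.I * lam) R :=
  exists_isResolventOf (fieldOp h) (fieldOp_isClosable h) (fieldMap_symmetric h) lam hlam
    (eq_zero_of_orthogonal lam hlam h)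

/-- The resolvent `R(λ, h) = (iλ + φ(h))⁻¹`, with `φ(h)` the closure of the field operator on
vectors with finite particle number. -/
def fieldResolvent (lam : ℝ) (hlam : lam ≠ 0) (h : H) : Operators H :=
  (exists_resolvent lam hlam h).choose

/-- The resolvent algebra: the C*-algebra generated by all `R(λ, h)`, where `λ ≠ 0` and `h ∈ D`. -/
def resolventAlgebra (D : Set H) : StarSubalgebra ℂ (Operators H) :=
  (StarAlgebra.adjoin ℂ {R : Operators H | ∃ (lam : ℝ) (hlam : lam ≠ 0),
    ∃ h ∈ D, R = fieldResolvent lam hlam h}).topologicalClosure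

/-- `R` is a tensor of degree `m`: `e^{iuN} R e^{-iuN} = e^{ium} R` for all `u`. -/
def IsTensor (m : ℤ) (R : Operators H) : Prop :=
  ∀ u : ℝ, gaugeUnitary u * R * gaugeUnitary (-u) = Complex.exp (Complex.I * u * m) • R

/-- The closed span of all tensors in the resolvent algebra of degree between `-M` and `M`. -/
def tensorSpace (D : Set H) (M : ℕ) : Submodule ℂ (Operators H) :=
  (Submodule.span ℂ {R : Operators H | R ∈ resolventAlgebra D ∧
    ∃ m : ℤ, |m| ≤ M ∧ IsTensor m R}).topologicalClosure

/-- The (extended) algebra of observables: the bounded operators which coincide on each subspace of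
limited particle number with a gauge invariant element of the resolvent algebra. -/
def observables (D : Set H) : Set (Operators H) :=
  {A | ∀ n : ℕ, ∃ B ∈ resolventAlgebra D, IsTensor 0 B ∧ ∀ ψ ∈ lowParticles n H, A ψ = B ψ}

/-- The (extended) field algebra: the norm closure of the bounded operators which, for some `M`,
coincide on each subspace of limited particle number with an element of `tensorSpace D M`. -/
def fieldAlgebra (D : Set H) : Set (Operators H) :=
  closure {F | ∃ M : ℕ, ∀ n : ℕ, ∃ R ∈ tensorSpace D M, ∀ ψ ∈ lowParticles n H, F ψ = R ψ}

/-- The bounded operator `B` commutes with the particle number operator: `B N ⊆ N B`. -/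
def CommutesWithNumber (B : Operators H) : Prop :=
  ∀ ψ : (numberOp H).domain, ∃ h : B ψ ∈ (numberOp H).domain,
    numberOp H ⟨B ψ, h⟩ = B (numberOp H ψ)

/-- The von Neumann algebra generated by the particle number operator, i.e. its bicommutant. -/
def numberVN (H : Type*) [NormedAddCommGroup H] [InnerProductSpace ℂ H] : Set (Operators H) :=
  Set.centralizer {B | CommutesWithNumber B}

/-- The adjoint action `T ↦ V T V*`. -/
def Ad (V T : Operators H) : Operators H := V * T * star V

/-- The morphism `ρ_h(A) = W_h A W_h*`. -/
def rho (h : H) (hh : ‖h‖ = 1) (A : Operators H) : Operators H :=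
  isometryW h hh * A * star (isometryW h hh)

/-- The transformed morphism `Ad V ∘ ρ ∘ Ad V*`. -/
def transformed (V : Operators H) (ρ : Operators H → Operators H) : Operators H → Operators H :=
  Ad V ∘ ρ ∘ Ad (star V)

/-- Equivalence `ρ₁ ≃ ρ₂` of morphisms of the algebra of observables: there is a partial isometry
`X` in this algebra with final projection `ρ₁(1)` and initial projection `ρ₂(1)` which intertwines
`ρ₁` and `ρ₂`. -/
def MorphismEquiv (D : Set H) (ρ₁ ρ₂ : Operators H → Operators H) : Prop :=
  ∃ X ∈ observables D, X * star X * X = X ∧ X * star X = ρ₁ 1 ∧ star X * X = ρ₂ 1 ∧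
    ∀ A ∈ observables D, ρ₁ A * X = X * ρ₂ A

/-- The one-particle space `L²(ℝˢ)`. -/
abbrev OneParticle (s : ℕ) : Type :=
  MeasureTheory.Lp ℂ 2 (MeasureTheory.volume : MeasureTheory.Measure (EuclideanSpace ℝ (Fin s)))

/-- The complex valued test functions on `ℝˢ`: smooth functions with compact support. -/
abbrev TestFunctions (s : ℕ) : Type :=
  TestFunction (⊤ : TopologicalSpace.Opens (EuclideanSpace ℝ (Fin s))) ℂ (⊤ : ℕ∞)

/-- The `L²`-class of a test function. -/
def testVector {s : ℕ} (f : TestFunctions s) : OneParticle s :=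
  (f.continuous.memLp_of_hasCompactSupport f.hasCompactSupport).toLp f

/-- The set of all test functions, regarded as vectors in the one-particle space. -/
def testVectors (s : ℕ) : Set (OneParticle s) := Set.range testVector

end BoseFock

end

open BoseFock

open scoped InnerProductSpace ComplexConjugate ComplexOrder
set_option linter.unusedSectionVars false
noncomputable section
namespace BoseFock
variable {H : Type*} [NormedAddCommGroup H] [InnerProductSpace ℂ H]

/-! ### Operators acting sector by sector -/

/-! Write W for W_f and V for Ad U(g)(W). The transformed morphism is A ↦ V A V*, so a partial
isometry X intertwining it with ρ_f has the form V Y W*, where Y = V* X W is isometric and commutes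
with all observables. The observables act irreducibly on each n-particle space
(`isSectorScalar_of_commute`), hence Y is a function of N with values of modulus one. Since V raises
N by one, a function of N passes through V with its argument shifted, and (1) becomes: for each g
some phase function z makes z(N) V W* an observable. This is (2) except that z need not yet be
multiplicative in g.

Multiplicativity comes from a rigidity property. If y and z both serve for the same g, then (y
z⁻¹)(N) W W* is an observable. Let g_j be unit vectors in the one-particle space moving to infinity.
Then W_{g_j}* R W_{g_j} tends to R for every R in the resolvent algebra
(`tendsto_star_isometryW_mul`), although W_{g_j} adds a particle. This forces y z⁻¹ to be constant
on n ≥ 1 (`eq_of_phase_mul_mem_observables`). The value z(0) has no effect, because V has no vacuum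
component. With z(0) = z(1) = 1 the function z is therefore unique, and since products of solutions
solve the problem for products of group elements, z is a homomorphism. Conversely, z(N) V W* is
itself an intertwiner.

For (2) ⇔ (3), a phase function w gives Ad(U w(N))(W) = z(N) V with z(n+1) = w(n+1)/w(n), and this
relation can be solved for either function. An extended tensor of degree m ≥ 0 is an observable
times Wᵐ. Thus Ad(U w(N)) preserves the field algebra if z(N) V is an extended tensor of degree 1.
Conversely, homogeneous elements of the field algebra are extended tensors
(`isExtendedTensor_of_mem_fieldAlgebra`), so z(N) V W* is an observable.

The analytic input is `isExtendedTensor_isometryW`: on at most n particles, W agrees with a degree 1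
tensor of the resolvent algebra. The gauge group acts norm continuously on products of resolvents of
the conjugate fields φ(h) and φ(ih). Fourier components of such products approximate a*(h) in norm
at bounded particle number as λ → ∞, and restrictions of tensors to bounded particle number form a
norm closed space (`exists_tensor_eq_of_near`). Functional calculus then supplies the factor (1 +
N_f)^{-1/2}. -/

theorem Fock.sector_sub (ψ χ : Fock H) (n : ℕ) :
    (ψ - χ).sector n = ψ.sector n - χ.sector n := rfl

theorem Fock.norm_sq_le {ψ χ : Fock H} {c : ℝ} (h : ∀ n, ‖ψ.sector n‖ ≤ c * ‖χ.sector n‖) :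
    ‖ψ‖ ^ 2 ≤ (c * ‖χ‖) ^ 2 := by
  rw [mul_pow, Fock.norm_sq, Fock.norm_sq, ← tsum_mul_left]
  refine ψ.summable_sq.tsum_le_tsum (fun n => ?_) (χ.summable_sq.mul_left _)
  rw [← mul_pow]
  exact pow_le_pow_left₀ (norm_nonneg _) (h n) 2

theorem Fock.norm_sector_le (ψ : Fock H) (n : ℕ) : ‖ψ.sector n‖ ≤ ‖ψ‖ := by
  rw [← sq_le_sq₀ (norm_nonneg _) (norm_nonneg _), Fock.norm_sq]
  exact ψ.summable_sq.le_tsum n fun _ _ => by positivity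

/-- The component in the `n`-particle space, as a bounded operator. -/
def sectorCLM (n : ℕ) : Fock H →L[ℂ] NParticle n H :=
  LinearMap.mkContinuous
    { toFun := fun ψ => ψ.sector n
      map_add' := fun _ _ => rfl
      map_smul' := fun _ _ => rfl }
    1 fun ψ => by rw [one_mul]; exact ψ.norm_sector_le n

@[simp] theorem sectorCLM_apply (n : ℕ) (ψ : Fock H) : sectorCLM n ψ = ψ.sector n := rfl

theorem norm_inSector (n : ℕ) (x : NParticle n H) : ‖inSector n x‖ = ‖x‖ := by
  have h : ⟪inSector n x, inSector n x⟫_ℂ = ⟪x, x⟫_ℂ := by rw [inner_inSector, inSector_self]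
  rw [inner_self_eq_ofReal, inner_self_eq_ofReal] at h
  exact (sq_eq_sq₀ (norm_nonneg _) (norm_nonneg _)).1 (Complex.ofReal_injective h)

theorem inSector_add (n : ℕ) (x y : NParticle n H) :
    inSector n (x + y) = inSector n x + inSector n y := Fock.ext fun k => by
  by_cases hk : k = n
  · subst hk
    rw [Fock.sector_add, inSector_self, inSector_self, inSector_self]
  · rw [Fock.sector_add, inSector_ne _ hk, inSector_ne _ hk, inSector_ne _ hk, add_zero]

/-- The embedding of the `n`-particle space, as a bounded operator. -/
def inSectorCLM (n : ℕ) : NParticle n H →L[ℂ] Fock H :=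
  LinearMap.mkContinuous
    { toFun := inSector n
      map_add' := inSector_add n
      map_smul' := inSector_smul n }
    1 fun x => by rw [one_mul]; exact (norm_inSector n x).le

@[simp] theorem inSectorCLM_apply (n : ℕ) (x : NParticle n H) : inSectorCLM n x = inSector n x :=
  rfl

theorem operator_ext {A B : Operators H}
    (h : ∀ (ψ : Fock H) (n : ℕ), (A ψ).sector n = (B ψ).sector n) : A = B :=
  ContinuousLinearMap.ext fun ψ => Fock.ext fun n => h ψ n

/-- The operator acting as multiplication by `w n` on the `n`-particle space. -/
def diagonal (w : ℕ → ℂ) {C : ℝ} (hw : ∀ n, ‖w n‖ ≤ C) : Operators H :=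
  LinearMap.mkContinuous
    { toFun := fun ψ => Fock.mk (fun n => w n • ψ.sector n) <| by
        refine Summable.of_nonneg_of_le (fun n => by positivity) (fun n => ?_)
          (ψ.summable_sq.mul_left (C ^ 2))
        rw [norm_smul, mul_pow]
        exact mul_le_mul_of_nonneg_right (pow_le_pow_left₀ (norm_nonneg _) (hw n) 2) (by positivity)
      map_add' := fun ψ χ => Fock.ext fun n => by
        simp only [Fock.sector_mk, Fock.sector_add, smul_add]
      map_smul' := fun c ψ => Fock.ext fun n => by
        simp only [Fock.sector_mk, Fock.sector_smul, RingHom.id_apply, smul_comm c] }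
    C fun ψ => by
      have hC : 0 ≤ C := (norm_nonneg _).trans (hw 0)
      rw [← sq_le_sq₀ (norm_nonneg _) (by positivity)]
      refine Fock.norm_sq_le fun n => ?_
      simp only [LinearMap.coe_mk, AddHom.coe_mk, Fock.sector_mk, norm_smul]
      exact mul_le_mul_of_nonneg_right (hw n) (norm_nonneg _)

@[simp] theorem sector_diagonal (w : ℕ → ℂ) {C : ℝ} (hw : ∀ n, ‖w n‖ ≤ C) (ψ : Fock H) (n : ℕ) :
    (diagonal w hw ψ).sector n = w n • ψ.sector n := rfl

theorem norm_diagonal_le (w : ℕ → ℂ) {C : ℝ} (hw : ∀ n, ‖w n‖ ≤ C) :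
    ‖(diagonal w hw : Operators H)‖ ≤ C :=
  LinearMap.mkContinuous_norm_le _ ((norm_nonneg _).trans (hw 0)) _

theorem star_eq_of_inner {A B : Operators H} (h : ∀ ψ χ, ⟪A ψ, χ⟫_ℂ = ⟪ψ, B χ⟫_ℂ) : star A = B := by
  rw [ContinuousLinearMap.star_eq_adjoint]
  exact ((ContinuousLinearMap.eq_adjoint_iff B A).2 fun ψ χ => by
    rw [← inner_conj_symm, ← h, inner_conj_symm]).symm

theorem inner_star_left (A : Operators H) (ψ χ : Fock H) : ⟪star A ψ, χ⟫_ℂ = ⟪ψ, A χ⟫_ℂ :=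
  ContinuousLinearMap.adjoint_inner_left _ _ _

theorem inner_star_right (A : Operators H) (ψ χ : Fock H) : ⟪ψ, star A χ⟫_ℂ = ⟪A ψ, χ⟫_ℂ :=
  ContinuousLinearMap.adjoint_inner_right _ _ _

theorem star_diagonal (w : ℕ → ℂ) {C : ℝ} (hw : ∀ n, ‖w n‖ ≤ C) :
    star (diagonal w hw : Operators H) =
      diagonal (fun n => conj (w n)) (C := C) (fun n => by rw [RCLike.norm_conj]; exact hw n) := by
  refine star_eq_of_inner fun ψ χ => ?_
  refine ((Fock.hasSum_inner _ _).congr_fun fun n => ?_).unique (Fock.hasSum_inner _ _)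
  rw [sector_diagonal, sector_diagonal, inner_smul_left, inner_smul_right]

/-- The components of `shiftUp T ψ`. -/
def shiftUpComponents (T : ∀ n, NParticle n H →L[ℂ] NParticle (n + 1) H) (ψ : Fock H) :
    ∀ n, NParticle n H
  | 0 => 0
  | n + 1 => T n (ψ.sector n)

/-- The operator mapping the `n`-particle space to the `(n+1)`-particle space by `T n`. -/
def shiftUp (T : ∀ n, NParticle n H →L[ℂ] NParticle (n + 1) H) {C : ℝ} (hT : ∀ n, ‖T n‖ ≤ C) :
    Operators H :=
  LinearMap.mkContinuous
    { toFun := fun ψ => Fock.mk (shiftUpComponents T ψ) <| by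
        rw [← summable_nat_add_iff 1]
        refine Summable.of_nonneg_of_le (fun n => by positivity) (fun n => ?_)
          (ψ.summable_sq.mul_left (C ^ 2))
        rw [← mul_pow]
        exact pow_le_pow_left₀ (norm_nonneg _) ((T n).le_of_opNorm_le (hT n) _) 2
      map_add' := fun ψ χ => Fock.ext fun n => by
        cases n <;> simp only [shiftUpComponents, Fock.sector_mk, Fock.sector_add, map_add, add_zero]
      map_smul' := fun c ψ => Fock.ext fun n => by
        cases n <;>
        simp only [shiftUpComponents, Fock.sector_mk, Fock.sector_smul, RingHom.id_apply, map_smul, smul_zero] }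
    C fun ψ => by
      have hC : 0 ≤ C := (norm_nonneg _).trans (hT 0)
      rw [← sq_le_sq₀ (norm_nonneg _) (by positivity), mul_pow, Fock.norm_sq, Fock.norm_sq,
        Summable.tsum_eq_zero_add (Fock.summable_sq _), ← tsum_mul_left]
      simp only [LinearMap.coe_mk, AddHom.coe_mk, Fock.sector_mk, shiftUpComponents, norm_zero, ne_eq,
        OfNat.ofNat_ne_zero, not_false_eq_true, zero_pow, zero_add]
      have hle : ∀ n, ‖T n (ψ.sector n)‖ ^ 2 ≤ C ^ 2 * ‖ψ.sector n‖ ^ 2 := fun n => by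
        rw [← mul_pow]
        exact pow_le_pow_left₀ (norm_nonneg _) ((T n).le_of_opNorm_le (hT n) _) 2
      exact (Summable.of_nonneg_of_le (fun n => by positivity) hle
        (ψ.summable_sq.mul_left (C ^ 2))).tsum_le_tsum hle (ψ.summable_sq.mul_left (C ^ 2))

section shiftUp

variable (T : ∀ n, NParticle n H →L[ℂ] NParticle (n + 1) H) {C : ℝ} (hT : ∀ n, ‖T n‖ ≤ C)

@[simp] theorem sector_shiftUp_zero (ψ : Fock H) : (shiftUp T hT ψ).sector 0 = 0 := rfl

@[simp] theorem sector_shiftUp_succ (ψ : Fock H) (n : ℕ) :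
    (shiftUp T hT ψ).sector (n + 1) = T n (ψ.sector n) := rfl

theorem norm_shiftUp_le : ‖shiftUp T hT‖ ≤ C :=
  LinearMap.mkContinuous_norm_le _ ((norm_nonneg _).trans (hT 0)) _

theorem shiftUp_inSector (n : ℕ) (x : NParticle n H) :
    shiftUp T hT (inSector n x) = inSector (n + 1) (T n x) := Fock.ext fun k => by
  rcases k with _ | k
  · rw [sector_shiftUp_zero, inSector_ne _ (by omega)]
  · rw [sector_shiftUp_succ]
    by_cases hk : k = n
    · subst hk
      rw [inSector_self, inSector_self]
    · rw [inSector_ne _ hk, inSector_ne _ (by omega), map_zero]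

@[simp] theorem sector_star_shiftUp (ψ : Fock H) (n : ℕ) :
    (star (shiftUp T hT) ψ).sector n = ContinuousLinearMap.adjoint (T n) (ψ.sector (n + 1)) := by
  refine ext_inner_left ℂ fun x => ?_
  rw [← inner_inSector, inner_star_right, shiftUp_inSector, inner_inSector,
    ContinuousLinearMap.adjoint_inner_right]

end shiftUp

/-! ### Creation and annihilation operators -/

/-- Symmetric tensors are total, so the commutation relations of creation and annihilation operators
reduce to computations with tuples. -/
theorem eq_of_symTensor {n : ℕ} {E : Type*} [NormedAddCommGroup E] [NormedSpace ℂ E]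
    {A B : NParticle n H →L[ℂ] E} (h : ∀ g : Fin n → H, A (symTensor g) = B (symTensor g)) :
    A = B := by
  refine ContinuousLinearMap.ext fun x => congrFun
    ((NParticle.denseRange_of n).equalizer A.continuous B.continuous (funext fun y => ?_)) x
  simp only [Function.comp_apply]
  induction y using preTensor_induction with
  | h0 => simp
  | hadd x y hx hy => simp only [map_add, hx, hy]
  | hs a g => simp only [map_smul]; exact congrArg _ (h g)

theorem symKernel_perm {n : ℕ} (σ : Equiv.Perm (Fin n)) (f g : Fin n → H) :
    symKernel f (g ∘ σ) = symKernel f g := by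
  rw [symKernel, symKernel, ← Equiv.sum_comp (Equiv.mulLeft σ⁻¹)]
  simp

theorem eq_of_inner_symTensor {n : ℕ} {x y : NParticle n H}
    (h : ∀ g : Fin n → H, ⟪symTensor g, x⟫_ℂ = ⟪symTensor g, y⟫_ℂ) : x = y := by
  have := eq_of_symTensor (A := innerSL ℂ x) (B := innerSL ℂ y) fun g => by
    simp only [innerSL_apply_apply]
    rw [← inner_conj_symm, h, inner_conj_symm]
  refine ext_inner_right ℂ fun z => ?_
  exact congrArg (fun A : NParticle n H →L[ℂ] ℂ => A z) this

/-- Permuted tuples are different formal tensors. They are identified only in the completion, where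
both have the same scalar products with a total set. -/
theorem symTensor_perm {n : ℕ} (σ : Equiv.Perm (Fin n)) (g : Fin n → H) :
    symTensor (g ∘ σ) = symTensor g :=
  eq_of_inner_symTensor fun f => by rw [inner_symTensor, inner_symTensor, symKernel_perm]

theorem norm_creation (n : ℕ) (h : H) : ‖creation n h‖ ≤ √(n + 1 : ℝ) * ‖h‖ :=
  ContinuousLinearMap.opNorm_le_bound _ (by positivity) (norm_creation_le n h)

theorem annihilation_symTensor (n : ℕ) (h : H) (g : Fin (n + 1) → H) :
    annihilation n h (symTensor g) =
      (((√(n + 1 : ℝ))⁻¹ : ℝ) : ℂ) • ∑ j, ⟪h, g j⟫_ℂ • symTensor (j.removeNth g) := by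
  rw [symTensor, annihilation_of, preAnnihilation_preTensor, map_smul, map_sum]
  simp only [map_smul, symTensor]

theorem annihilation_add (n : ℕ) (h k : H) :
    annihilation n (h + k) = annihilation n h + annihilation n k :=
  eq_of_symTensor fun g => by
    simp only [annihilation_symTensor, add_apply, inner_add_left, add_smul,
      Finset.sum_add_distrib, smul_add]

theorem annihilation_smul (n : ℕ) (c : ℂ) (h : H) :
    annihilation n (c • h) = conj c • annihilation n h :=
  eq_of_symTensor fun g => by
    simp only [annihilation_symTensor, smul_apply, inner_smul_left, mul_smul,
      Finset.smul_sum]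
    refine Finset.sum_congr rfl fun j _ => ?_
    rw [smul_comm]

theorem creation_eq (n : ℕ) (h : H) :
    creation n h = ContinuousLinearMap.adjoint (annihilation n h) := by
  rw [annihilation, ContinuousLinearMap.adjoint_adjoint]

theorem creation_add (n : ℕ) (h k : H) : creation n (h + k) = creation n h + creation n k := by
  simp only [creation_eq, annihilation_add, map_add]

theorem creation_smul (n : ℕ) (c : ℂ) (h : H) : creation n (c • h) = c • creation n h := by
  simp only [creation_eq, annihilation_smul, map_smulₛₗ, Complex.conj_conj]

theorem annihilation_creation_zero (h k : H) (x : NParticle 0 H) :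
    annihilation 0 h (creation 0 k x) = ⟪h, k⟫_ℂ • x := by
  have : annihilation 0 h ∘L creation 0 k = ⟪h, k⟫_ℂ • ContinuousLinearMap.id ℂ _ :=
    eq_of_symTensor fun g => by
      simp [creation_symTensor, annihilation_symTensor]
  exact congrArg (fun A : NParticle 0 H →L[ℂ] NParticle 0 H => A x) this

/-- The canonical commutation relation `a(h) a*(k) = ⟨h, k⟩ + a*(k) a(h)`. -/
theorem annihilation_creation_succ (n : ℕ) (h k : H) (x : NParticle (n + 1) H) :
    annihilation (n + 1) h (creation (n + 1) k x) =
      ⟪h, k⟫_ℂ • x + creation n k (annihilation n h x) := by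
  have : annihilation (n + 1) h ∘L creation (n + 1) k =
      ⟪h, k⟫_ℂ • ContinuousLinearMap.id ℂ _ + creation n k ∘L annihilation n h :=
    eq_of_symTensor fun g => by
      have h1 : ∀ m : ℕ, ((√(m + 1 : ℝ) : ℝ) : ℂ) * (((√(m + 1 : ℝ))⁻¹ : ℝ) : ℂ) = 1 := by
        intro m
        rw [← Complex.ofReal_mul, mul_inv_cancel₀ (by positivity), Complex.ofReal_one]
      have h2 : ∀ i : Fin (n + 1), (i.succ.removeNth (Fin.cons k g : Fin (n + 2) → H)) =
          (Fin.cons k (i.removeNth g) : Fin (n + 1) → H) := by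
        intro i
        ext j
        refine Fin.cases ?_ (fun j => ?_) j <;> simp [Fin.removeNth]
      simp only [ContinuousLinearMap.comp_apply, add_apply,
        smul_apply, ContinuousLinearMap.id_apply, map_smul,
        creation_symTensor, annihilation_symTensor, map_sum]
      -- The term j = 0 contracts the new factor `k` and gives ⟨h, k⟩; the others contract old
      -- factors and reassemble to a*(k) a(h).
      rw [smul_smul _ _ (∑ j, _), h1, one_smul, Fin.sum_univ_succ]
      simp only [Fin.cons_zero, Fin.cons_succ, h2, smul_comm _ ((√(n + 1 : ℝ) : ℝ) : ℂ),
        ← Finset.smul_sum]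
      rw [smul_smul ((√(n + 1 : ℝ) : ℝ) : ℂ), h1, one_smul]
      simp
  exact congrArg (fun A : NParticle (n + 1) H →L[ℂ] NParticle (n + 1) H => A x) this

theorem creation_comm (n : ℕ) (h k : H) :
    creation (n + 1) h ∘L creation n k = creation (n + 1) k ∘L creation n h :=
  eq_of_symTensor fun g => by
    simp only [ContinuousLinearMap.comp_apply, creation_symTensor, map_smul]
    congr 2
    rw [← symTensor_perm (Equiv.swap 0 1)]
    congr 1
    ext j
    refine Fin.cases ?_ (fun j => Fin.cases ?_ (fun j => ?_) j) j
    · rw [Function.comp_apply, Equiv.swap_apply_left]; rfl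
    · have : (Fin.succ 0 : Fin (n + 2)) = 1 := rfl
      rw [Function.comp_apply, this, Equiv.swap_apply_right]; rfl
    · rw [Function.comp_apply, Equiv.swap_apply_of_ne_of_ne (by simp)
        (by rw [ne_eq, Fin.ext_iff]; simp)]
      rfl

theorem annihilation_comm (n : ℕ) (h k : H) :
    annihilation n h ∘L annihilation (n + 1) k = annihilation n k ∘L annihilation (n + 1) h := by
  have := congrArg ContinuousLinearMap.adjoint (creation_comm n k h)
  rwa [ContinuousLinearMap.adjoint_comp, ContinuousLinearMap.adjoint_comp] at this

/-! ### Vectors with finite particle number -/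

theorem clm_eq_of_finite {E : Type*} [NormedAddCommGroup E] [NormedSpace ℂ E]
    {A B : Fock H →L[ℂ] E} (h : ∀ ψ : finiteParticles H, A ψ = B ψ) : A = B :=
  ContinuousLinearMap.ext fun x => congrFun
    (Continuous.ext_on dense_finiteParticles A.continuous B.continuous fun ψ hψ => h ⟨ψ, hψ⟩) x

theorem operator_eq_of_inner_finite {A B : Operators H}
    (h : ∀ ψ χ : finiteParticles H, ⟪(ψ : Fock H), A χ⟫_ℂ = ⟪(ψ : Fock H), B χ⟫_ℂ) : A = B :=
  clm_eq_of_finite fun χ => dense_finiteParticles.eq_of_inner_right ℂ fun ψ hψ => h ⟨ψ, hψ⟩ χ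

theorem diagonal_mem_finite (w : ℕ → ℂ) {C : ℝ} (hw : ∀ n, ‖w n‖ ≤ C) (ψ : finiteParticles H) :
    diagonal w hw (ψ : Fock H) ∈ finiteParticles H := by
  obtain ⟨ψ, n, hn⟩ := ψ
  exact ⟨n, fun k hk => by rw [sector_diagonal, hn k hk, smul_zero]⟩

theorem fieldMap_mem_finite (h : H) (ψ : finiteParticles H) :
    fieldMap h ψ ∈ finiteParticles H := by
  obtain ⟨ψ, n, hn⟩ := ψ
  refine ⟨n + 1, fun k hk => ?_⟩
  obtain ⟨k, rfl⟩ : ∃ j, k = j + 1 := ⟨k - 1, by omega⟩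
  rw [fieldMap_succ, hn k (by omega), hn (k + 2) (by omega), map_zero, map_zero, add_zero]

/-- The field operator as an endomorphism of the space of vectors with finite particle number. -/
def fieldEnd (h : H) : finiteParticles H →ₗ[ℂ] finiteParticles H :=
  (fieldMap h).codRestrict _ (fieldMap_mem_finite h)

theorem coe_fieldEnd (h : H) (ψ : finiteParticles H) : (fieldEnd h ψ : Fock H) = fieldMap h ψ := rfl

/-- Creation operators commute with each other, and so do annihilation operators; the mixed terms
leave a scalar. The sectors 0 and 1 are separate because some of the terms present elsewhere are
absent there. -/
theorem fieldMap_commutator (h k : H) (ψ : finiteParticles H) :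
    fieldMap h (fieldEnd k ψ) - fieldMap k (fieldEnd h ψ) =
      (⟪h, k⟫_ℂ - ⟪k, h⟫_ℂ) • (ψ : Fock H) := by
  have hc : ∀ n (x : NParticle n H), creation (n + 1) h (creation n k x) =
      creation (n + 1) k (creation n h x) := fun n x => DFunLike.congr_fun (creation_comm n h k) x
  have ha : ∀ n (x : NParticle (n + 2) H), annihilation n h (annihilation (n + 1) k x) =
      annihilation n k (annihilation (n + 1) h x) :=
    fun n x => DFunLike.congr_fun (annihilation_comm n h k) x
  refine Fock.ext fun n => ?_
  rw [Fock.sector_sub, Fock.sector_smul]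
  rcases n with _ | _ | n
  · simp only [fieldMap_zero, coe_fieldEnd, fieldMap_succ, map_add, annihilation_creation_zero, ha,
      sub_smul]
    abel
  · simp only [fieldMap_zero, coe_fieldEnd, fieldMap_succ, map_add, annihilation_creation_succ, ha,
      sub_smul]
    abel
  · simp only [coe_fieldEnd, fieldMap_succ, map_add, annihilation_creation_succ, ha, hc,
      sub_smul]
    abel

/-! ### The resolvents of the field operators -/

theorem fieldResolvent_spec (lam : ℝ) (hlam : lam ≠ 0) (h : H) :
    IsResolventOf (fieldOp h).closure (Complex.I * lam) (fieldResolvent lam hlam h) :=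
  (exists_resolvent lam hlam h).choose_spec

theorem fieldResolvent_apply (lam : ℝ) (hlam : lam ≠ 0) (h : H) (ψ : finiteParticles H) :
    fieldResolvent lam hlam h ((Complex.I * lam) • (ψ : Fock H) + fieldMap h ψ) = ψ := by
  have hle := (fieldOp h).le_closure
  have h1 := (fieldResolvent_spec lam hlam h).2 ⟨ψ, hle.1 ψ.2⟩
  have h2 : fieldOp h ψ = (fieldOp h).closure ⟨ψ, hle.1 ψ.2⟩ := hle.2 rfl
  rw [← h2] at h1
  exact h1

/-- Finite-particle vectors are a core on which iλ + φ(h) already has dense range, so operator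
identities involving a resolvent may be tested on this range and the domain of the closure never
enters. -/
theorem dense_resolvent_range (lam : ℝ) (hlam : lam ≠ 0) (h : H) :
    Dense (Set.range fun ψ : finiteParticles H =>
      (Complex.I * lam) • (ψ : Fock H) + fieldMap h ψ) := by
  have : Dense (LinearMap.range ((Complex.I * lam) • (finiteParticles H).subtype + fieldMap h) :
      Set (Fock H)) := by
    rw [Submodule.dense_iff_topologicalClosure_eq_top, Submodule.topologicalClosure_eq_top_iff,
      Submodule.eq_bot_iff]
    exact fun η hη => eq_zero_of_orthogonal lam hlam h η fun ψ => hη _ ⟨ψ, rfl⟩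
  exact this

theorem clm_eq_of_resolvent_range {E : Type*} [NormedAddCommGroup E] [NormedSpace ℂ E]
    (lam : ℝ) (hlam : lam ≠ 0) (h : H) {A B : Fock H →L[ℂ] E}
    (hAB : ∀ ψ : finiteParticles H, A ((Complex.I * lam) • (ψ : Fock H) + fieldMap h ψ) =
      B ((Complex.I * lam) • (ψ : Fock H) + fieldMap h ψ)) : A = B :=
  ContinuousLinearMap.ext fun x => congrFun
    (Continuous.ext_on (dense_resolvent_range lam hlam h) A.continuous B.continuous
      (by rintro _ ⟨ψ, rfl⟩; exact hAB ψ)) x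

/-- As φ(h) is symmetric, ⟨ψ, (iλ + φ(h)) ψ⟩ has imaginary part λ‖ψ‖², and Cauchy–Schwarz gives the
bound. -/
theorem norm_le_resolvent_range (lam : ℝ) (h : H) (ψ : finiteParticles H) :
    |lam| * ‖(ψ : Fock H)‖ ≤ ‖(Complex.I * lam) • (ψ : Fock H) + fieldMap h ψ‖ := by
  have hreal : (⟪(ψ : Fock H), fieldMap h ψ⟫_ℂ).im = 0 := by
    have := fieldMap_symmetric h ψ ψ
    rw [← inner_conj_symm] at this
    exact Complex.conj_eq_iff_im.1 this
  have e : (⟪(ψ : Fock H), (Complex.I * lam) • (ψ : Fock H) + fieldMap h ψ⟫_ℂ).im =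
      lam * ‖(ψ : Fock H)‖ ^ 2 := by
    rw [inner_add_right, inner_smul_right, inner_self_eq_ofReal, Complex.add_im, hreal]
    simp [-Complex.ofReal_pow]
  have h4 := (Complex.abs_im_le_norm _).trans
    (norm_inner_le_norm (𝕜 := ℂ) (ψ : Fock H) ((Complex.I * lam) • (ψ : Fock H) + fieldMap h ψ))
  rw [e, abs_mul, abs_of_nonneg (sq_nonneg ‖(ψ : Fock H)‖)] at h4
  rcases (norm_nonneg (ψ : Fock H)).eq_or_lt with h5 | h5
  · rw [← h5, mul_zero]; exact norm_nonneg _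
  · refine le_of_mul_le_mul_left ?_ h5
    linarith

theorem norm_fieldResolvent_le (lam : ℝ) (hlam : lam ≠ 0) (h : H) :
    ‖fieldResolvent lam hlam h‖ ≤ |lam|⁻¹ := by
  have hl := abs_pos.2 hlam
  refine ContinuousLinearMap.opNorm_le_bound _ (by positivity) fun x => ?_
  refine (dense_resolvent_range lam hlam h).induction
    (P := fun x => ‖fieldResolvent lam hlam h x‖ ≤ |lam|⁻¹ * ‖x‖) ?_ ?_ x
  · rintro _ ⟨ψ, rfl⟩
    rw [fieldResolvent_apply, inv_mul_eq_div, le_div_iff₀ hl, mul_comm]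
    exact norm_le_resolvent_range lam h ψ
  · exact isClosed_le (by fun_prop) (by fun_prop)

/-! ### Field operators with a number cutoff -/

theorem norm_inv_succ_le (n : ℕ) : ‖((n + 1 : ℂ))⁻¹‖ ≤ 1 := by
  rw [norm_inv]
  have : ‖(n + 1 : ℂ)‖ = (n + 1 : ℝ) := by
    rw [← Nat.cast_succ, Complex.norm_natCast, Nat.cast_succ]
  rw [this]
  exact inv_le_one_of_one_le₀ (by linarith [n.cast_nonneg (α := ℝ)])

/-- The operator `(1 + N)⁻¹`. -/
def invNumber (H : Type*) [NormedAddCommGroup H] [InnerProductSpace ℂ H] : Operators H :=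
  diagonal (fun n => ((n + 1 : ℂ))⁻¹) norm_inv_succ_le

theorem sector_invNumber (ψ : Fock H) (n : ℕ) :
    (invNumber H ψ).sector n = ((n + 1 : ℂ))⁻¹ • ψ.sector n := rfl

/-- The operator `(1 + N)⁻¹` on the vectors with finite particle number. -/
def invNumberFin (ψ : finiteParticles H) : finiteParticles H :=
  ⟨invNumber H (ψ : Fock H), diagonal_mem_finite _ _ ψ⟩

theorem coe_invNumberFin (ψ : finiteParticles H) :
    (invNumberFin ψ : Fock H) = invNumber H (ψ : Fock H) := rfl

theorem star_invNumber : star (invNumber H) = invNumber H := by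
  rw [invNumber, star_diagonal]
  exact operator_ext fun ψ n => by simp

/-- `(1 + N)` on the vectors with at most `n` particles, zero on the others. -/
def cutNumber (n : ℕ) (H : Type*) [NormedAddCommGroup H] [InnerProductSpace ℂ H] : Operators H :=
  diagonal (fun k => if k ≤ n then ((k + 1 : ℂ)) else 0) (C := n + 1) fun k => by
    split_ifs with hk
    · rw [← Nat.cast_succ, Complex.norm_natCast, Nat.cast_succ]
      exact_mod_cast Nat.succ_le_succ hk
    · rw [norm_zero]; positivity

theorem sector_cutNumber (n : ℕ) (ψ : Fock H) (k : ℕ) :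
    (cutNumber n H ψ).sector k = (if k ≤ n then ((k + 1 : ℂ)) else 0) • ψ.sector k := rfl

/-- The projection onto the vectors with at most `n` particles. -/
def lowProj (n : ℕ) (H : Type*) [NormedAddCommGroup H] [InnerProductSpace ℂ H] : Operators H :=
  diagonal (fun k => if k ≤ n then 1 else 0) (C := 1) fun k => by split_ifs <;> simp

theorem sector_lowProj (n : ℕ) (ψ : Fock H) (k : ℕ) :
    (lowProj n H ψ).sector k = if k ≤ n then ψ.sector k else 0 := by
  rw [lowProj, sector_diagonal]
  split_ifs <;> simp

theorem lowProj_mem (n : ℕ) (ψ : Fock H) : lowProj n H ψ ∈ lowParticles n H := fun k hk => by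
  rw [sector_lowProj, if_neg (by omega)]

theorem lowProj_apply {n : ℕ} {ψ : Fock H} (hψ : ψ ∈ lowParticles n H) : lowProj n H ψ = ψ :=
  Fock.ext fun k => by
    rw [sector_lowProj]
    split_ifs with hk
    · rfl
    · exact (hψ k (by omega)).symm

theorem mul_lowProj_eq_iff {n : ℕ} {A B : Operators H} :
    A * lowProj n H = B * lowProj n H ↔ ∀ ψ ∈ lowParticles n H, A ψ = B ψ := by
  constructor
  · intro h ψ hψ
    rw [← lowProj_apply hψ]
    exact DFunLike.congr_fun h ψ
  · exact fun h => ContinuousLinearMap.ext fun ψ => h _ (lowProj_mem n ψ)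

theorem star_lowProj (n : ℕ) : star (lowProj n H) = lowProj n H := by
  rw [lowProj, star_diagonal]
  exact operator_ext fun ψ k => by
    simp only [sector_diagonal]
    split_ifs <;> simp

theorem norm_lowProj_le (n : ℕ) : ‖lowProj n H‖ ≤ 1 := norm_diagonal_le _ _

theorem lowProj_mul_lowProj {m n : ℕ} (hmn : m ≤ n) : lowProj n H * lowProj m H = lowProj m H :=
  ContinuousLinearMap.ext fun ψ =>
    lowProj_apply fun k hk => lowProj_mem m ψ k (by omega)

theorem invNumber_mul_cutNumber (n : ℕ) : invNumber H * cutNumber n H = lowProj n H :=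
  operator_ext fun ψ k => by
    rw [mul_apply_eq_comp, sector_invNumber, sector_cutNumber, sector_lowProj, smul_smul]
    split_ifs
    · rw [inv_mul_cancel₀ (by exact_mod_cast k.succ_ne_zero), one_smul]
    · simp

theorem exists_invNumber_eq (ψ : finiteParticles H) :
    ∃ χ : finiteParticles H, invNumberFin χ = ψ := by
  obtain ⟨ψ, n, hn⟩ := ψ
  refine ⟨⟨cutNumber n H ψ, diagonal_mem_finite _ _ ⟨ψ, n, hn⟩⟩, Subtype.ext ?_⟩
  refine (DFunLike.congr_fun (invNumber_mul_cutNumber n) ψ).trans ?_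
  exact lowProj_apply hn

/-- (1 + N)⁻¹ maps the finite-particle vectors onto themselves and so has dense range. Relations
between unbounded fields are proved with this factor attached, which makes them relations of bounded
operators, and the factor is cancelled here. -/
theorem eq_of_mul_invNumber {A B : Operators H} (h : A * invNumber H = B * invNumber H) : A = B :=
  clm_eq_of_finite fun ψ => by
    obtain ⟨χ, hχ⟩ := exists_invNumber_eq ψ
    rw [← hχ, coe_invNumberFin]
    exact DFunLike.congr_fun h (χ : Fock H)

/-- The case m = n serves a*(h)(1 + N)⁻¹. The case m = n + 1 serves the adjoint of a(h)(1 + N)⁻¹,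
where (1 + N)⁻¹ acts on the larger particle number. -/
theorem norm_smul_creation_le (n m : ℕ) (hnm : n ≤ m) (h : H) :
    ‖((m + 1 : ℂ))⁻¹ • creation n h‖ ≤ ‖h‖ := by
  have h1 : ‖(m + 1 : ℂ)‖ = (m + 1 : ℝ) := by
    rw [← Nat.cast_succ, Complex.norm_natCast, Nat.cast_succ]
  have h2 : (n : ℝ) ≤ m := by exact_mod_cast hnm
  rw [norm_smul, norm_inv, h1, inv_mul_le_iff₀ (by positivity)]
  refine (norm_creation n h).trans (mul_le_mul_of_nonneg_right ?_ (norm_nonneg _))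
  rw [Real.sqrt_le_left (by positivity)]
  nlinarith [n.cast_nonneg (α := ℝ)]

/-- The operator `a*(h) (1 + N)⁻¹`. -/
def cutCreation (h : H) : Operators H :=
  shiftUp (fun n => ((n + 1 : ℂ))⁻¹ • creation n h) fun n => norm_smul_creation_le n n le_rfl h

/-- The operator `a(h) (1 + N)⁻¹`. -/
def cutAnnihilation (h : H) : Operators H :=
  star (shiftUp (fun n => (((n + 1 : ℕ) + 1 : ℂ))⁻¹ • creation n h)
    fun n => norm_smul_creation_le n (n + 1) n.le_succ h)

theorem cutCreation_zero (h : H) (ψ : Fock H) : (cutCreation h ψ).sector 0 = 0 := rfl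

theorem cutCreation_succ (h : H) (ψ : Fock H) (n : ℕ) :
    (cutCreation h ψ).sector (n + 1) = ((n + 1 : ℂ))⁻¹ • creation n h (ψ.sector n) := rfl

theorem cutAnnihilation_sector (h : H) (ψ : Fock H) (n : ℕ) :
    (cutAnnihilation h ψ).sector n =
      (((n + 1 : ℕ) + 1 : ℂ))⁻¹ • annihilation n h (ψ.sector (n + 1)) := by
  rw [cutAnnihilation, sector_star_shiftUp, map_smulₛₗ]
  simp only [map_inv₀, map_add, map_natCast, map_one]
  rfl

theorem norm_cutCreation_le (h : H) : ‖cutCreation h‖ ≤ ‖h‖ := norm_shiftUp_le _ _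

theorem norm_cutAnnihilation_le (h : H) : ‖cutAnnihilation h‖ ≤ ‖h‖ := by
  rw [cutAnnihilation, norm_star]
  exact norm_shiftUp_le _ _

/-- The operator `φ(h) (1 + N)⁻¹`. -/
def cutField (h : H) : Operators H := cutCreation h + cutAnnihilation h

theorem cutField_apply (h : H) (ψ : finiteParticles H) :
    cutField h (ψ : Fock H) = fieldMap h (invNumberFin ψ) := by
  refine Fock.ext fun n => ?_
  rw [cutField, add_apply, Fock.sector_add, cutAnnihilation_sector]
  rcases n with _ | n
  · rw [cutCreation_zero, fieldMap_zero, coe_invNumberFin, sector_invNumber, map_smul, zero_add]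
  · rw [cutCreation_succ, fieldMap_succ, coe_invNumberFin, sector_invNumber, sector_invNumber, map_smul,
      map_smul]

theorem cutField_add (h k : H) : cutField (h + k) = cutField h + cutField k :=
  operator_ext fun ψ n => by
    cases n <;>
    simp only [cutField, add_apply, Fock.sector_add, cutCreation_zero, cutCreation_succ,
      cutAnnihilation_sector, creation_add, annihilation_add, smul_add] <;> abel

theorem cutField_smul (r : ℝ) (h : H) : cutField ((r : ℂ) • h) = (r : ℂ) • cutField h :=
  operator_ext fun ψ n => by
    cases n <;>
    simp only [cutField, add_apply, smul_apply, Fock.sector_add, Fock.sector_smul,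
      cutCreation_zero, cutCreation_succ, cutAnnihilation_sector, creation_smul,
      annihilation_smul, smul_add, Complex.conj_ofReal, smul_zero, smul_comm _ (r : ℂ)]

/-- Symmetry of the field: both sides stand for (1 + N)⁻¹ φ(h) (1 + N)⁻¹. -/
theorem invNumber_mul_cutField (h : H) :
    invNumber H * cutField h = star (cutField h) * invNumber H :=
  operator_eq_of_inner_finite fun ψ χ => by
    rw [mul_apply_eq_comp, mul_apply_eq_comp, inner_star_right,
      ← inner_star_left, star_invNumber, cutField_apply, cutField_apply]
    exact (fieldMap_symmetric h (invNumberFin ψ) (invNumberFin χ)).symm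

/-- Since `star (cutField h)` plays the role of (1 + N)⁻¹ φ(h), this is the commutator [φ(h), φ(k)]
with a factor (1 + N)⁻¹ on either side. -/
theorem cutField_commutator (h k : H) :
    star (cutField h) * cutField k - star (cutField k) * cutField h =
      (⟪h, k⟫_ℂ - ⟪k, h⟫_ℂ) • (invNumber H * invNumber H) :=
  operator_eq_of_inner_finite fun ψ χ => by
    have h1 : ∀ a b : H, ⟪fieldMap a (invNumberFin ψ), fieldMap b (invNumberFin χ)⟫_ℂ =
        ⟪invNumber H (ψ : Fock H), fieldMap a (fieldEnd b (invNumberFin χ))⟫_ℂ := fun a b =>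
      fieldMap_symmetric a (invNumberFin ψ) (fieldEnd b (invNumberFin χ))
    simp only [sub_apply, mul_apply_eq_comp, smul_apply, inner_sub_right,
      inner_star_right, cutField_apply]
    rw [h1, h1, ← inner_sub_right, fieldMap_commutator, inner_smul_right,
      inner_smul_right, coe_invNumberFin, ← inner_star_left _ (ψ : Fock H), star_invNumber]

/-- The operator `(iλ + φ(h)) (1 + N)⁻¹`. -/
def cutDenominator (lam : ℝ) (h : H) : Operators H :=
  (Complex.I * lam) • invNumber H + cutField h

theorem fieldResolvent_mul_cutDenominator (lam : ℝ) (hlam : lam ≠ 0) (h : H) :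
    fieldResolvent lam hlam h * cutDenominator lam h = invNumber H :=
  clm_eq_of_finite fun ψ => by
    rw [mul_apply_eq_comp, cutDenominator, add_apply, smul_apply, cutField_apply]
    exact fieldResolvent_apply lam hlam h (invNumberFin ψ)

/-- The range of the right factor contains iλ + φ(h) applied to every finite-particle vector, so it
is dense. -/
theorem eq_of_mul_cutDenominator (lam : ℝ) (hlam : lam ≠ 0) (h : H) {A B : Operators H}
    (hAB : A * cutDenominator lam h = B * cutDenominator lam h) : A = B :=
  clm_eq_of_resolvent_range lam hlam h fun ψ => by
    obtain ⟨χ, hχ⟩ := exists_invNumber_eq ψ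
    have h1 : (Complex.I * lam) • (ψ : Fock H) + fieldMap h ψ =
        cutDenominator lam h (χ : Fock H) := by
      rw [cutDenominator, add_apply, smul_apply, cutField_apply, ← coe_invNumberFin, hχ]
    rw [h1]
    exact DFunLike.congr_fun hAB (χ : Fock H)

theorem eq_of_star_cutDenominator_mul (lam : ℝ) (hlam : lam ≠ 0) (h : H) {A B : Operators H}
    (hAB : star (cutDenominator lam h) * A = star (cutDenominator lam h) * B) : A = B := by
  have h' := congrArg star hAB
  rw [star_mul, star_mul, star_star] at h'
  exact star_injective (eq_of_mul_cutDenominator lam hlam h h')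

theorem star_cutDenominator (lam : ℝ) (h : H) :
    star (cutDenominator lam h) = (Complex.I * (-lam : ℝ)) • invNumber H + star (cutField h) := by
  rw [cutDenominator, star_add, star_smul, star_invNumber]
  simp

theorem star_cutDenominator_mul_invNumber (lam : ℝ) (h : H) :
    star (cutDenominator lam h) * invNumber H = invNumber H * cutDenominator (-lam) h := by
  rw [star_cutDenominator, cutDenominator, add_mul, mul_add, invNumber_mul_cutField,
    smul_mul_assoc, mul_smul_comm]

/-- Multiplied on the left by (1 + N)⁻¹(−iλ + φ(h)) and on the right by (−iλ + φ(h))(1 + N)⁻¹, both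
sides become (1 + N)⁻¹(−iλ + φ(h))(1 + N)⁻¹; the two factors can be cancelled. -/
theorem star_fieldResolvent (lam : ℝ) (hlam : lam ≠ 0) (h : H) :
    star (fieldResolvent lam hlam h) = fieldResolvent (-lam) (neg_ne_zero.2 hlam) h := by
  refine eq_of_star_cutDenominator_mul lam hlam h
    (eq_of_mul_cutDenominator (-lam) (neg_ne_zero.2 hlam) h ?_)
  rw [← star_mul, fieldResolvent_mul_cutDenominator, star_invNumber, mul_assoc,
    fieldResolvent_mul_cutDenominator, star_cutDenominator_mul_invNumber]

/-- The resolvents leave the domain of the number operator invariant. -/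
theorem exists_fieldResolvent_mul_invNumber (lam : ℝ) (hlam : lam ≠ 0) (h : H)
    (hh : 2 * ‖h‖ < |lam|) : ∃ R' : Operators H,
      fieldResolvent lam hlam h * invNumber H = invNumber H * R' := by
  set R := fieldResolvent lam hlam h with hR
  -- `D` is [N, φ(h)](1 + N)⁻¹, because [N, a*] = a* and [N, a] = −a. It measures the failure of (1
  -- + N)⁻¹ to commute with the field.
  set D : Operators H := cutCreation h - cutAnnihilation h with hD
  have hcomm : invNumber H * (cutDenominator lam h + D * invNumber H) =
      cutDenominator lam h * invNumber H := operator_ext fun ψ n => by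
    rcases n with _ | n
    · simp only [cutDenominator, hD, cutField, mul_apply_eq_comp, add_apply, sub_apply,
        smul_apply, Fock.sector_add, Fock.sector_sub, Fock.sector_smul, cutCreation_zero,
        cutAnnihilation_sector, sector_invNumber, map_smul]
      module
    · simp only [cutDenominator, hD, cutField, mul_apply_eq_comp, add_apply, sub_apply,
        smul_apply, Fock.sector_add, Fock.sector_sub, Fock.sector_smul, cutCreation_succ,
        cutAnnihilation_sector, sector_invNumber, map_smul]
      have e1 : ((n + 1 : ℕ) + 1 : ℂ) ≠ 0 := by exact_mod_cast (n + 1).succ_ne_zero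
      have e2 : ((n + 1 : ℂ)) ≠ 0 := by exact_mod_cast n.succ_ne_zero
      have e3 : ((n + 1 + 1 : ℕ) + 1 : ℂ) ≠ 0 := by exact_mod_cast (n + 1 + 1).succ_ne_zero
      match_scalars <;> (push_cast at *; field_simp) <;> ring
  have hDR : ‖-(D * R)‖ < 1 := by
    have hl : 0 < |lam| := abs_pos.2 hlam
    rw [norm_neg]
    calc ‖D * R‖ ≤ ‖D‖ * ‖R‖ := norm_mul_le _ _
      _ ≤ (2 * ‖h‖) * |lam|⁻¹ := by
        refine mul_le_mul ?_ (norm_fieldResolvent_le lam hlam h) (norm_nonneg _) (by positivity)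
        refine (norm_sub_le _ _).trans ?_
        linarith [norm_cutCreation_le h, norm_cutAnnihilation_le h]
      _ < 1 := by rwa [← div_eq_mul_inv, div_lt_one hl]
  obtain ⟨E, hE⟩ : IsUnit (1 + D * R) := by
    have := isUnit_one_sub_of_norm_lt_one hDR
    rwa [sub_neg_eq_add] at this
  -- Since ‖D‖ ≤ 2‖h‖ and ‖R‖ ≤ 1/|λ|, the factor 1 + DR is invertible by a Neumann series. Moving
  -- it to the other side exhibits R (1 + N)⁻¹ as (1 + N)⁻¹ R'.
  have key : R * invNumber H * (1 + D * R) = invNumber H * R := by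
    refine eq_of_mul_cutDenominator lam hlam h ?_
    have e1 : (1 + D * R) * cutDenominator lam h = cutDenominator lam h + D * invNumber H := by
      rw [add_mul, one_mul, mul_assoc, fieldResolvent_mul_cutDenominator]
    rw [mul_assoc, e1, mul_assoc, hcomm, ← mul_assoc, mul_assoc (invNumber H),
      fieldResolvent_mul_cutDenominator]
  refine ⟨R * (E⁻¹ : (Operators H)ˣ), ?_⟩
  rw [← mul_assoc, ← key, ← hE, mul_assoc, Units.mul_inv, mul_one]

/-! ### Commutators and differences of resolvents -/

theorem eq_of_fieldResolvent_mul (lam : ℝ) (hlam : lam ≠ 0) (h : H) {A B : Operators H}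
    (hAB : fieldResolvent lam hlam h * A = fieldResolvent lam hlam h * B) : A = B := by
  have h' := congrArg star hAB
  rw [star_mul, star_mul, star_fieldResolvent] at h'
  have h2 := congrArg (· * cutDenominator (-lam) h) h'
  simp only [mul_assoc, fieldResolvent_mul_cutDenominator] at h2
  exact star_injective (eq_of_mul_invNumber h2)

section commutator

variable {lam : ℝ} {hlam : lam ≠ 0} {h : H} {R' : Operators H}
  (hR' : fieldResolvent lam hlam h * invNumber H = invNumber H * R')

include hR'

/-- (1 + N)⁻¹ R' is R (1 + N)⁻¹, so this expresses that R is also a right inverse of iλ + φ(h), on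
the range of (1 + N)⁻¹. -/
theorem cutDenominator_mul : cutDenominator lam h * R' = invNumber H := by
  refine eq_of_fieldResolvent_mul lam hlam h ?_
  rw [← mul_assoc, fieldResolvent_mul_cutDenominator, hR']

theorem cutField_mul_self :
    cutField h * R' = (1 - (Complex.I * lam) • fieldResolvent lam hlam h) * invNumber H := by
  have := cutDenominator_mul hR'
  rw [cutDenominator, add_mul, smul_mul_assoc] at this
  rw [sub_mul, one_mul, smul_mul_assoc, hR', eq_sub_iff_add_eq', this]

/-- The commutator of a field operator with a resolvent. -/
theorem cutField_mul (k : H) :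
    cutField k * R' = fieldResolvent lam hlam h * cutField k + (⟪h, k⟫_ℂ - ⟪k, h⟫_ℂ) •
      (fieldResolvent lam hlam h * fieldResolvent lam hlam h * invNumber H) := by
  have h1 : star (cutDenominator (-lam) h) * fieldResolvent lam hlam h = invNumber H := by
    have := congrArg star (fieldResolvent_mul_cutDenominator (-lam) (neg_ne_zero.2 hlam) h)
    rw [star_mul, star_fieldResolvent, star_invNumber] at this
    simpa only [neg_neg] using this
  refine eq_of_star_cutDenominator_mul (-lam) (neg_ne_zero.2 hlam) h ?_
  rw [mul_add, ← mul_assoc _ _ (cutField k), h1, mul_smul_comm, ← mul_assoc, ← mul_assoc, ← mul_assoc,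
    h1]
  have h2 : star (cutDenominator (-lam) h) * cutField k =
      star (cutField k) * cutDenominator lam h +
        (⟪h, k⟫_ℂ - ⟪k, h⟫_ℂ) • (invNumber H * invNumber H) := by
    rw [← cutField_commutator, star_cutDenominator, cutDenominator, neg_neg, add_mul, mul_add,
      smul_mul_assoc, mul_smul_comm, invNumber_mul_cutField]
    abel
  rw [h2, add_mul, mul_assoc, cutDenominator_mul hR', smul_mul_assoc, mul_assoc, ← hR',
    invNumber_mul_cutField, mul_assoc (invNumber H)]

end commutator

/-- Formally R₁ − R = R₁ (xΦ − yΨ) R. The field Φ is absorbed by R, while Ψ is commuted through R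
and then absorbed by S; this is why the factor S is needed. `M` stands for (1 + N)⁻¹, which keeps
the fields bounded, and R', S' are R, S after passing through `M`. -/
theorem sub_mul_mul_eq {A : Type*} [Ring A] [Algebra ℂ A] {R S R₁ M Φ Ψ R' S' : A} {x y z w c : ℂ}
    (h1 : (R₁ - R) * M = R₁ * ((x • Φ - y • Ψ) * R')) (h2 : Φ * R' = (1 - z • R) * M)
    (h3 : Ψ * R' = R * Ψ + c • (R * R * M)) (h4 : S * M = M * S')
    (h5 : Ψ * S' = (1 - w • S) * M) :
    (R₁ - R) * S * M =
      R₁ * (x • ((1 - z • R) * S) - y • (R * (1 - w • S) + c • (R * R * S))) * M := by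
  have h6 : Φ * (R' * S') = (1 - z • R) * S * M := by
    rw [← mul_assoc, h2, mul_assoc, ← h4, mul_assoc]
  have h7 : Ψ * (R' * S') = R * (1 - w • S) * M + c • (R * R * S) * M := by
    rw [← mul_assoc, h3, add_mul, mul_assoc, h5, smul_mul_assoc, mul_assoc (R * R), ← h4,
      smul_mul_assoc]
    simp only [mul_assoc]
  rw [mul_assoc, h4, ← mul_assoc, h1, mul_assoc, mul_assoc, mul_assoc R₁]
  rw [sub_mul, smul_mul_assoc, smul_mul_assoc, h6, h7, ← add_mul,
    sub_mul (x • ((1 - z • R) * S)), smul_mul_assoc, smul_mul_assoc]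

/-- The change of a resolvent under rotation of the test function, multiplied by another
resolvent. -/
theorem fieldResolvent_sub_mul {lam mu : ℝ} (hlam : lam ≠ 0) (hmu : mu ≠ 0) {h k : H}
    (hh : 2 * ‖h‖ < |lam|) (hk : 2 * ‖k‖ < |mu|) (a b : ℝ) :
    (fieldResolvent lam hlam ((a : ℂ) • h + (b : ℂ) • k) - fieldResolvent lam hlam h) *
        fieldResolvent mu hmu k =
      fieldResolvent lam hlam ((a : ℂ) • h + (b : ℂ) • k) *
        (((1 - a : ℝ) : ℂ) • ((1 - (Complex.I * lam) • fieldResolvent lam hlam h) *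
            fieldResolvent mu hmu k) -
          (b : ℂ) • (fieldResolvent lam hlam h *
              (1 - (Complex.I * mu) • fieldResolvent mu hmu k) +
            (⟪h, k⟫_ℂ - ⟪k, h⟫_ℂ) • (fieldResolvent lam hlam h * fieldResolvent lam hlam h *
              fieldResolvent mu hmu k))) := by
  obtain ⟨R', hR'⟩ := exists_fieldResolvent_mul_invNumber lam hlam h hh
  obtain ⟨S', hS'⟩ := exists_fieldResolvent_mul_invNumber mu hmu k hk
  set R := fieldResolvent lam hlam h
  set S := fieldResolvent mu hmu k
  set Ru := fieldResolvent lam hlam ((a : ℂ) • h + (b : ℂ) • k)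
  have e1 : (Ru - R) * invNumber H =
      Ru * ((((1 - a : ℝ) : ℂ) • cutField h - (b : ℂ) • cutField k) * R') := by
    have h1 : Ru * invNumber H = Ru * (cutDenominator lam h * R') := by
      rw [cutDenominator_mul hR']
    have h2 : R * invNumber H =
        Ru * (cutDenominator lam ((a : ℂ) • h + (b : ℂ) • k) * R') := by
      rw [← mul_assoc, fieldResolvent_mul_cutDenominator, hR']
    rw [sub_mul, h1, h2, ← mul_sub, ← sub_mul]
    congr 2
    simp only [cutDenominator, cutField_add, cutField_smul, Complex.ofReal_sub,
      Complex.ofReal_one, sub_smul, one_smul]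
    abel
  exact eq_of_mul_invNumber (sub_mul_mul_eq e1 (cutField_mul_self hR') (cutField_mul hR' k) hS'
    (cutField_mul_self hS'))

/-- The resolvent of the rotated field enters only through its norm bound 1/|λ|, so `K` is
independent of a and b, and the difference vanishes in norm as a → 1 and b → 0. -/
theorem exists_norm_fieldResolvent_sub_mul_le {lam mu : ℝ} (hlam : lam ≠ 0) (hmu : mu ≠ 0) {h k : H}
    (hh : 2 * ‖h‖ < |lam|) (hk : 2 * ‖k‖ < |mu|) : ∃ K : ℝ, ∀ a b : ℝ,
    ‖(fieldResolvent lam hlam ((a : ℂ) • h + (b : ℂ) • k) - fieldResolvent lam hlam h) *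
        fieldResolvent mu hmu k‖ ≤ |lam|⁻¹ * (|1 - a| * K + |b| * K) := by
  refine ⟨max ‖(1 - (Complex.I * lam) • fieldResolvent lam hlam h) * fieldResolvent mu hmu k‖
    ‖fieldResolvent lam hlam h * (1 - (Complex.I * mu) • fieldResolvent mu hmu k) +
            (⟪h, k⟫_ℂ - ⟪k, h⟫_ℂ) • (fieldResolvent lam hlam h * fieldResolvent lam hlam h *
              fieldResolvent mu hmu k)‖, fun a b => ?_⟩
  rw [fieldResolvent_sub_mul hlam hmu hh hk]
  refine (norm_mul_le _ _).trans (mul_le_mul (norm_fieldResolvent_le _ _ _)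
    ((norm_sub_le _ _).trans (add_le_add ?_ ?_)) (norm_nonneg _) (by positivity))
  · rw [norm_smul, Complex.norm_real, Real.norm_eq_abs]
    exact mul_le_mul_of_nonneg_left (le_max_left _ _) (abs_nonneg _)
  · rw [norm_smul, Complex.norm_real, Real.norm_eq_abs]
    exact mul_le_mul_of_nonneg_left (le_max_right _ _) (abs_nonneg _)

/-! ### Gauge transformations -/

theorem sector_gaugeUnitary (u : ℝ) (ψ : Fock H) (n : ℕ) :
    (gaugeUnitary u ψ).sector n = Complex.exp (Complex.I * u * n) • ψ.sector n := rfl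

theorem gaugeUnitary_mul (u v : ℝ) :
    (gaugeUnitary u * gaugeUnitary v : Operators H) = gaugeUnitary (u + v) :=
  operator_ext fun ψ n => by
    rw [mul_apply_eq_comp, sector_gaugeUnitary, sector_gaugeUnitary, sector_gaugeUnitary, smul_smul,
      ← Complex.exp_add]
    congr 2
    push_cast
    ring

theorem gaugeUnitary_zero : (gaugeUnitary 0 : Operators H) = 1 :=
  operator_ext fun ψ n => by simp [sector_gaugeUnitary]

theorem star_gaugeUnitary (u : ℝ) : star (gaugeUnitary u : Operators H) = gaugeUnitary (-u) := by
  refine star_eq_of_inner fun ψ χ => ?_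
  refine ((Fock.hasSum_inner _ _).congr_fun fun n => ?_).unique (Fock.hasSum_inner _ _)
  rw [sector_gaugeUnitary, sector_gaugeUnitary, inner_smul_left, inner_smul_right,
    ← Complex.exp_conj]
  congr 2
  simp

theorem gaugeUnitary_mem_unitary (u : ℝ) : (gaugeUnitary u : Operators H) ∈ unitary (Operators H) := by
  rw [Unitary.mem_iff, star_gaugeUnitary, gaugeUnitary_mul, gaugeUnitary_mul]
  simp [gaugeUnitary_zero]

/-- The adjoint action of the gauge group. -/
def gaugeAd (u : ℝ) : Operators H →L[ℂ] Operators H :=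
  ContinuousLinearMap.mulLeftRight ℂ (Operators H) (gaugeUnitary u) (gaugeUnitary (-u))

theorem gaugeAd_apply (u : ℝ) (T : Operators H) :
    gaugeAd u T = gaugeUnitary u * T * gaugeUnitary (-u) := rfl

theorem gaugeAd_mul (u : ℝ) (S T : Operators H) :
    gaugeAd u (S * T) = gaugeAd u S * gaugeAd u T := by
  have h : (gaugeUnitary (-u) * gaugeUnitary u : Operators H) = 1 := by
    rw [gaugeUnitary_mul, neg_add_cancel, gaugeUnitary_zero]
  simp only [gaugeAd_apply, mul_assoc]
  rw [← mul_assoc (gaugeUnitary (-u)) (gaugeUnitary u), h, one_mul]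

theorem gaugeAd_star (u : ℝ) (T : Operators H) : gaugeAd u (star T) = star (gaugeAd u T) := by
  rw [gaugeAd_apply, gaugeAd_apply, star_mul, star_mul, star_gaugeUnitary, star_gaugeUnitary,
    neg_neg, mul_assoc]

theorem isTensor_iff {m : ℤ} {T : Operators H} :
    IsTensor m T ↔ ∀ u : ℝ, gaugeAd u T = Complex.exp (Complex.I * u * m) • T := by
  simp only [IsTensor, gaugeAd_apply]

theorem gaugeAd_add (u v : ℝ) (T : Operators H) : gaugeAd (u + v) T = gaugeAd u (gaugeAd v T) := by
  simp only [gaugeAd_apply, mul_assoc, gaugeUnitary_mul]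
  simp only [← mul_assoc, gaugeUnitary_mul]
  rw [neg_add, add_comm (-u)]

theorem gaugeAd_zero (T : Operators H) : gaugeAd 0 T = T := by
  rw [gaugeAd_apply, neg_zero, gaugeUnitary_zero, one_mul, mul_one]

theorem norm_gaugeAd (u : ℝ) (T : Operators H) : ‖gaugeAd u T‖ = ‖T‖ :=
  (CStarRing.norm_mul_mem_unitary _ (gaugeUnitary_mem_unitary _)).trans
    (CStarRing.norm_mem_unitary_mul _ (gaugeUnitary_mem_unitary _))

theorem gaugeAd_sector (u : ℝ) (T : Operators H) (ψ : Fock H) (n : ℕ) :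
    (gaugeAd u T ψ).sector n =
      Complex.exp (Complex.I * u * n) • (T (gaugeUnitary (-u) ψ)).sector n := by
  rw [gaugeAd_apply, mul_apply_eq_comp, mul_apply_eq_comp, sector_gaugeUnitary]

theorem isTensor_diagonal (w : ℕ → ℂ) {C : ℝ} (hw : ∀ n, ‖w n‖ ≤ C) :
    IsTensor 0 (diagonal w hw : Operators H) := isTensor_iff.2 fun u => operator_ext fun ψ n => by
  rw [gaugeAd_sector, sector_diagonal, sector_gaugeUnitary, smul_comm (w n), smul_smul,
    ← Complex.exp_add]
  simp

theorem isTensor_shiftUp (T : ∀ n, NParticle n H →L[ℂ] NParticle (n + 1) H) {C : ℝ}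
    (hT : ∀ n, ‖T n‖ ≤ C) : IsTensor 1 (shiftUp T hT) :=
  isTensor_iff.2 fun u => operator_ext fun ψ n => by
    rw [gaugeAd_sector, smul_apply, Fock.sector_smul]
    rcases n with _ | n
    · rw [sector_shiftUp_zero, sector_shiftUp_zero, smul_zero, smul_zero]
    · rw [sector_shiftUp_succ, sector_shiftUp_succ, sector_gaugeUnitary, map_smul, smul_smul,
        ← Complex.exp_add]
      congr 2
      push_cast
      ring

theorem IsTensor.mul {m n : ℤ} {S T : Operators H} (hS : IsTensor m S) (hT : IsTensor n T) :
    IsTensor (m + n) (S * T) := isTensor_iff.2 fun u => by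
  rw [gaugeAd_mul, isTensor_iff.1 hS, isTensor_iff.1 hT, smul_mul_smul_comm, ← Complex.exp_add]
  congr 2
  push_cast
  ring

theorem IsTensor.star {m : ℤ} {T : Operators H} (hT : IsTensor m T) : IsTensor (-m) (star T) :=
  isTensor_iff.2 fun u => by
    rw [gaugeAd_star, isTensor_iff.1 hT, star_smul]
    congr 1
    rw [RCLike.star_def, ← Complex.exp_conj]
    simp

theorem IsTensor.add {m : ℤ} {S T : Operators H} (hS : IsTensor m S) (hT : IsTensor m T) :
    IsTensor m (S + T) := isTensor_iff.2 fun u => by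
  rw [map_add, isTensor_iff.1 hS, isTensor_iff.1 hT, smul_add]

theorem IsTensor.smul {m : ℤ} {T : Operators H} (c : ℂ) (hT : IsTensor m T) :
    IsTensor m (c • T) := isTensor_iff.2 fun u => by
  rw [map_smul, isTensor_iff.1 hT, smul_comm]

theorem isTensor_zero (m : ℤ) : IsTensor m (0 : Operators H) := isTensor_iff.2 fun u => by
  rw [map_zero, smul_zero]

theorem isTensor_one : IsTensor 0 (1 : Operators H) := isTensor_iff.2 fun u => by
  rw [gaugeAd_apply, mul_one, gaugeUnitary_mul, add_neg_cancel, gaugeUnitary_zero]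
  simp

theorem isClosed_isTensor (m : ℤ) : IsClosed {T : Operators H | IsTensor m T} := by
  simp only [isTensor_iff, Set.ofPred_forall]
  exact isClosed_iInter fun u => isClosed_eq (gaugeAd u).continuous (continuous_const_smul _)

theorem isTensor_cutCreation (h : H) : IsTensor 1 (cutCreation h) := isTensor_shiftUp _ _

theorem isTensor_cutAnnihilation (h : H) : IsTensor (-1) (cutAnnihilation h) :=
  (isTensor_shiftUp _ _).star

theorem isTensor_invNumber : IsTensor 0 (invNumber H) := isTensor_diagonal _ _

theorem gaugeAd_invNumber (u : ℝ) : gaugeAd u (invNumber H) = invNumber H := by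
  rw [isTensor_iff.1 isTensor_invNumber]
  simp

/-- The creation part has degree 1 and is linear in h, the annihilation part has degree −1 and is
antilinear; hence one phase in front of h accounts for both. -/
theorem gaugeAd_cutDenominator (u lam : ℝ) (h : H) :
    gaugeAd u (cutDenominator lam h) =
      cutDenominator lam (Complex.exp (Complex.I * u) • h) := by
  have h1 : gaugeAd u (cutCreation h) = cutCreation (Complex.exp (Complex.I * u) • h) := by
    rw [isTensor_iff.1 (isTensor_cutCreation h)]
    refine operator_ext fun ψ n => ?_
    rcases n with _ | n
    · simp [cutCreation_zero]
    · rw [smul_apply, Fock.sector_smul, cutCreation_succ, cutCreation_succ, creation_smul,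
        smul_apply, smul_comm]
      simp
  have h2 : gaugeAd u (cutAnnihilation h) =
      cutAnnihilation (Complex.exp (Complex.I * u) • h) := by
    rw [isTensor_iff.1 (isTensor_cutAnnihilation h)]
    refine operator_ext fun ψ n => ?_
    rw [smul_apply, Fock.sector_smul, cutAnnihilation_sector, cutAnnihilation_sector,
      annihilation_smul, smul_apply, smul_comm, ← Complex.exp_conj]
    simp
  rw [cutDenominator, cutField, map_add, map_add, map_smul, h1, h2, gaugeAd_invNumber]
  rfl

theorem gaugeAd_fieldResolvent (u lam : ℝ) (hlam : lam ≠ 0) (h : H) :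
    gaugeAd u (fieldResolvent lam hlam h) =
      fieldResolvent lam hlam (Complex.exp (Complex.I * u) • h) := by
  refine eq_of_mul_cutDenominator lam hlam (Complex.exp (Complex.I * u) • h) ?_
  rw [fieldResolvent_mul_cutDenominator, ← gaugeAd_cutDenominator, ← gaugeAd_mul,
    fieldResolvent_mul_cutDenominator, gaugeAd_invNumber]

/-! ### Norm continuity of the gauge action -/

theorem continuous_gaugeAd_of_tendsto {T : Operators H}
    (hT : Filter.Tendsto (fun u : ℝ => gaugeAd u T - T) (nhds 0) (nhds 0)) :
    Continuous fun u : ℝ => gaugeAd u T := by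
  refine continuous_iff_continuousAt.2 fun v => ?_
  rw [ContinuousAt, tendsto_iff_norm_sub_tendsto_zero]
  have h1 : Filter.Tendsto (fun u : ℝ => u - v) (nhds v) (nhds 0) :=
    Continuous.tendsto' (by fun_prop) _ _ (sub_self v)
  refine ((tendsto_zero_iff_norm_tendsto_zero.1 hT).comp h1).congr fun u => ?_
  rw [Function.comp_apply, ← norm_gaugeAd v (gaugeAd (u - v) T - T), map_sub, ← gaugeAd_add,
    add_sub_cancel]

/-- The gauge action is norm continuous on the product of resolvents of conjugate fields. -/
theorem continuous_gaugeAd_resolvents {lam mu : ℝ} (hlam : lam ≠ 0) (hmu : mu ≠ 0) {h : H}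
    (hh : 2 * ‖h‖ < |lam|) (hk : 2 * ‖h‖ < |mu|) :
    Continuous fun u : ℝ => gaugeAd u
      (fieldResolvent lam hlam h * fieldResolvent mu hmu (Complex.I • h)) := by
  have hI : ‖Complex.I • h‖ = ‖h‖ := by rw [norm_smul, Complex.norm_I, one_mul]
  obtain ⟨K, hK⟩ := exists_norm_fieldResolvent_sub_mul_le hlam hmu (h := h) (k := Complex.I • h) hh
    (by rwa [hI])
  obtain ⟨K', hK'⟩ := exists_norm_fieldResolvent_sub_mul_le (neg_ne_zero.2 hmu) (neg_ne_zero.2 hlam)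
    (h := Complex.I • h) (k := h) (by rwa [hI, abs_neg]) (by rwa [abs_neg])
  set R := fieldResolvent lam hlam h with hR
  set S := fieldResolvent mu hmu (Complex.I • h) with hS
  have e1 : ∀ u : ℝ, gaugeAd u R - R = fieldResolvent lam hlam
      ((Real.cos u : ℂ) • h + (Real.sin u : ℂ) • Complex.I • h) - R := fun u => by
    rw [gaugeAd_fieldResolvent, mul_comm Complex.I, Complex.exp_mul_I, add_smul, mul_smul,
      Complex.ofReal_cos, Complex.ofReal_sin]
  have e2 : ∀ u : ℝ, star (gaugeAd (-u) S - S) = fieldResolvent (-mu) (neg_ne_zero.2 hmu)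
      ((Real.cos u : ℂ) • Complex.I • h + (Real.sin u : ℂ) • h) -
        fieldResolvent (-mu) (neg_ne_zero.2 hmu) (Complex.I • h) := fun u => by
    rw [star_sub, gaugeAd_fieldResolvent, star_fieldResolvent, star_fieldResolvent]
    congr 2
    rw [mul_comm Complex.I, Complex.exp_mul_I, smul_smul, smul_smul, ← add_smul]
    congr 1
    push_cast
    rw [Complex.cos_neg, Complex.sin_neg]
    linear_combination -Complex.sin u * Complex.I_mul_I
  refine continuous_gaugeAd_of_tendsto (squeeze_zero_norm
    (a := fun u : ℝ => |-mu|⁻¹ * (|1 - Real.cos u| * K' + |Real.sin u| * K') +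
      |lam|⁻¹ * (|1 - Real.cos u| * K + |Real.sin u| * K)) (fun u => ?_) ?_)
  -- In each term one factor varies and the other is a fixed resolvent of the conjugate field. In
  -- the first term the varying factor stands on the right; passing to adjoints brings it to the
  -- left, where the bound for rotated resolvents applies.
  · have e3 : gaugeAd u (R * S) - R * S =
        gaugeAd u (R * (S - gaugeAd (-u) S)) + (gaugeAd u R - R) * S := by
      rw [gaugeAd_mul, gaugeAd_mul, map_sub, ← gaugeAd_add, add_neg_cancel, gaugeAd_zero]
      noncomm_ring
    rw [e3]
    refine (norm_add_le _ _).trans (add_le_add ?_ ?_)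
    · rw [norm_gaugeAd, ← norm_neg, ← mul_neg, neg_sub, ← norm_star, star_mul, e2,
        star_fieldResolvent]
      exact hK' _ _
    · rw [e1]
      exact hK _ _
  · refine Continuous.tendsto' (by fun_prop) _ _ ?_
    simp

/-! ### Fourier components with regard to the gauge group -/

/-- The component of degree `m` of an operator on which the gauge group acts norm continuously. -/
def fourierComp (m : ℤ) (T : Operators H) : Operators H :=
  ⨍ u in (0 : ℝ)..2 * Real.pi, Complex.exp (-(Complex.I * u * m)) • gaugeAd u T

theorem fourierComp_eq (m : ℤ) (T : Operators H) : fourierComp m T =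
    (2 * Real.pi)⁻¹ • ∫ u in (0 : ℝ)..2 * Real.pi,
      Complex.exp (-(Complex.I * u * m)) • gaugeAd u T := by
  rw [fourierComp, interval_average_eq, sub_zero]

/-- The gauge group acts norm continuously on `T`. -/
def GaugeContinuous (T : Operators H) : Prop := Continuous fun u : ℝ => gaugeAd u T

theorem GaugeContinuous.integrand {T : Operators H} (hT : GaugeContinuous T) (m : ℤ) :
    Continuous fun u : ℝ => Complex.exp (-(Complex.I * u * m)) • gaugeAd u T := by
  have h : Continuous fun u : ℝ => Complex.exp (-(Complex.I * u * m)) := by fun_prop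
  exact h.smul hT

theorem IsTensor.gaugeContinuous {m : ℤ} {T : Operators H} (hT : IsTensor m T) :
    GaugeContinuous T := by
  simp only [GaugeContinuous, isTensor_iff.1 hT]
  have h : Continuous fun u : ℝ => Complex.exp (Complex.I * u * m) := by fun_prop
  exact h.smul continuous_const

theorem GaugeContinuous.add {S T : Operators H} (hS : GaugeContinuous S) (hT : GaugeContinuous T) :
    GaugeContinuous (S + T) := by
  simp only [GaugeContinuous, map_add]
  exact Continuous.add hS hT

theorem GaugeContinuous.smul {T : Operators H} (c : ℂ) (hT : GaugeContinuous T) :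
    GaugeContinuous (c • T) := by
  simp only [GaugeContinuous, map_smul]
  exact Continuous.const_smul hT c

theorem GaugeContinuous.sub {S T : Operators H} (hS : GaugeContinuous S) (hT : GaugeContinuous T) :
    GaugeContinuous (S - T) := by
  simp only [GaugeContinuous, map_sub]
  exact Continuous.sub hS hT

theorem GaugeContinuous.mul {S T : Operators H} (hS : GaugeContinuous S) (hT : GaugeContinuous T) :
    GaugeContinuous (S * T) := by
  simp only [GaugeContinuous, gaugeAd_mul]
  exact Continuous.mul hS hT

theorem gaugeAd_periodic (T : Operators H) (u : ℝ) : gaugeAd (u + 2 * Real.pi) T = gaugeAd u T := by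
  have h : (gaugeUnitary (2 * Real.pi) : Operators H) = 1 := operator_ext fun ψ n => by
    rw [sector_gaugeUnitary]
    have : Complex.exp (Complex.I * (2 * Real.pi : ℝ) * n) = 1 := by
      rw [← Complex.exp_nat_mul_two_pi_mul_I n]
      congr 1
      push_cast
      ring
    rw [this, one_smul]
    rfl
  rw [gaugeAd_add, gaugeAd_apply _ T, ← star_gaugeUnitary, h, star_one, mul_one, one_mul]

/-- The gauge action translates the 2π-periodic integrand up to the factor e^{ivm}, and its integral
over a period is translation invariant. -/
theorem isTensor_fourierComp (m : ℤ) {T : Operators H} (hT : GaugeContinuous T) :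
    IsTensor m (fourierComp m T) := isTensor_iff.2 fun v => by
  set F : ℝ → Operators H := fun u => Complex.exp (-(Complex.I * u * m)) • gaugeAd u T with hF
  have hper : Function.Periodic F (2 * Real.pi) := fun u => by
    simp only [hF, gaugeAd_periodic]
    congr 1
    have : -(Complex.I * ((u + 2 * Real.pi : ℝ) : ℂ) * m) =
        -(Complex.I * u * m) - (m : ℂ) * (2 * Real.pi * Complex.I) := by
      push_cast
      ring
    rw [this, Complex.exp_sub, Complex.exp_int_mul_two_pi_mul_I, div_one]
  have h1 : ∀ u : ℝ, gaugeAd v (F u) = Complex.exp (Complex.I * v * m) • F (u + v) := fun u => by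
    simp only [hF, map_smul]
    rw [← gaugeAd_add, add_comm v u, smul_smul, ← Complex.exp_add]
    congr 2
    push_cast
    ring
  rw [fourierComp_eq, ← Complex.coe_smul, map_smul, ← ContinuousLinearMap.intervalIntegral_comp_comm
    _ ((hT.integrand m).intervalIntegrable _ _)]
  simp only [← hF]
  rw [smul_comm]
  congr 1
  change ∫ u in (0 : ℝ)..2 * Real.pi, gaugeAd v (F u) = _
  simp only [h1]
  rw [intervalIntegral.integral_smul, intervalIntegral.integral_comp_add_right, zero_add, add_comm,
    hper.intervalIntegral_add_eq v 0, zero_add]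

theorem fourierComp_add (m : ℤ) {S T : Operators H} (hS : GaugeContinuous S)
    (hT : GaugeContinuous T) : fourierComp m (S + T) = fourierComp m S + fourierComp m T := by
  simp only [fourierComp_eq, map_add, smul_add]
  rw [intervalIntegral.integral_add ((hS.integrand m).intervalIntegrable _ _)
    ((hT.integrand m).intervalIntegrable _ _), smul_add]

theorem fourierComp_smul (m : ℤ) (c : ℂ) (T : Operators H) :
    fourierComp m (c • T) = c • fourierComp m T := by
  simp only [fourierComp_eq, map_smul, smul_comm _ c]
  rw [intervalIntegral.integral_smul, smul_comm]

theorem fourierComp_sub (m : ℤ) {S T : Operators H} (hS : GaugeContinuous S)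
    (hT : GaugeContinuous T) : fourierComp m (S - T) = fourierComp m S - fourierComp m T := by
  have : S - T = S + (-1 : ℂ) • T := by rw [neg_one_smul, sub_eq_add_neg]
  rw [this, fourierComp_add m hS (hT.smul _), fourierComp_smul, neg_one_smul, sub_eq_add_neg]

theorem fourierComp_mul (m : ℤ) {S T : Operators H} (hS : GaugeContinuous S) (hT : IsTensor 0 T) :
    fourierComp m (S * T) = fourierComp m S * T := by
  have h := ContinuousLinearMap.intervalIntegral_comp_comm ((ContinuousLinearMap.mul ℂ
    (Operators H)).flip T) ((hS.integrand m).intervalIntegrable (μ := MeasureTheory.volume) 0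
      (2 * Real.pi))
  simp only [ContinuousLinearMap.flip_apply, ContinuousLinearMap.mul_apply'] at h
  rw [fourierComp_eq, fourierComp_eq, smul_mul_assoc, ← h]
  congr 2
  funext u
  rw [gaugeAd_mul, isTensor_iff.1 hT]
  simp

theorem fourierComp_self {m : ℤ} {T : Operators H} (hT : IsTensor m T) : fourierComp m T = T := by
  rw [fourierComp_eq]
  have : ∀ u : ℝ, Complex.exp (-(Complex.I * u * m)) • gaugeAd u T = T := fun u => by
    rw [isTensor_iff.1 hT, smul_smul, ← Complex.exp_add, neg_add_cancel, Complex.exp_zero, one_smul]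
  simp only [this, intervalIntegral.integral_const, sub_zero]
  rw [smul_smul, inv_mul_cancel₀ (by positivity), one_smul]

theorem fourierComp_of_ne {m k : ℤ} (hmk : k ≠ m) {T : Operators H} (hT : IsTensor k T) :
    fourierComp m T = 0 := by
  have hne : Complex.I * (k - m) ≠ 0 :=
    mul_ne_zero Complex.I_ne_zero (sub_ne_zero.2 (by exact_mod_cast hmk))
  have : ∀ u : ℝ, Complex.exp (-(Complex.I * u * m)) • gaugeAd u T =
      Complex.exp (Complex.I * (k - m) * u) • T := fun u => by
    rw [isTensor_iff.1 hT, smul_smul, ← Complex.exp_add]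
    congr 2
    ring
  have h2 : Complex.I * (k - m) * ((2 * Real.pi : ℝ) : ℂ) =
      ((k - m : ℤ) : ℂ) * (2 * Real.pi * Complex.I) := by
    push_cast
    ring
  rw [fourierComp_eq]
  simp only [this]
  rw [intervalIntegral.integral_smul_const, integral_exp_mul_complex hne, h2,
    Complex.exp_int_mul_two_pi_mul_I]
  simp

theorem norm_fourierComp_le (m : ℤ) (T : Operators H) : ‖fourierComp m T‖ ≤ ‖T‖ := by
  have h := intervalIntegral.norm_integral_le_of_norm_le_const (a := 0) (b := 2 * Real.pi)
    (f := fun u : ℝ => Complex.exp (-(Complex.I * u * m)) • gaugeAd u T) (C := ‖T‖) fun u _ => by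
      rw [norm_smul, norm_gaugeAd, Complex.norm_exp]
      simp
  rw [fourierComp_eq, norm_smul, sub_zero] at *
  have hpi : (0 : ℝ) < 2 * Real.pi := by positivity
  rw [abs_of_pos hpi] at h
  rw [Real.norm_of_nonneg (by positivity), inv_mul_le_iff₀ hpi, mul_comm _ ‖T‖]
  exact h

/-- A closed subspace is closed and convex, and so contains the average of a function with values in
it. -/
theorem fourierComp_mem (m : ℤ) {T : Operators H} (hT : GaugeContinuous T)
    {K : Submodule ℂ (Operators H)} (hK : IsClosed (K : Set (Operators H)))
    (h : ∀ u, gaugeAd u T ∈ K) : fourierComp m T ∈ K := by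
  have hconv : Convex ℝ (K : Set (Operators H)) := (K.restrictScalars ℝ).convex
  refine hconv.set_average_mem hK ?_ ?_ (Filter.Eventually.of_forall fun u => K.smul_mem _ (h u)) ?_
  · rw [Set.uIoc_of_le (by positivity), Real.volume_Ioc]
    simp [Real.pi_pos]
  · rw [Set.uIoc_of_le (by positivity), Real.volume_Ioc]
    exact ENNReal.ofReal_ne_top
  · rw [Set.uIoc_of_le (by positivity)]
    exact (((hT.integrand m).intervalIntegrable 0 (2 * Real.pi)).1)

/-! ### Tensors in the resolvent algebra -/

/-- The space of tensors of degree `m` in the resolvent algebra. -/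
def tensors (D : Set H) (m : ℤ) : Submodule ℂ (Operators H) where
  carrier := {R | R ∈ resolventAlgebra D ∧ IsTensor m R}
  zero_mem' := ⟨zero_mem _, isTensor_zero m⟩
  add_mem' hS hT := ⟨add_mem hS.1 hT.1, hS.2.add hT.2⟩
  smul_mem' c _ hT := ⟨SMulMemClass.smul_mem c hT.1, hT.2.smul c⟩

theorem isClosed_resolventAlgebra (D : Set H) : IsClosed (resolventAlgebra D : Set (Operators H)) :=
  StarSubalgebra.isClosed_topologicalClosure _

theorem isClosed_tensors (D : Set H) (m : ℤ) : IsClosed (tensors D m : Set (Operators H)) :=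
  (isClosed_resolventAlgebra D).inter (isClosed_isTensor m)

theorem IsTensor.mul_degree_zero {m : ℤ} {S T : Operators H} (hS : IsTensor m S)
    (hT : IsTensor 0 T) : IsTensor m (S * T) := by
  have h := hS.mul hT
  rwa [add_zero] at h

theorem tensors_mul {D : Set H} {m n : ℤ} {S T : Operators H} (hS : S ∈ tensors D m)
    (hT : T ∈ tensors D n) : S * T ∈ tensors D (m + n) := ⟨mul_mem hS.1 hT.1, hS.2.mul hT.2⟩

theorem tensors_star {D : Set H} {m : ℤ} {T : Operators H} (hT : T ∈ tensors D m) :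
    star T ∈ tensors D (-m) := ⟨star_mem hT.1, hT.2.star⟩

theorem fieldResolvent_mem {D : Set H} {h : H} (hh : h ∈ D) (lam : ℝ) (hlam : lam ≠ 0) :
    fieldResolvent lam hlam h ∈ resolventAlgebra D :=
  StarSubalgebra.le_topologicalClosure _ (StarAlgebra.subset_adjoin ℂ _ ⟨lam, hlam, h, hh, rfl⟩)

/-! ### Creation operators on the vectors with limited particle number -/

theorem lowProj_mul_cutField (n : ℕ) (h : H) :
    lowProj (n + 1) H * (cutField h * cutNumber n H) = cutField h * cutNumber n H :=
  ContinuousLinearMap.ext fun ψ => lowProj_apply fun k hk => by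
    obtain ⟨k, rfl⟩ : ∃ j, k = j + 1 := ⟨k - 1, by omega⟩
    change (cutField h (cutNumber n H ψ)).sector (k + 1) = 0
    rw [cutField, add_apply, Fock.sector_add, cutCreation_succ,
      cutAnnihilation_sector, sector_cutNumber, sector_cutNumber, if_neg (by omega),
      if_neg (by omega)]
    simp

/-- This is iλR = 1 − R φ(h) on at most n particles, where φ(h) is bounded; iterated, it is an
expansion in powers of 1/λ. -/
theorem smul_fieldResolvent_mul_lowProj (lam : ℝ) (hlam : lam ≠ 0) (h : H) (n : ℕ) :
    (Complex.I * lam) • (fieldResolvent lam hlam h * lowProj n H) =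
      lowProj n H - fieldResolvent lam hlam h * (cutField h * cutNumber n H) := by
  rw [eq_sub_iff_add_eq, ← mul_smul_comm, ← mul_add]
  have : (Complex.I * lam) • lowProj n H + cutField h * cutNumber n H =
      cutDenominator lam h * cutNumber n H := by
    rw [cutDenominator, add_mul, smul_mul_assoc, invNumber_mul_cutNumber]
  rw [this, ← mul_assoc, fieldResolvent_mul_cutDenominator, invNumber_mul_cutNumber]

/-- Expanding zR and zS by h1–h6, the terms of order zero cancel against 1, those of first order
give F + G, and every remaining term carries a surplus resolvent of size 1/|z|. `P'` is the cutoff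
at n + 1 particles, which contains the ranges of F and G. -/
theorem one_sub_mul_eq {A : Type*} [Ring A] [Algebra ℂ A] {R S P P' F F' G G' : A} {z : ℂ}
    (h1 : z • (R * P) = P - R * F) (h2 : z • (R * P') = P' - R * F') (h3 : P' * F = F)
    (h4 : z • (S * P) = P - S * G) (h5 : z • (S * P') = P' - S * G') (h6 : P' * G = G) :
    (z • (1 - (z • R) * (z • S))) * P - (F + G) =
      -(R * (F' * F)) - R * (F' * G) - (z • R) * (S * (G' * G)) := by
  have a1 : z • (R * F) = F - R * (F' * F) := by
    have := congrArg (· * F) h2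
    simpa only [smul_mul_assoc, mul_assoc, h3, sub_mul] using this
  have a2 : z • (R * G) = G - R * (F' * G) := by
    have := congrArg (· * G) h2
    simpa only [smul_mul_assoc, mul_assoc, h6, sub_mul] using this
  have a3 : z • (S * G) = G - S * (G' * G) := by
    have := congrArg (· * G) h5
    simpa only [smul_mul_assoc, mul_assoc, h6, sub_mul] using this
  have b1 : (z • (1 - (z • R) * (z • S))) * P = z • P - z • ((z • R) * (z • (S * P))) := by
    rw [smul_mul_assoc, sub_mul, one_mul, smul_sub, mul_assoc, smul_mul_assoc z S]
  have b2 : z • ((z • R) * (S * G)) = (z • R) * G - (z • R) * (S * (G' * G)) := by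
    rw [← mul_smul_comm, a3, mul_sub]
  rw [b1, h4, mul_sub, smul_mul_assoc z R P, h1, smul_sub, smul_sub, b2, smul_mul_assoc z R G, a1, a2]
  abel

theorem cutCreation_I (h : H) : cutCreation (Complex.I • h) = Complex.I • cutCreation h :=
  operator_ext fun ψ n => by
    rcases n with _ | n
    · simp [cutCreation_zero]
    · rw [smul_apply, Fock.sector_smul, cutCreation_succ, cutCreation_succ, creation_smul,
        smul_apply, smul_comm]

theorem cutAnnihilation_I (h : H) :
    cutAnnihilation (Complex.I • h) = (-Complex.I) • cutAnnihilation h :=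
  operator_ext fun ψ n => by
    rw [smul_apply, Fock.sector_smul, cutAnnihilation_sector, cutAnnihilation_sector,
      annihilation_smul, smul_apply, smul_comm, Complex.conj_I]

theorem isTensor_cutNumber (n : ℕ) : IsTensor 0 (cutNumber n H) := isTensor_diagonal _ _

theorem isTensor_lowProj (n : ℕ) : IsTensor 0 (lowProj n H) := isTensor_diagonal _ _

/-! ### Gauge continuous approximants of field operators -/

theorem gaugeAd_mem_resolventAlgebra {D : Set H} (hD : ∀ h ∈ D, ∀ c : ℂ, c • h ∈ D) {h : H}
    (hh : h ∈ D) (lam : ℝ) (hlam : lam ≠ 0) (u : ℝ) :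
    gaugeAd u (fieldResolvent lam hlam h) ∈ resolventAlgebra D := by
  rw [gaugeAd_fieldResolvent]
  exact fieldResolvent_mem (hD h hh _) lam hlam

/-- The operator `iλ (1 - (iλ R(λ, h)) (iλ R(λ, ih)))`. -/
def resolventApprox (lam : ℝ) (hlam : lam ≠ 0) (h : H) : Operators H :=
  (Complex.I * lam) • (1 - ((Complex.I * lam) • fieldResolvent lam hlam h) *
    ((Complex.I * lam) • fieldResolvent lam hlam (Complex.I • h)))

theorem gaugeContinuous_resolventApprox {lam : ℝ} (hlam : lam ≠ 0) {h : H}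
    (hh : 2 * ‖h‖ < |lam|) : GaugeContinuous (resolventApprox lam hlam h) := by
  have hcts : GaugeContinuous (fieldResolvent lam hlam h * fieldResolvent lam hlam (Complex.I • h)) :=
    continuous_gaugeAd_resolvents hlam hlam hh hh
  rw [resolventApprox, smul_mul_smul_comm]
  exact (isTensor_one.gaugeContinuous.sub (hcts.smul _)).smul _

theorem gaugeAd_resolventApprox_mem {D : Set H} (hD : ∀ h ∈ D, ∀ c : ℂ, c • h ∈ D) {h : H}
    (hh : h ∈ D) (lam : ℝ) (hlam : lam ≠ 0) (u : ℝ) :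
    gaugeAd u (resolventApprox lam hlam h) ∈ resolventAlgebra D := by
  have h1 := gaugeAd_mem_resolventAlgebra hD hh lam hlam u
  have h2 := gaugeAd_mem_resolventAlgebra hD (hD h hh Complex.I) lam hlam u
  have h3 : gaugeAd u (1 : Operators H) = 1 := by
    rw [isTensor_iff.1 isTensor_one]
    simp
  rw [resolventApprox, map_smul, map_sub, gaugeAd_mul, map_smul, map_smul, h3]
  exact SMulMemClass.smul_mem _ (sub_mem (one_mem _)
    (mul_mem (SMulMemClass.smul_mem _ h1) (SMulMemClass.smul_mem _ h2)))

theorem norm_three_products_le {A : Type*} [NormedRing A] [NormedAlgebra ℂ A] {R S F F' G G' : A}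
    {z : ℂ} {r : ℝ} (hR : ‖R‖ ≤ r) (hS : ‖S‖ ≤ r) (hzR : ‖z • R‖ ≤ 1) :
    ‖-(R * (F' * F)) - R * (F' * G) - (z • R) * (S * (G' * G))‖ ≤
      r * (‖F'‖ * ‖F‖ + ‖F'‖ * ‖G‖ + ‖G'‖ * ‖G‖) := by
  have hr : 0 ≤ r := (norm_nonneg _).trans hR
  have b : ∀ {X Y Z : A}, ‖X‖ ≤ r → ‖X * (Y * Z)‖ ≤ r * (‖Y‖ * ‖Z‖) := fun {X Y Z} hX =>
    (norm_mul_le _ _).trans (mul_le_mul hX (norm_mul_le _ _) (norm_nonneg _) hr)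
  have b3 : ‖(z • R) * (S * (G' * G))‖ ≤ r * (‖G'‖ * ‖G‖) := by
    refine (norm_mul_le _ _).trans ((mul_le_mul hzR (b hS) (norm_nonneg _) zero_le_one).trans ?_)
    rw [one_mul]
  refine (norm_sub_le _ _).trans ((add_le_add ((norm_sub_le _ _).trans
    (add_le_add ((norm_neg _).trans_le (b hR)) (b hR))) b3).trans_eq ?_)
  ring

theorem exists_norm_resolventApprox_sub_le (h : H) (n : ℕ) : ∃ C : ℝ, 0 ≤ C ∧
    ∀ (lam : ℝ) (hlam : lam ≠ 0), ‖resolventApprox lam hlam h * lowProj n H -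
      (cutField h * cutNumber n H + cutField (Complex.I • h) * cutNumber n H)‖ ≤ |lam|⁻¹ * C := by
  refine ⟨‖cutField h * cutNumber (n + 1) H‖ * ‖cutField h * cutNumber n H‖ +
    ‖cutField h * cutNumber (n + 1) H‖ * ‖cutField (Complex.I • h) * cutNumber n H‖ +
    ‖cutField (Complex.I • h) * cutNumber (n + 1) H‖ * ‖cutField (Complex.I • h) * cutNumber n H‖,
    by positivity, fun lam hlam => ?_⟩
  rw [resolventApprox, one_sub_mul_eq (smul_fieldResolvent_mul_lowProj lam hlam h n)
    (smul_fieldResolvent_mul_lowProj lam hlam h (n + 1)) (lowProj_mul_cutField n h)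
    (smul_fieldResolvent_mul_lowProj lam hlam (Complex.I • h) n)
    (smul_fieldResolvent_mul_lowProj lam hlam (Complex.I • h) (n + 1))
    (lowProj_mul_cutField n (Complex.I • h))]
  refine norm_three_products_le (norm_fieldResolvent_le _ _ _) (norm_fieldResolvent_le _ _ _) ?_
  rw [norm_smul, norm_mul, Complex.norm_I, one_mul, Complex.norm_real, Real.norm_eq_abs]
  exact (mul_le_mul_of_nonneg_left (norm_fieldResolvent_le _ _ _) (abs_nonneg _)).trans_eq
    (mul_inv_cancel₀ (abs_ne_zero.2 hlam))

theorem fourierComp_mul_sub_tensors {T P X Y : Operators H} (hT : GaugeContinuous T)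
    (hP : IsTensor 0 P) (hX : IsTensor 1 X) (hY : IsTensor (-1) Y) :
    fourierComp 1 (T * P - (X + Y)) = fourierComp 1 T * P - X := by
  rw [fourierComp_sub 1 (hT.mul hP.gaugeContinuous) (hX.gaugeContinuous.add hY.gaugeContinuous),
    fourierComp_mul 1 hT hP, fourierComp_add 1 hX.gaugeContinuous hY.gaugeContinuous,
    fourierComp_self hX, fourierComp_of_ne (by decide) hY, add_zero]

/-- Multiplication of h by i has opposite effects on the linear a* and the antilinear a. The
coefficient 1 + i of the creation part does not vanish, so the component of degree 1 recovers a*(h).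
-/
theorem cutField_add_cutField_I (h : H) (n : ℕ) :
    cutField h * cutNumber n H + cutField (Complex.I • h) * cutNumber n H =
      (1 + Complex.I) • (cutCreation h * cutNumber n H) +
        (1 - Complex.I) • (cutAnnihilation h * cutNumber n H) := by
  rw [cutField, cutField, cutCreation_I, cutAnnihilation_I, add_mul, add_mul,
    smul_mul_assoc, smul_mul_assoc]
  module

theorem fourierComp_resolventApprox_sub {lam : ℝ} (hlam : lam ≠ 0) {h : H} (hh : 2 * ‖h‖ < |lam|)
    (n : ℕ) : fourierComp 1 (resolventApprox lam hlam h * lowProj n H -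
      (cutField h * cutNumber n H + cutField (Complex.I • h) * cutNumber n H)) =
    fourierComp 1 (resolventApprox lam hlam h) * lowProj n H -
      (1 + Complex.I) • (cutCreation h * cutNumber n H) := by
  have hA : IsTensor 1 (cutCreation h * cutNumber n H) :=
    (isTensor_cutCreation h).mul_degree_zero (isTensor_cutNumber n)
  have hA' : IsTensor (-1) (cutAnnihilation h * cutNumber n H) :=
    (isTensor_cutAnnihilation h).mul_degree_zero (isTensor_cutNumber n)
  have h1 : IsTensor 1 ((1 + Complex.I) • (cutCreation h * cutNumber n H)) := hA.smul _
  have h2 : IsTensor (-1) ((1 - Complex.I) • (cutAnnihilation h * cutNumber n H)) := hA'.smul _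
  have h3 := fourierComp_mul_sub_tensors (gaugeContinuous_resolventApprox hlam hh)
    (isTensor_lowProj n) h1 h2
  rwa [← cutField_add_cutField_I] at h3

/-- On the vectors with limited particle number, creation operators are norm limits of tensors in
the resolvent algebra. -/
theorem exists_tensor_near_creation {D : Set H} (hD : ∀ h ∈ D, ∀ c : ℂ, c • h ∈ D) {h : H}
    (hh : h ∈ D) (n : ℕ) {ε : ℝ} (hε : 0 < ε) :
    ∃ R ∈ tensors D 1, ‖R * lowProj n H - cutCreation h * cutNumber n H‖ < ε := by
  obtain ⟨C, hC0, hC⟩ := exists_norm_resolventApprox_sub_le h n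
  -- Large enough both for gauge continuity, which needs 2‖h‖ < λ, and for the error bound C/λ < ε.
  obtain ⟨lam, hlamdef⟩ : ∃ lam : ℝ, lam = 2 * ‖h‖ + (C + 1) / ε + 1 := ⟨_, rfl⟩
  have hdiv : 0 < (C + 1) / ε := by positivity
  have hlam0 : 0 < lam := by rw [hlamdef]; positivity
  have hlam : lam ≠ 0 := hlam0.ne'
  have habs : |lam| = lam := abs_of_pos hlam0
  have hlh : 2 * ‖h‖ < |lam| := by
    rw [habs, hlamdef]
    linarith
  have hT := gaugeContinuous_resolventApprox hlam hlh
  have hmem : fourierComp 1 (resolventApprox lam hlam h) ∈ tensors D 1 :=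
    ⟨fourierComp_mem 1 hT (K := (resolventAlgebra D).toSubalgebra.toSubmodule)
      (isClosed_resolventAlgebra D) (gaugeAd_resolventApprox_mem hD hh lam hlam),
      isTensor_fourierComp 1 hT⟩
  have hne : (1 + Complex.I) ≠ 0 := fun h => by simpa using congrArg Complex.re h
  have hone : 1 ≤ ‖1 + Complex.I‖ := by
    have := Complex.abs_re_le_norm (1 + Complex.I)
    simpa using this
  refine ⟨(1 + Complex.I)⁻¹ • fourierComp 1 (resolventApprox lam hlam h),
    Submodule.smul_mem _ _ hmem, ?_⟩
  have e : ((1 + Complex.I)⁻¹ • fourierComp 1 (resolventApprox lam hlam h)) * lowProj n H -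
      cutCreation h * cutNumber n H = (1 + Complex.I)⁻¹ • fourierComp 1
        (resolventApprox lam hlam h * lowProj n H -
          (cutField h * cutNumber n H + cutField (Complex.I • h) * cutNumber n H)) := by
    rw [fourierComp_resolventApprox_sub hlam hlh, smul_sub, smul_smul, inv_mul_cancel₀ hne, one_smul,
      smul_mul_assoc]
  rw [e, norm_smul, norm_inv]
  refine (mul_le_mul (inv_le_one_of_one_le₀ hone) ((norm_fourierComp_le _ _).trans (hC lam hlam))
    (norm_nonneg _) zero_le_one).trans_lt ?_
  rw [one_mul, habs, inv_mul_lt_iff₀ hlam0, hlamdef]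
  have : (C + 1) / ε * ε = C + 1 := div_mul_cancel₀ _ hε.ne'
  nlinarith [norm_nonneg h]

/-! ### Functional calculus and intertwining operators -/

section intertwining

variable {E F : Type*} [NormedAddCommGroup E] [InnerProductSpace ℂ E] [CompleteSpace E]
  [NormedAddCommGroup F] [InnerProductSpace ℂ F] [CompleteSpace F]

theorem intertwine_aeval {A : E →L[ℂ] E} {B : F →L[ℂ] F} {T : E →L[ℂ] F}
    (hT : T ∘L A = B ∘L T) (p : Polynomial ℝ) :
    T ∘L Polynomial.aeval A p = Polynomial.aeval B p ∘L T := by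
  have hpow : ∀ n : ℕ, T ∘L (A ^ n) = (B ^ n) ∘L T := by
    intro n
    induction n with
    | zero => rfl
    | succ n ih =>
      rw [pow_succ, pow_succ]
      change (T ∘L (A ^ n)) ∘L A = (B ^ n) ∘L (B ∘L T)
      rw [ih, ← hT]
      rfl
  induction p using Polynomial.induction_on' with
  | add p q hp hq => rw [map_add, map_add, ContinuousLinearMap.comp_add, hp, hq,
      ContinuousLinearMap.add_comp]
  | monomial n a =>
    rw [Polynomial.aeval_monomial, Polynomial.aeval_monomial, ← Algebra.smul_def,
      ← Algebra.smul_def]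
    ext x
    have := DFunLike.congr_fun (hpow n) x
    simp only [ContinuousLinearMap.comp_apply, smul_apply] at this ⊢
    rw [← this, ← Complex.coe_smul, map_smul, Complex.coe_smul]

theorem norm_cfc_sub_aeval_le {C : E →L[ℂ] E} (hC : IsSelfAdjoint C) {φ : ℝ → ℝ}
    (hφ : Continuous φ) {p : Polynomial ℝ} {r δ : ℝ} (hδ : 0 ≤ δ)
    (hr : ‖C‖ * ‖(1 : E →L[ℂ] E)‖ ≤ r) (hp : ∀ x ∈ Set.Icc (-r) r, |p.eval x - φ x| < δ) :
    ‖cfc φ C - Polynomial.aeval C p‖ ≤ δ := by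
  rw [← cfc_polynomial p C, ← cfc_sub φ _ C hφ.continuousOn (by fun_prop)]
  refine norm_cfc_le hδ fun x hx => ?_
  rw [norm_sub_rev]
  exact (hp x (abs_le.1 ((spectrum.norm_le_norm_mul_of_mem hx).trans hr))).le

/-- An operator intertwining two self-adjoint operators intertwines continuous functions of them. -/
theorem intertwine_cfc {A : E →L[ℂ] E} {B : F →L[ℂ] F} {T : E →L[ℂ] F} (hA : IsSelfAdjoint A)
    (hB : IsSelfAdjoint B) (hT : T ∘L A = B ∘L T) (φ : ℝ → ℝ) (hφ : Continuous φ) :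
    T ∘L cfc φ A = cfc φ B ∘L T := by
  -- The interval [−r, r] contains both spectra, so a single Weierstrass polynomial approximates φ
  -- on both. The factors ‖1‖ allow for trivial spaces.
  obtain ⟨r, hrA, hrB⟩ : ∃ r : ℝ, ‖A‖ * ‖(1 : E →L[ℂ] E)‖ ≤ r ∧ ‖B‖ * ‖(1 : F →L[ℂ] F)‖ ≤ r :=
    ⟨_, le_max_left _ _, le_max_right _ _⟩
  rw [← sub_eq_zero, ← norm_le_zero_iff]
  refine le_of_forall_pos_le_add fun ε hε => ?_
  have hδ : 0 < ε / (2 * (‖T‖ + 1)) := by positivity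
  obtain ⟨p, hp⟩ := exists_polynomial_near_of_continuousOn (-r) r φ hφ.continuousOn _ hδ
  have e : T ∘L cfc φ A - cfc φ B ∘L T =
      T ∘L (cfc φ A - Polynomial.aeval A p) - (cfc φ B - Polynomial.aeval B p) ∘L T := by
    rw [ContinuousLinearMap.comp_sub, ContinuousLinearMap.sub_comp, intertwine_aeval hT]
    abel
  have h0 := norm_sub_le (T ∘L (cfc φ A - Polynomial.aeval A p))
    ((cfc φ B - Polynomial.aeval B p) ∘L T)
  rw [e, zero_add]
  refine h0.trans ?_
  have h1 := (ContinuousLinearMap.opNorm_comp_le T (cfc φ A - Polynomial.aeval A p)).trans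
    (mul_le_mul_of_nonneg_left (norm_cfc_sub_aeval_le hA hφ hδ.le hrA hp) (norm_nonneg _))
  have h2 := (ContinuousLinearMap.opNorm_comp_le (cfc φ B - Polynomial.aeval B p) T).trans
    (mul_le_mul_of_nonneg_right (norm_cfc_sub_aeval_le hB hφ hδ.le hrB hp) (norm_nonneg _))
  refine (add_le_add h1 h2).trans ?_
  have h3 : ‖T‖ * (ε / (2 * (‖T‖ + 1))) + ε / (2 * (‖T‖ + 1)) * ‖T‖ = ε * (‖T‖ / (‖T‖ + 1)) := by
    field_simp
    ring
  rw [h3]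
  have h4 : ‖T‖ / (‖T‖ + 1) ≤ 1 := by
    rw [div_le_one (by positivity)]
    linarith
  nlinarith

end intertwining

/-! ### Restrictions of tensors to the vectors with limited particle number -/

/-- The gauge invariant elements of the resolvent algebra form a C*-algebra. -/
def invariantAlgebra (D : Set H) : StarSubalgebra ℂ (Operators H) where
  carrier := tensors D 0
  mul_mem' {S T} hS hT := by
    have h := tensors_mul hS hT
    rwa [add_zero] at h
  add_mem' hS hT := add_mem hS hT
  algebraMap_mem' c := by
    rw [Algebra.algebraMap_eq_smul_one]
    exact Submodule.smul_mem _ _ ⟨one_mem _, isTensor_one⟩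
  star_mem' {T} hT := by
    have h := tensors_star hT
    rwa [neg_zero] at h

theorem cfc_mem_tensors {D : Set H} {T : Operators H} (hT : T ∈ tensors D 0)
    (φ : ℝ → ℝ) : cfc φ T ∈ tensors D 0 := by
  have : IsClosed (invariantAlgebra D : Set (Operators H)) := isClosed_tensors D 0
  exact cfc_mem (𝕜' := ℂ) (s := invariantAlgebra D) φ hT

theorem tensors_mul_degree_zero {D : Set H} {m : ℤ} {S T : Operators H} (hS : S ∈ tensors D m)
    (hT : T ∈ tensors D 0) : S * T ∈ tensors D m := by
  have h := tensors_mul hS hT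
  rwa [add_zero] at h

theorem star_mul_self_mem_tensors {D : Set H} {m : ℤ} {S : Operators H} (hS : S ∈ tensors D m) :
    star S * S ∈ tensors D 0 := by
  have h := tensors_mul (tensors_star hS) hS
  rwa [neg_add_cancel] at h

/-! ### Tensors and particle number -/

theorem IsTensor.sector_inSector_eq_zero {m : ℤ} {T : Operators H} (hT : IsTensor m T) {n k : ℕ}
    (hk : (k : ℤ) ≠ n + m) (x : NParticle n H) : (T (inSector n x)).sector k = 0 := by
  have hne : ((k : ℂ) - n - m) ≠ 0 := by
    intro h
    refine hk ?_
    have : ((k : ℤ) : ℂ) = ((n + m : ℤ) : ℂ) := by push_cast; linear_combination h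
    exact_mod_cast this
  -- At this angle the transformation law equates the component in sector k with its negative.
  obtain ⟨u, hu⟩ : ∃ u : ℝ, (u : ℂ) * ((k : ℂ) - n - m) = Real.pi := by
    refine ⟨Real.pi / (k - n - m), ?_⟩
    push_cast
    exact div_mul_cancel₀ _ hne
  have h1 : gaugeUnitary (-u) (inSector n x) = Complex.exp (-(Complex.I * u * n)) • inSector n x := by
    refine Fock.ext fun j => ?_
    rw [sector_gaugeUnitary, Fock.sector_smul]
    by_cases hj : j = n
    · subst hj
      congr 2
      push_cast
      ring
    · rw [inSector_ne _ hj, smul_zero, smul_zero]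
  have h2 := congrArg (fun S : Operators H => (S (inSector n x)).sector k) (isTensor_iff.1 hT u)
  simp only [gaugeAd_sector, h1, map_smul, smul_apply, Fock.sector_smul, smul_smul,
    ← Complex.exp_add] at h2
  have h3 := congrArg (Complex.exp (-(Complex.I * u * m)) • ·) h2
  simp only [smul_smul, ← Complex.exp_add, neg_add_cancel, Complex.exp_zero, one_smul] at h3
  have h4 : -(Complex.I * u * m) + (Complex.I * u * k + -(Complex.I * u * n)) =
      Real.pi * Complex.I := by
    rw [← hu]
    ring
  rw [h4, Complex.exp_pi_mul_I, neg_one_smul] at h3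
  have h5 : (2 : ℂ) • (T (inSector n x)).sector k = 0 := by
    rw [two_smul]
    nth_rewrite 1 [← h3]
    exact neg_add_cancel _
  exact (smul_eq_zero.1 h5).resolve_left two_ne_zero

theorem clm_eq_of_inSector {E : Type*} [NormedAddCommGroup E] [NormedSpace ℂ E]
    {A B : Fock H →L[ℂ] E} (h : ∀ n (x : NParticle n H), A (inSector n x) = B (inSector n x)) :
    A = B := clm_eq_of_finite fun ⟨ψ, n, hn⟩ => by
  have hsum : ψ = ∑ k ∈ Finset.range (n + 1), inSectorCLM k (sectorCLM k ψ) := by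
    refine Fock.ext fun j => ?_
    rw [← sectorCLM_apply j, ← sectorCLM_apply j, map_sum]
    simp only [sectorCLM_apply, inSectorCLM_apply]
    by_cases hj : j ≤ n
    · rw [Finset.sum_eq_single_of_mem j (Finset.mem_range.2 (by omega)), inSector_self]
      exact fun k _ hk => inSector_ne _ hk.symm
    · rw [hn j (by omega), Finset.sum_eq_zero]
      intro k hk
      rw [Finset.mem_range] at hk
      exact inSector_ne _ (by omega)
  change A ψ = B ψ
  rw [hsum, map_sum, map_sum]
  exact Finset.sum_congr rfl fun k _ => h k _

theorem diagonal_inSector (w : ℕ → ℂ) {C : ℝ} (hw : ∀ n, ‖w n‖ ≤ C) (n : ℕ) (x : NParticle n H) :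
    diagonal w hw (inSector n x) = w n • inSector n x := Fock.ext fun k => by
  rw [sector_diagonal, Fock.sector_smul]
  by_cases hk : k = n
  · rw [hk]
  · rw [inSector_ne _ hk, smul_zero, smul_zero]

theorem lowProj_inSector (l n : ℕ) (x : NParticle n H) :
    lowProj l H (inSector n x) = if n ≤ l then inSector n x else 0 := by
  rw [lowProj, diagonal_inSector]
  split_ifs <;> simp

/-- A tensor of degree `m` changes the particle number by `m`. -/
theorem IsTensor.lowProj_mul {m : ℤ} {T : Operators H} (hT : IsTensor m T) {l n : ℕ}
    (hl : (n : ℤ) + m ≤ l) : lowProj l H * (T * lowProj n H) = T * lowProj n H :=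
  clm_eq_of_inSector fun k x => by
    change lowProj l H (T (lowProj n H (inSector k x))) = T (lowProj n H (inSector k x))
    rw [lowProj_inSector]
    split_ifs with hk
    · refine lowProj_apply fun j hj => hT.sector_inSector_eq_zero (by omega) x
    · rw [map_zero, map_zero]

/-- Both T and T* leave the subspace of at most n particles invariant. -/
theorem IsTensor.commute_lowProj {T : Operators H} (hT : IsTensor 0 T) (n : ℕ) :
    lowProj n H * T = T * lowProj n H := by
  have h1 := hT.lowProj_mul (l := n) (n := n) (by omega)
  have hT' : IsTensor 0 (Star.star T) := by
    have := hT.star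
    rwa [neg_zero] at this
  have h2 := congrArg Star.star (hT'.lowProj_mul (l := n) (n := n) (by omega))
  rw [star_mul, star_mul, star_star, star_lowProj, mul_assoc, h1] at h2
  exact h2.symm

/-- Tensors in the resolvent algebra can be modified on the vectors with large particle number such
that their norm is attained on the vectors with limited particle number. -/
theorem exists_tensor_norm_le {D : Set H} {m : ℤ} {S : Operators H} (hS : S ∈ tensors D m) (n : ℕ) :
    ∃ S' ∈ tensors D m, S' * lowProj n H = S * lowProj n H ∧ ‖S'‖ ≤ ‖S * lowProj n H‖ := by
  obtain ⟨ε, hεdef⟩ : ∃ ε, ε = ‖S * lowProj n H‖ := ⟨_, rfl⟩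
  rw [← hεdef]
  rcases (norm_nonneg (S * lowProj n H)).eq_or_lt with h0 | hpos
  · refine ⟨0, zero_mem _, ?_, ?_⟩
    · rw [zero_mul, eq_comm, ← norm_eq_zero, h0]
    · rw [norm_zero, hεdef]
      exact norm_nonneg _
  rw [← hεdef] at hpos
  have hxmem := star_mul_self_mem_tensors hS
  have hxsa : IsSelfAdjoint (star S * S) := IsSelfAdjoint.star_mul_self S
  -- Multiplying S by φ(S*S) cuts |S| off at height ε: one has x φ(x)² ≤ ε² for all x ≥ 0, while φ =
  -- 1 up to ε².
  obtain ⟨φ, hφdef⟩ : ∃ φ : ℝ → ℝ, φ = fun x => ε / max ε √x := ⟨_, rfl⟩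
  have hφ : Continuous φ := by
    rw [hφdef]
    exact continuous_const.div (continuous_const.max Real.continuous_sqrt) fun x =>
      (lt_max_of_lt_left hpos).ne'
  have hnn : (0 : Operators H) ≤ star S * S := star_mul_self_nonneg S
  refine ⟨S * cfc φ (star S * S), tensors_mul_degree_zero hS (cfc_mem_tensors hxmem φ), ?_, ?_⟩
  · have hcomm := hxmem.2.commute_lowProj n
    have hPP : lowProj n H * lowProj n H = lowProj n H := lowProj_mul_lowProj le_rfl
    obtain ⟨y, hy⟩ : ∃ y, y = star (S * lowProj n H) * (S * lowProj n H) := ⟨_, rfl⟩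
    have hysa : IsSelfAdjoint y := by rw [hy]; exact IsSelfAdjoint.star_mul_self _
    have hyeq : y = star S * S * lowProj n H := by
      rw [hy, star_mul, star_lowProj, mul_assoc, ← mul_assoc (star S), ← mul_assoc, hcomm, mul_assoc,
        hPP]
    have hint : lowProj n H ∘L y = (star S * S) ∘L lowProj n H := by
      change lowProj n H * y = star S * S * lowProj n H
      rw [hyeq, ← mul_assoc, hcomm, mul_assoc, hPP]
    -- `y` is S*S on at most n particles and zero elsewhere, of norm ε². Hence its spectrum lies
    -- where φ = 1, and the cutoff leaves S unchanged on this subspace.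
    have hone : cfc φ y = 1 := by
      rw [← cfc_one ℝ y hysa]
      refine cfc_congr fun x hx => ?_
      have h1 : ‖x‖ ≤ ‖y‖ * ‖(1 : Operators H)‖ := spectrum.norm_le_norm_mul_of_mem hx
      have h2 : ‖y‖ = ε * ε := by rw [hy, CStarRing.norm_star_mul_self, hεdef]
      have h3 : ‖(1 : Operators H)‖ ≤ 1 := ContinuousLinearMap.norm_id_le
      have h4 : x ≤ ε ^ 2 := by
        have : ‖y‖ * ‖(1 : Operators H)‖ ≤ ‖y‖ * 1 := mul_le_mul_of_nonneg_left h3 (norm_nonneg _)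
        have := Real.le_norm_self x
        nlinarith
      have h5 : √x ≤ ε := Real.sqrt_le_iff.2 ⟨hpos.le, h4⟩
      simp only [hφdef, max_eq_left h5, div_self hpos.ne', Pi.one_apply]
    have hcfc := intertwine_cfc hysa hxsa hint φ hφ
    rw [hone] at hcfc
    have hcfc' : cfc φ (star S * S) * lowProj n H = lowProj n H := hcfc.symm
    rw [mul_assoc, hcfc']
  · have hgsa : IsSelfAdjoint (cfc φ (star S * S)) := cfc_predicate _ _
    rw [← sq_le_sq₀ (norm_nonneg _) hpos.le, sq, ← CStarRing.norm_star_mul_self, star_mul,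
      hgsa.star_eq]
    have e : cfc φ (star S * S) * star S * (S * cfc φ (star S * S)) =
        cfc (fun x => φ x * (x * φ x)) (star S * S) := by
      rw [cfc_mul φ (fun x => x * φ x) _ hφ.continuousOn (by fun_prop),
        cfc_mul (fun x => x) φ _ (by fun_prop) hφ.continuousOn, cfc_id' ℝ (star S * S)]
      noncomm_ring
    rw [e]
    refine norm_cfc_le (by positivity) fun x hx => ?_
    have hx0 : 0 ≤ x := spectrum_nonneg_of_nonneg hnn hx
    have hm : 0 < max ε √x := lt_max_of_lt_left hpos
    have hxm : x ≤ max ε √x ^ 2 := by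
      calc x = √x ^ 2 := (Real.sq_sqrt hx0).symm
        _ ≤ _ := pow_le_pow_left₀ (Real.sqrt_nonneg _) (le_max_right _ _) 2
    have hval : φ x * (x * φ x) = ε ^ 2 * (x / max ε √x ^ 2) := by
      rw [hφdef]
      field_simp
    rw [hval, Real.norm_of_nonneg (by positivity)]
    have : x / max ε √x ^ 2 ≤ 1 := (div_le_one (by positivity)).2 hxm
    nlinarith [sq_nonneg ε]

/-- The restrictions of the tensors in the resolvent algebra to the vectors with limited particle
number form a norm closed space. -/
theorem exists_tensor_eq_of_near {D : Set H} {m : ℤ} {T : Operators H} {n : ℕ}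
    (hT : ∀ ε > 0, ∃ R ∈ tensors D m, ‖R * lowProj n H - T * lowProj n H‖ < ε) :
    ∃ R ∈ tensors D m, R * lowProj n H = T * lowProj n H := by
  have : CompleteSpace (tensors D m) := (isClosed_tensors D m).completeSpace_coe
  let f : NormedAddGroupHom (tensors D m) (Operators H) :=
    AddMonoidHom.mkNormedAddGroupHom
      ((AddMonoidHom.mulRight (lowProj n H)).comp (tensors D m).toAddSubgroup.subtype) 1 fun R => by
        rw [one_mul]
        exact (norm_mul_le _ _).trans (mul_le_of_le_one_right (norm_nonneg _) (norm_lowProj_le n))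
  -- Every restriction lifts to a tensor of no larger norm. As the space of tensors is complete,
  -- such controlled lifts can be summed along a series, and the range of the restriction map is
  -- closed.
  have hf : f.SurjectiveOnWith f.range 1 := by
    rintro _ ⟨S, rfl⟩
    obtain ⟨S', hS', h1, h2⟩ := exists_tensor_norm_le S.2 n
    exact ⟨⟨S', hS'⟩, h1, by rw [one_mul]; exact h2⟩
  have hmem : T * lowProj n H ∈ f.range.topologicalClosure := by
    change _ ∈ closure (f.range : Set (Operators H))
    refine Metric.mem_closure_iff.2 fun ε hε => ?_
    obtain ⟨R, hR, h⟩ := hT ε hε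
    refine ⟨R * lowProj n H, ⟨⟨R, hR⟩, rfl⟩, ?_⟩
    rwa [dist_comm, dist_eq_norm]
  obtain ⟨R, h, -⟩ := controlled_closure_of_complete one_pos one_pos hf _ hmem
  exact ⟨R, R.2, h⟩

/-! ### Extended tensors -/

/-- The operator `T` coincides on each subspace of limited particle number with a tensor of degree
`m` in the resolvent algebra. -/
def IsExtendedTensor (D : Set H) (m : ℤ) (T : Operators H) : Prop :=
  ∀ n, ∃ R ∈ tensors D m, R * lowProj n H = T * lowProj n H

theorem mem_observables_iff {D : Set H} {A : Operators H} :
    A ∈ observables D ↔ IsExtendedTensor D 0 A := by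
  refine forall_congr' fun n => ⟨?_, ?_⟩
  · rintro ⟨B, hB, hB', h⟩
    exact ⟨B, ⟨hB, hB'⟩, (mul_lowProj_eq_iff.2 h).symm⟩
  · rintro ⟨B, ⟨hB, hB'⟩, h⟩
    exact ⟨B, hB, hB', mul_lowProj_eq_iff.1 h.symm⟩

theorem eq_of_mul_lowProj {A B : Operators H} (h : ∀ n, A * lowProj n H = B * lowProj n H) :
    A = B := clm_eq_of_inSector fun n _ =>
  mul_lowProj_eq_iff.1 (h n) _ fun _ hk => inSector_ne _ hk.ne'

theorem gaugeAd_mul_lowProj (u : ℝ) (T : Operators H) (n : ℕ) :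
    gaugeAd u (T * lowProj n H) = gaugeAd u T * lowProj n H := by
  rw [gaugeAd_mul, isTensor_iff.1 (isTensor_lowProj n)]
  simp

theorem isExtendedTensor_of_mem {D : Set H} {m : ℤ} {T : Operators H} (hT : T ∈ tensors D m) :
    IsExtendedTensor D m T := fun _ => ⟨T, hT, rfl⟩

namespace IsExtendedTensor

variable {D : Set H} {m k : ℤ} {S T : Operators H}

theorem isTensor (hT : IsExtendedTensor D m T) : IsTensor m T :=
  isTensor_iff.2 fun u => eq_of_mul_lowProj fun n => by
    obtain ⟨R, hR, h⟩ := hT n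
    rw [← gaugeAd_mul_lowProj, ← h, gaugeAd_mul_lowProj, isTensor_iff.1 hR.2, smul_mul_assoc,
      smul_mul_assoc, h]

theorem mul (hS : IsExtendedTensor D m S) (hT : IsExtendedTensor D k T) :
    IsExtendedTensor D (m + k) (S * T) := fun n => by
  obtain ⟨R', hR', h'⟩ := hT n
  -- T takes at most n particles to at most n + |k|, so S has to be matched on the larger subspace.
  obtain ⟨R, hR, h⟩ := hS (n + k.natAbs)
  have hl : (n : ℤ) + k ≤ (n + k.natAbs : ℕ) := by omega
  refine ⟨R * R', tensors_mul hR hR', ?_⟩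
  rw [mul_assoc, mul_assoc, ← h', ← hR'.2.lowProj_mul hl, ← mul_assoc, h, mul_assoc]

theorem star (hT : IsExtendedTensor D m T) : IsExtendedTensor D (-m) (star T) := fun n => by
  -- T* on at most n particles is determined by T on at most n + |m|: with P the projections, T* Pₙ
  -- = (T P_{n+|m|})* Pₙ.
  obtain ⟨R, hR, h⟩ := hT (n + m.natAbs)
  have hl : (n : ℤ) + -m ≤ (n + m.natAbs : ℕ) := by omega
  refine ⟨_, tensors_star hR, ?_⟩
  rw [← hR.2.star.lowProj_mul hl, ← hT.isTensor.star.lowProj_mul hl, ← mul_assoc, ← mul_assoc,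
    ← star_lowProj (n + m.natAbs), ← star_mul, ← star_mul, h]

theorem of_near (hT : ∀ ε > 0, ∃ S, IsExtendedTensor D m S ∧ ‖S - T‖ < ε) :
    IsExtendedTensor D m T := fun n => exists_tensor_eq_of_near fun ε hε => by
  obtain ⟨S, hS, h⟩ := hT ε hε
  obtain ⟨R, hR, h'⟩ := hS n
  refine ⟨R, hR, ?_⟩
  rw [h', ← sub_mul]
  exact ((norm_mul_le _ _).trans
    (mul_le_of_le_one_right (norm_nonneg _) (norm_lowProj_le n))).trans_lt h

theorem smul (c : ℂ) (hT : IsExtendedTensor D m T) : IsExtendedTensor D m (c • T) := fun n => by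
  obtain ⟨R, hR, h⟩ := hT n
  exact ⟨c • R, Submodule.smul_mem _ _ hR, by rw [smul_mul_assoc, smul_mul_assoc, h]⟩

theorem pow (hT : IsExtendedTensor D m T) (j : ℕ) : IsExtendedTensor D (j * m) (T ^ j) := by
  induction j with
  | zero =>
    rw [Nat.cast_zero, zero_mul, pow_zero]
    exact isExtendedTensor_of_mem ⟨one_mem _, isTensor_one⟩
  | succ j ih =>
    have h := ih.mul hT
    rw [pow_succ]
    rwa [Nat.cast_succ, add_mul, one_mul]

end IsExtendedTensor

/-! ### Elementary extended tensors -/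

/-- Approximation in norm becomes equality because restrictions of tensors form a closed space. The
factor `cutNumber` undoes the (1 + N)⁻¹ in `cutCreation`. -/
theorem exists_tensor_creation {D : Set H} (hD : ∀ h ∈ D, ∀ c : ℂ, c • h ∈ D) {h : H}
    (hh : h ∈ D) (n : ℕ) : ∃ R ∈ tensors D 1, ∀ k ≤ n, ∀ x : NParticle k H,
      R (inSector k x) = inSector (k + 1) (creation k h x) := by
  have hKP : cutNumber n H * lowProj n H = cutNumber n H := operator_ext fun ψ k => by
    rw [mul_apply_eq_comp, sector_cutNumber, sector_lowProj, sector_cutNumber]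
    split_ifs <;> simp
  obtain ⟨R, hR, hRP⟩ := exists_tensor_eq_of_near (D := D) (m := 1) (n := n)
    (T := cutCreation h * cutNumber n H) fun ε hε => by
      rw [mul_assoc, hKP]
      exact exists_tensor_near_creation hD hh n hε
  refine ⟨R, hR, fun k hk x => ?_⟩
  have h1 := DFunLike.congr_fun hRP (inSector k x)
  rw [mul_assoc, hKP] at h1
  have h2 : (R * lowProj n H) (inSector k x) = R (inSector k x) := by
    rw [mul_apply_eq_comp, lowProj_inSector, if_pos hk]
  have h3 : cutNumber n H (inSector k x) = (k + 1 : ℂ) • inSector k x := by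
    rw [cutNumber, diagonal_inSector, if_pos hk]
  rw [← h2, h1, mul_apply_eq_comp, h3, map_smul, cutCreation, shiftUp_inSector, ← inSector_smul,
    smul_apply, smul_smul, mul_inv_cancel₀ (by exact_mod_cast k.succ_ne_zero), one_smul]

theorem star_tensor_inSector {R : Operators H} (hR : IsTensor 1 R) {h : H} {k : ℕ}
    (hRk : ∀ x : NParticle k H, R (inSector k x) = inSector (k + 1) (creation k h x))
    (x : NParticle (k + 1) H) : star R (inSector (k + 1) x) = inSector k (annihilation k h x) :=
  Fock.ext fun j => by
    by_cases hj : j = k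
    · subst hj
      refine ext_inner_left ℂ fun y => ?_
      rw [← inner_inSector, inner_star_right, hRk, inner_inSector, inSector_self, inSector_self,
        annihilation, ContinuousLinearMap.adjoint_inner_right]
    · rw [hR.star.sector_inSector_eq_zero (by omega), inSector_ne _ hj]

theorem star_tensor_inSector_zero {R : Operators H} (hR : IsTensor 1 R) (x : NParticle 0 H) :
    star R (inSector 0 x) = 0 :=
  Fock.ext fun _ => hR.star.sector_inSector_eq_zero (by omega) x

/-- If R represents a*(h) on at most n particles, then R* represents a(h) there, and R R* represents
a*(h) a(h). On the vacuum, R* vanishes since it has degree −1. -/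
theorem exists_tensor_modeNumber {D : Set H} (hD : ∀ h ∈ D, ∀ c : ℂ, c • h ∈ D) {h : H}
    (hh : h ∈ D) (n : ℕ) : ∃ A ∈ tensors D 0, IsSelfAdjoint A ∧ ∀ k ≤ n, ∀ x : NParticle k H,
      A (inSector k x) = inSector k (modeNumber h k x) := by
  obtain ⟨R, hR, hRk⟩ := exists_tensor_creation hD hh n
  have hmem := tensors_mul hR (tensors_star hR)
  rw [add_neg_cancel] at hmem
  refine ⟨R * star R, hmem, IsSelfAdjoint.mul_star_self R, fun k hk x => ?_⟩
  rw [mul_apply_eq_comp]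
  rcases k with _ | k
  · rw [star_tensor_inSector_zero hR.2, map_zero, modeNumber, zero_apply]
    exact (map_zero (inSectorCLM 0)).symm
  · rw [star_tensor_inSector hR.2 (hRk k (by omega)), hRk k (by omega)]
    rfl

/-- Replacing x by max x 0 makes the function continuous on all of ℝ, as `intertwine_cfc` demands,
and changes nothing on the nonnegative spectrum of N_h. -/
theorem continuous_invSqrt : Continuous fun x : ℝ => (1 + max x 0) ^ (-(1 / 2) : ℝ) := by
  refine Continuous.rpow_const (by fun_prop) fun x => Or.inl ?_
  have := le_max_right x 0
  positivity

theorem invSqrtModeNumber_eq (h : H) (k : ℕ) : invSqrtModeNumber h k =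
    cfc (fun x : ℝ => (1 + max x 0) ^ (-(1 / 2) : ℝ)) (modeNumber h k) := by
  refine cfc_congr fun x hx => ?_
  have hnn : 0 ≤ modeNumber h k :=
    (ContinuousLinearMap.nonneg_iff_isPositive _).2 (modeNumber_nonneg h k)
  simp only [max_eq_left (spectrum_nonneg_of_nonneg hnn hx)]

theorem isometryW_eq (h : H) (hh : ‖h‖ = 1) : isometryW h hh = shiftUp (raising h) (C := 1)
    fun n => ContinuousLinearMap.opNorm_le_bound _ zero_le_one fun x => by
      rw [norm_raising h hh, one_mul] :=
  operator_ext fun ψ n => by cases n <;> rfl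

theorem isometryW_inSector (h : H) (hh : ‖h‖ = 1) (n : ℕ) (x : NParticle n H) :
    isometryW h hh (inSector n x) = inSector (n + 1) (raising h n x) := by
  rw [isometryW_eq, shiftUp_inSector]

/-- On at most n particles, W_h is R (1 + A)^{-1/2}, where R and A represent a*(h) and N_h. For k ≤
n the embedding of the k-particle space intertwines N_h with A, hence also their functions, so the
functional calculus of A acts on these sectors as that of N_h. -/
theorem isExtendedTensor_isometryW {D : Set H} (hD : ∀ h ∈ D, ∀ c : ℂ, c • h ∈ D) {h : H}
    (hh : h ∈ D) (h1 : ‖h‖ = 1) : IsExtendedTensor D 1 (isometryW h h1) := fun n => by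
  obtain ⟨R, hR, hRk⟩ := exists_tensor_creation hD hh n
  obtain ⟨A, hA, hsa, hAk⟩ := exists_tensor_modeNumber hD hh n
  refine ⟨R * cfc (fun x : ℝ => (1 + max x 0) ^ (-(1 / 2) : ℝ)) A,
    tensors_mul_degree_zero hR (cfc_mem_tensors hA _), clm_eq_of_inSector fun k x => ?_⟩
  change (R * _) (lowProj n H (inSector k x)) = isometryW h h1 (lowProj n H (inSector k x))
  rw [lowProj_inSector]
  split_ifs with hk
  · have hint : inSectorCLM k ∘L modeNumber h k = A ∘L inSectorCLM k :=
      ContinuousLinearMap.ext fun x => (hAk k hk x).symm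
    have h2 := DFunLike.congr_fun (intertwine_cfc (modeNumber_nonneg h k).isSelfAdjoint hsa hint _
      continuous_invSqrt) x
    rw [← invSqrtModeNumber_eq] at h2
    simp only [ContinuousLinearMap.comp_apply, inSectorCLM_apply] at h2
    rw [isometryW_inSector, mul_apply_eq_comp, ← h2, hRk k hk]
    rfl
  · rw [map_zero, map_zero]

/-! ### The field algebra -/

/-- The component of degree `m` of an operator with components of degrees between `-M` and `M`, as
an average over a finite subgroup of the gauge group. -/
def gaugeAverage (M : ℕ) (m : ℤ) : Operators H →L[ℂ] Operators H :=
  ((2 * M + 1 : ℕ) : ℂ)⁻¹ • ∑ j ∈ Finset.range (2 * M + 1),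
    Complex.exp (-(Complex.I * (2 * Real.pi * j / (2 * M + 1 : ℕ) : ℝ) * m)) •
      gaugeAd (2 * Real.pi * j / (2 * M + 1 : ℕ) : ℝ)

theorem gaugeAverage_apply (M : ℕ) (m : ℤ) (T : Operators H) : gaugeAverage M m T =
    ((2 * M + 1 : ℕ) : ℂ)⁻¹ • ∑ j ∈ Finset.range (2 * M + 1),
      Complex.exp (-(Complex.I * (2 * Real.pi * j / (2 * M + 1 : ℕ) : ℝ) * m)) •
        gaugeAd (2 * Real.pi * j / (2 * M + 1 : ℕ) : ℝ) T := by
  rw [gaugeAverage, smul_apply, sum_apply]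
  rfl

theorem norm_gaugeAverage_le (M : ℕ) (m : ℤ) (T : Operators H) : ‖gaugeAverage M m T‖ ≤ ‖T‖ := by
  have hK : (0 : ℝ) < (2 * M + 1 : ℕ) := by exact_mod_cast Nat.succ_pos _
  rw [gaugeAverage_apply, norm_smul, norm_inv, Complex.norm_natCast, inv_mul_le_iff₀ hK]
  refine (norm_sum_le _ _).trans_eq ?_
  have : ∀ u : ℝ, ‖Complex.exp (-(Complex.I * u * m)) • gaugeAd u T‖ = ‖T‖ := fun u => by
    rw [norm_smul, norm_gaugeAd, Complex.norm_exp]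
    simp
  simp only [this, Finset.sum_const, Finset.card_range, nsmul_eq_mul]

theorem gaugeAverage_mul_lowProj (M : ℕ) (m : ℤ) (T : Operators H) (n : ℕ) :
    gaugeAverage M m (T * lowProj n H) = gaugeAverage M m T * lowProj n H := by
  simp only [gaugeAverage_apply, gaugeAd_mul_lowProj, smul_mul_assoc, Finset.sum_mul]

theorem gaugeAverage_self {M : ℕ} {m : ℤ} {T : Operators H} (hT : IsTensor m T) :
    gaugeAverage M m T = T := by
  have : ∀ u : ℝ, Complex.exp (-(Complex.I * u * m)) • gaugeAd u T = T := fun u => by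
    rw [isTensor_iff.1 hT, smul_smul, ← Complex.exp_add, neg_add_cancel, Complex.exp_zero, one_smul]
  simp only [gaugeAverage_apply, this, Finset.sum_const, Finset.card_range]
  rw [← Nat.cast_smul_eq_nsmul ℂ, smul_smul, inv_mul_cancel₀ (Nat.cast_ne_zero.2 (Nat.succ_ne_zero _)),
    one_smul]

/-- A geometric sum over the (2M + 1)-th roots of unity: degrees in [−M, M] differ by at most 2M, so
distinct ones give a nontrivial root. Being a finite sum, this average applies to every bounded
operator, without any continuity of the gauge action. -/
theorem gaugeAverage_of_ne {M : ℕ} {m k : ℤ} (hm : |m| ≤ M) (hk : |k| ≤ M) (hmk : k ≠ m)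
    {T : Operators H} (hT : IsTensor k T) : gaugeAverage M m T = 0 := by
  have hprim := Complex.isPrimitiveRoot_exp (2 * M + 1) (Nat.succ_ne_zero _)
  obtain ⟨ζ, hζ⟩ : ∃ ζ, ζ = Complex.exp (2 * Real.pi * Complex.I / (2 * M + 1 : ℕ)) ^ (k - m) :=
    ⟨_, rfl⟩
  have hζ1 : ζ ≠ 1 := fun h => by
    rw [hζ, hprim.zpow_eq_one_iff_dvd] at h
    have h1 := Int.eq_zero_of_abs_lt_dvd h (by push_cast; rw [abs_lt]; rw [abs_le] at hm hk; omega)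
    omega
  have hζK : ζ ^ (2 * M + 1) = 1 := by
    rw [hζ, ← zpow_natCast, ← zpow_mul, mul_comm (k - m), zpow_mul, zpow_natCast, hprim.pow_eq_one,
      one_zpow]
  have : ∀ j : ℕ, Complex.exp (-(Complex.I * (2 * Real.pi * j / (2 * M + 1 : ℕ) : ℝ) * m)) •
      gaugeAd (2 * Real.pi * j / (2 * M + 1 : ℕ) : ℝ) T = ζ ^ j • T := fun j => by
    rw [isTensor_iff.1 hT, smul_smul, ← Complex.exp_add, hζ, ← Complex.exp_int_mul,
      ← Complex.exp_nat_mul]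
    congr 2
    push_cast
    ring
  simp only [gaugeAverage_apply, this]
  rw [← Finset.sum_smul, geom_sum_eq hζ1, hζK, sub_self, zero_div, zero_smul, smul_zero]

theorem gaugeAverage_mem {D : Set H} {M : ℕ} {m : ℤ} (hm : |m| ≤ M) {T : Operators H}
    (hT : T ∈ tensorSpace D M) : gaugeAverage M m T ∈ tensors D m := by
  refine (Submodule.topologicalClosure_minimal (t := (tensors D m).comap (gaugeAverage M m).toLinearMap)
    _ ?_ ?_) hT
  · refine Submodule.span_le.2 ?_
    rintro R ⟨hR, k, hk, hRk⟩
    change gaugeAverage M m R ∈ tensors D m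
    by_cases hmk : k = m
    · subst hmk
      rw [gaugeAverage_self hRk]
      exact ⟨hR, hRk⟩
    · rw [gaugeAverage_of_ne hm hk hmk hRk]
      exact zero_mem _
  · exact (isClosed_tensors D m).preimage (gaugeAverage M m).continuous

theorem sum_gaugeAverage {D : Set H} {M : ℕ} {T : Operators H} (hT : T ∈ tensorSpace D M) :
    ∑ m ∈ Finset.Icc (-(M : ℤ)) M, gaugeAverage M m T = T := by
  obtain ⟨A, hA⟩ : ∃ A : Operators H →L[ℂ] Operators H,
      ∀ T, A T = (∑ m ∈ Finset.Icc (-(M : ℤ)) M, gaugeAverage M m T) - T :=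
    ⟨(∑ m ∈ Finset.Icc (-(M : ℤ)) M, gaugeAverage M m) - ContinuousLinearMap.id ℂ _, fun T => by
      rw [sub_apply, sum_apply]
      rfl⟩
  have h := (Submodule.topologicalClosure_minimal (t := LinearMap.ker A.toLinearMap)
    (Submodule.span ℂ {R : Operators H | R ∈ resolventAlgebra D ∧
    ∃ m : ℤ, |m| ≤ M ∧ IsTensor m R}) ?_ ?_) hT
  · exact sub_eq_zero.1 ((hA T).symm.trans h)
  · refine Submodule.span_le.2 ?_
    rintro R ⟨hR, k, hk, hRk⟩
    change A R = 0
    rw [hA, sub_eq_zero,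
      Finset.sum_eq_single_of_mem k (Finset.mem_Icc.2 (abs_le.1 hk)), gaugeAverage_self hRk]
    exact fun m hm hmk => gaugeAverage_of_ne (abs_le.2 (Finset.mem_Icc.1 hm)) hk (Ne.symm hmk) hRk
  · exact ContinuousLinearMap.isClosed_ker A

/-- The operators which coincide on each subspace of limited particle number with an element of
`tensorSpace D M`. -/
def extendedTensorSpace (D : Set H) (M : ℕ) : Submodule ℂ (Operators H) where
  carrier := {F | ∀ n, ∃ R ∈ tensorSpace D M, R * lowProj n H = F * lowProj n H}
  zero_mem' _ := ⟨0, zero_mem _, rfl⟩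
  add_mem' hS hT n := by
    obtain ⟨R, hR, h⟩ := hS n
    obtain ⟨R', hR', h'⟩ := hT n
    exact ⟨R + R', add_mem hR hR', by rw [add_mul, add_mul, h, h']⟩
  smul_mem' c T hT n := by
    obtain ⟨R, hR, h⟩ := hT n
    exact ⟨c • R, Submodule.smul_mem _ _ hR, by rw [smul_mul_assoc, smul_mul_assoc, h]⟩

theorem fieldAlgebra_eq (D : Set H) :
    fieldAlgebra D = closure {F | ∃ M, F ∈ extendedTensorSpace D M} := by
  rw [fieldAlgebra]
  congr 1
  ext F
  refine exists_congr fun M => forall_congr' fun n => exists_congr fun R => and_congr_right fun _ => ?_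
  rw [eq_comm, mul_lowProj_eq_iff]

theorem extendedTensorSpace_mono {D : Set H} {M M' : ℕ} (hM : M ≤ M') :
    extendedTensorSpace D M ≤ extendedTensorSpace D M' := fun F hF n => by
  obtain ⟨R, hR, h⟩ := hF n
  refine ⟨R, Submodule.topologicalClosure_mono (Submodule.span_mono ?_) hR, h⟩
  rintro R ⟨hR, k, hk, hRk⟩
  exact ⟨hR, k, hk.trans (by exact_mod_cast hM), hRk⟩

theorem IsExtendedTensor.mem_extendedTensorSpace {D : Set H} {m : ℤ} {T : Operators H}
    (hT : IsExtendedTensor D m T) {M : ℕ} (hm : |m| ≤ M) : T ∈ extendedTensorSpace D M := fun n => by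
  obtain ⟨R, hR, h⟩ := hT n
  exact ⟨R, Submodule.le_topologicalClosure _ (Submodule.subset_span ⟨hR.1, m, hm, hR.2⟩), h⟩

theorem isExtendedTensor_gaugeAverage {D : Set H} {M : ℕ} {m : ℤ} (hm : |m| ≤ M) {F : Operators H}
    (hF : F ∈ extendedTensorSpace D M) : IsExtendedTensor D m (gaugeAverage M m F) := fun n => by
  obtain ⟨R, hR, h⟩ := hF n
  exact ⟨gaugeAverage M m R, gaugeAverage_mem hm hR, by
    rw [← gaugeAverage_mul_lowProj, h, gaugeAverage_mul_lowProj]⟩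

theorem sum_gaugeAverage_extended {D : Set H} {M : ℕ} {F : Operators H}
    (hF : F ∈ extendedTensorSpace D M) :
    ∑ m ∈ Finset.Icc (-(M : ℤ)) M, gaugeAverage M m F = F := eq_of_mul_lowProj fun n => by
  obtain ⟨R, hR, h⟩ := hF n
  simp only [Finset.sum_mul, ← gaugeAverage_mul_lowProj]
  simp only [← h, gaugeAverage_mul_lowProj]
  rw [← Finset.sum_mul, sum_gaugeAverage hR]

/-- Tensors in the field algebra are extended tensors. -/
theorem isExtendedTensor_of_mem_fieldAlgebra {D : Set H} {m : ℤ} {T : Operators H}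
    (hT : T ∈ fieldAlgebra D) (hm : IsTensor m T) : IsExtendedTensor D m T :=
  IsExtendedTensor.of_near fun ε hε => by
    rw [fieldAlgebra_eq] at hT
    obtain ⟨F, ⟨M, hF⟩, h⟩ := Metric.mem_closure_iff.1 hT ε hε
    -- With M + |m| in place of M, the degree m is among those which the average separates. The
    -- average is contractive and fixes T, so the degree m component of F is as close to T as F is.
    have hF' := extendedTensorSpace_mono (Nat.le_add_right M m.natAbs) hF
    refine ⟨gaugeAverage (M + m.natAbs) m F, isExtendedTensor_gaugeAverage
      (by rw [Int.abs_eq_natAbs]; push_cast; omega) hF', ?_⟩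
    rw [dist_comm, dist_eq_norm] at h
    have e : gaugeAverage (M + m.natAbs) m F - T = gaugeAverage (M + m.natAbs) m (F - T) := by
      rw [map_sub, gaugeAverage_self hm]
    rw [e]
    exact (norm_gaugeAverage_le _ _ _).trans_lt h

/-! ### Functions of the number operator -/

/-- The unitary operator acting on the `n`-particle space as multiplication by `w n`. -/
def phase (w : ℕ → Circle) (H : Type*) [NormedAddCommGroup H] [InnerProductSpace ℂ H] :
    Operators H :=
  diagonal (fun n => (w n : ℂ)) (C := 1) fun n => (Circle.norm_coe (w n)).le

theorem sector_phase (w : ℕ → Circle) (ψ : Fock H) (n : ℕ) :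
    (phase w H ψ).sector n = (w n : ℂ) • ψ.sector n := sector_diagonal _ _ _ _

theorem phase_inSector (w : ℕ → Circle) (n : ℕ) (x : NParticle n H) :
    phase w H (inSector n x) = (w n : ℂ) • inSector n x := diagonal_inSector _ _ _ _

theorem phase_one : phase 1 H = 1 := operator_ext fun ψ n => by
  rw [sector_phase, Pi.one_apply, Circle.coe_one, one_smul]
  rfl

theorem phase_mul (v w : ℕ → Circle) : phase (v * w) H = phase v H * phase w H :=
  operator_ext fun ψ n => by
    rw [mul_apply_eq_comp, sector_phase, sector_phase, sector_phase, smul_smul, Pi.mul_apply,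
      Circle.coe_mul]

theorem star_phase (w : ℕ → Circle) : star (phase w H) = phase w⁻¹ H := by
  rw [phase, star_diagonal]
  refine operator_ext fun ψ n => ?_
  rw [sector_diagonal, sector_phase, Pi.inv_apply, Circle.coe_inv_eq_conj]

theorem isTensor_phase (w : ℕ → Circle) : IsTensor 0 (phase w H) := isTensor_diagonal _ _

theorem phase_mem_unitary (w : ℕ → Circle) : phase w H ∈ unitary (Operators H) := by
  rw [Unitary.mem_iff, star_phase, ← phase_mul, ← phase_mul, inv_mul_cancel, mul_inv_cancel,
    phase_one]
  exact ⟨rfl, rfl⟩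

/-- The unitary group of the von Neumann algebra generated by the number operator. -/
def phaseHom (H : Type*) [NormedAddCommGroup H] [InnerProductSpace ℂ H] :
    (ℕ → Circle) →* unitary (Operators H) where
  toFun w := ⟨phase w H, phase_mem_unitary w⟩
  map_one' := Subtype.ext phase_one
  map_mul' v w := Subtype.ext (phase_mul v w)

theorem coe_phaseHom (w : ℕ → Circle) : (phaseHom H w : Operators H) = phase w H := rfl

theorem commute_phase_of_sector {B : Operators H}
    (hB : ∀ n (x : NParticle n H) k, k ≠ n → (B (inSector n x)).sector k = 0) (w : ℕ → Circle) :
    phase w H * B = B * phase w H := clm_eq_of_inSector fun n x => by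
  rw [mul_apply_eq_comp, mul_apply_eq_comp, phase_inSector, map_smul]
  refine Fock.ext fun k => ?_
  rw [sector_phase, Fock.sector_smul]
  by_cases hk : k = n
  · rw [hk]
  · rw [hB n x k hk, smul_zero, smul_zero]

theorem IsTensor.commute_phase {B : Operators H} (hB : IsTensor 0 B) (w : ℕ → Circle) :
    phase w H * B = B * phase w H :=
  commute_phase_of_sector (fun _ x _ hk => hB.sector_inSector_eq_zero (by omega) x) w

theorem inSector_mem_domain (n : ℕ) (x : NParticle n H) : inSector n x ∈ (numberOp H).domain :=
  summable_of_ne_finset_zero (s := {n}) fun k hk => by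
    rw [inSector_ne x (by simpa using hk), smul_zero, norm_zero]
    norm_num

theorem sector_numberOp (ψ : (numberOp H).domain) (n : ℕ) :
    (numberOp H ψ).sector n = (n : ℂ) • (ψ : Fock H).sector n := rfl

theorem CommutesWithNumber.sector_eq_zero {B : Operators H} (hB : CommutesWithNumber B) (n : ℕ)
    (x : NParticle n H) (k : ℕ) (hk : k ≠ n) : (B (inSector n x)).sector k = 0 := by
  obtain ⟨h, e⟩ := hB ⟨_, inSector_mem_domain n x⟩
  have h1 : numberOp H ⟨_, inSector_mem_domain n x⟩ = (n : ℂ) • inSector n x :=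
    Fock.ext fun k => by
      rw [sector_numberOp, Fock.sector_smul]
      by_cases hk : k = n
      · rw [hk]
      · rw [inSector_ne x hk, smul_zero, smul_zero]
  rw [h1, map_smul] at e
  have e' := congrArg (fun ψ => Fock.sector ψ k) e
  simp only [sector_numberOp, Fock.sector_smul] at e'
  rw [← sub_eq_zero, ← sub_smul, smul_eq_zero, sub_eq_zero] at e'
  exact e'.resolve_left (by exact_mod_cast hk)

theorem CommutesWithNumber.isTensor {B : Operators H} (hB : CommutesWithNumber B) :
    IsTensor 0 B := isTensor_iff.2 fun u => by
  have hg : (gaugeUnitary u : Operators H) = phase (fun n => Circle.exp (u * n)) H :=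
    operator_ext fun ψ n => by
      rw [sector_gaugeUnitary, sector_phase, Circle.coe_exp]
      congr 2
      push_cast
      ring
  rw [gaugeAd_apply, hg, commute_phase_of_sector hB.sector_eq_zero, ← hg, mul_assoc,
    gaugeUnitary_mul, add_neg_cancel, gaugeUnitary_zero]
  simp

theorem phase_mem_numberVN (w : ℕ → Circle) : phase w H ∈ numberVN H :=
  Set.mem_centralizer_iff.2 fun _ hB => (hB.isTensor.commute_phase w).symm

theorem commutesWithNumber_rankOne (n : ℕ) (x y : NParticle n H) :
    CommutesWithNumber (inSectorCLM n ∘L (innerSL ℂ y).smulRight x ∘L sectorCLM n) := fun ψ => by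
  refine ⟨inSector_mem_domain n _, Fock.ext fun k => ?_⟩
  rw [sector_numberOp]
  change (k : ℂ) • (inSector n (⟪y, (ψ : Fock H).sector n⟫_ℂ • x)).sector k =
    (inSector n (⟪y, (n : ℂ) • (ψ : Fock H).sector n⟫_ℂ • x)).sector k
  by_cases hk : k = n
  · subst hk
    rw [inSector_self, inSector_self, inner_smul_right, smul_smul]
  · rw [inSector_ne _ hk, inSector_ne _ hk, smul_zero]

/-- The operator `T` is multiplication by a scalar on each `n`-particle space. -/
def IsSectorScalar (T : Operators H) : Prop :=
  ∀ n, ∃ c : ℂ, ∀ x : NParticle n H, T (inSector n x) = c • inSector n x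

/-- The rank one operators |x⟩⟨y| within the n-particle space commute with N, hence with T. Applied
to a fixed y ≠ 0, this gives T x = c x with c depending on y only. -/
theorem isSectorScalar_of_mem_numberVN {T : Operators H} (hT : T ∈ numberVN H) :
    IsSectorScalar T := fun n => by
  by_cases hn : ∀ y : NParticle n H, y = 0
  · refine ⟨0, fun x => ?_⟩
    rw [hn x]
    exact (congrArg T (map_zero (inSectorCLM n))).trans (by rw [map_zero, zero_smul])
  push Not at hn
  obtain ⟨y, hy⟩ := hn
  refine ⟨(⟪y, y⟫_ℂ)⁻¹ * ⟪y, (T (inSector n y)).sector n⟫_ℂ, fun x => ?_⟩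
  have h := DFunLike.congr_fun
    (Set.mem_centralizer_iff.1 hT _ (commutesWithNumber_rankOne n x y)) (inSector n y)
  have h' : inSector n (⟪y, (T (inSector n y)).sector n⟫_ℂ • x) =
    T (inSector n (⟪y, (inSector n y).sector n⟫_ℂ • x)) := h
  rw [inSector_self, inSector_smul, inSector_smul, map_smul] at h'
  rw [mul_smul, h', smul_smul, inv_mul_cancel₀ (inner_self_ne_zero.2 hy), one_smul]

theorem IsSectorScalar.exists_phase {T : Operators H} (hT : IsSectorScalar T)
    (hu : star T * T = 1) : ∃ w, T = phase w H := by
  choose c hc using hT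
  have h : ∀ n, ∃ w : Circle, ∀ x : NParticle n H, T (inSector n x) = (w : ℂ) • inSector n x := by
    intro n
    by_cases hn : ∀ y : NParticle n H, y = 0
    · refine ⟨1, fun x => ?_⟩
      rw [hn x]
      change T (inSectorCLM n 0) = _ • inSectorCLM n 0
      rw [map_zero, map_zero, smul_zero]
    push Not at hn
    obtain ⟨y, hy⟩ := hn
    have h1 : ‖T (inSector n y)‖ = ‖inSector n y‖ :=
      ContinuousLinearMap.norm_map_iff_adjoint_comp_self T |>.2 hu _
    rw [hc, norm_smul, norm_inSector] at h1
    have h2 : ‖c n‖ = 1 := by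
      have := norm_ne_zero_iff.2 hy
      field_simp at h1
      exact h1
    exact ⟨⟨c n, mem_sphere_zero_iff_norm.2 h2⟩, hc n⟩
  choose w hw using h
  exact ⟨w, clm_eq_of_inSector fun n x => by rw [hw, phase_inSector]⟩

/-! ### The vacuum -/

/-- The vacuum vector. -/
def vacuum (H : Type*) [NormedAddCommGroup H] [InnerProductSpace ℂ H] : Fock H :=
  inSector 0 (symTensor Fin.elim0)

theorem norm_vacuum : ‖vacuum H‖ = 1 := by
  rw [vacuum, norm_inSector, ← sq_eq_sq₀ (norm_nonneg _) zero_le_one]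
  have h : ⟪symTensor (H := H) Fin.elim0, symTensor Fin.elim0⟫_ℂ = 1 := by
    rw [inner_symTensor]
    simp [symKernel]
  rw [inner_self_eq_ofReal] at h
  rw [one_pow]
  exact_mod_cast h

theorem inSector_zero_eq (x : NParticle 0 H) :
    inSector 0 x = ⟪vacuum H, inSector 0 x⟫_ℂ • vacuum H := by
  have h : ContinuousLinearMap.id ℂ (NParticle 0 H) =
      (innerSL ℂ (symTensor (H := H) Fin.elim0)).smulRight (symTensor Fin.elim0) :=
    eq_of_symTensor fun g => by
      rw [Subsingleton.elim g Fin.elim0, ContinuousLinearMap.smulRight_apply, innerSL_apply_apply,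
        inner_symTensor]
      simp [symKernel]
  have h' := DFunLike.congr_fun h x
  rw [vacuum, inner_inSector, inSector_self, ← inSector_smul]
  exact congrArg (inSector 0) h'

/-! ### The isometry W_h and its powers applied to the vacuum -/

theorem star_isometryW_mul_self (h : H) (hh : ‖h‖ = 1) :
    star (isometryW h hh) * isometryW h hh = 1 := by
  refine ContinuousLinearMap.norm_map_iff_adjoint_comp_self _ |>.1 fun ψ => ?_
  rw [← sq_eq_sq₀ (norm_nonneg _) (norm_nonneg _), Fock.norm_sq, Fock.norm_sq,
    Summable.tsum_eq_zero_add (Fock.summable_sq _)]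
  have h0 : (isometryW h hh ψ).sector 0 = 0 := rfl
  have h1 : ∀ n, (isometryW h hh ψ).sector (n + 1) = raising h n (ψ.sector n) := fun _ => rfl
  simp only [h0, h1, norm_raising h hh]
  simp

theorem norm_isometryW_apply (h : H) (hh : ‖h‖ = 1) (ψ : Fock H) : ‖isometryW h hh ψ‖ = ‖ψ‖ :=
  ContinuousLinearMap.norm_map_iff_adjoint_comp_self _ |>.2 (star_isometryW_mul_self h hh) ψ

theorem isTensor_isometryW (h : H) (hh : ‖h‖ = 1) : IsTensor 1 (isometryW h hh) := by
  rw [isometryW_eq]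
  exact isTensor_shiftUp _ _

/-- The unit vector of `n` particles in the state `h`. -/
theorem exists_isometryW_pow_vacuum (h : H) (hh : ‖h‖ = 1) (n : ℕ) :
    ∃ x : NParticle n H, (isometryW h hh ^ n) (vacuum H) = inSector n x ∧ ‖x‖ = 1 := by
  induction n with
  | zero =>
    refine ⟨symTensor Fin.elim0, rfl, ?_⟩
    rw [← norm_inSector]
    exact norm_vacuum
  | succ n ih =>
    obtain ⟨x, hx, hx1⟩ := ih
    refine ⟨raising h n x, ?_, by rw [norm_raising h hh, hx1]⟩
    rw [pow_succ', mul_apply_eq_comp, hx, isometryW_inSector]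

/-- Every sector contains a unit vector, obtained by applying a power of W_h to the vacuum, from
which the phase can be read off. -/
theorem phaseHom_injective {h : H} (hh : ‖h‖ = 1) : Function.Injective (phaseHom H) :=
  fun v w hvw => funext fun n => by
    obtain ⟨x, -, hx⟩ := exists_isometryW_pow_vacuum h hh n
    have h1 := DFunLike.congr_fun (congrArg Subtype.val hvw) (inSector n x)
    rw [coe_phaseHom, coe_phaseHom, phase_inSector, phase_inSector] at h1
    refine Circle.coe_injective (smul_left_injective ℂ (?_ : inSector n x ≠ 0) h1)
    rw [← norm_ne_zero_iff, norm_inSector, hx]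
    exact one_ne_zero

/-- Representations by unitaries in the von Neumann algebra generated by the number operator. -/
theorem exists_phaseHom {h : H} (hh : ‖h‖ = 1) {G : Type*} [Group G]
    (Z : G →* unitary (Operators H)) (hZ : ∀ g, (Z g : Operators H) ∈ numberVN H) :
    ∃ z : G →* (ℕ → Circle), ∀ g, Z g = phaseHom H (z g) := by
  have h1 : ∀ g, ∃ w, Z g = phaseHom H w := fun g => by
    obtain ⟨w, hw⟩ := (isSectorScalar_of_mem_numberVN (hZ g)).exists_phase
      (Unitary.star_mul_self_of_mem (Z g).2)
    exact ⟨w, Subtype.ext hw⟩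
  choose z hz using h1
  -- Injectivity makes the chosen phases multiplicative.
  refine ⟨MonoidHom.mk' z fun a b => phaseHom_injective hh ?_, hz⟩
  rw [← hz, map_mul, map_mul, hz, hz]

/-! ### Irreducibility of the observables on the `n`-particle spaces -/

/-- The norm distance of two symmetric tensors is the square root of a polynomial in scalar products
of their factors. Continuity allows the factors to be restricted to a dense set. -/
theorem continuous_symTensor (n : ℕ) : Continuous fun g : Fin n → H => symTensor g := by
  refine continuous_iff_continuousAt.2 fun f => tendsto_iff_norm_sub_tendsto_zero.2 ?_
  have hc : Continuous fun g : Fin n → H => RCLike.re (symKernel g g) -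
      2 * RCLike.re (symKernel g f) + RCLike.re (symKernel f f) := by
    unfold symKernel
    fun_prop
  have e : ∀ g : Fin n → H, ‖symTensor g - symTensor f‖ = √(RCLike.re (symKernel g g) -
      2 * RCLike.re (symKernel g f) + RCLike.re (symKernel f f)) := fun g => by
    rw [← Real.sqrt_sq (norm_nonneg (symTensor g - symTensor f)), norm_sub_sq (𝕜 := ℂ),
      ← inner_self_eq_norm_sq (𝕜 := ℂ), ← inner_self_eq_norm_sq (𝕜 := ℂ), inner_symTensor,
      inner_symTensor, inner_symTensor]
  simp only [e]
  refine (hc.sqrt.tendsto f).trans_eq ?_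
  ring_nf
  simp

theorem eq_of_symTensor_dense {D : Set H} (hdense : Dense D) {n : ℕ} {E : Type*}
    [NormedAddCommGroup E] [NormedSpace ℂ E] {A B : NParticle n H →L[ℂ] E}
    (h : ∀ g : Fin n → H, (∀ i, g i ∈ D) → A (symTensor g) = B (symTensor g)) : A = B := by
  refine eq_of_symTensor fun g => ?_
  have hd : Dense (Set.univ.pi fun _ : Fin n => D) := dense_pi _ fun _ _ => hdense
  exact congrFun (Continuous.ext_on hd (A.continuous.comp (continuous_symTensor n))
    (B.continuous.comp (continuous_symTensor n)) fun g hg => h g fun i => hg i (Set.mem_univ i)) g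

/-- The factors are created one after the other, dividing by the normalization √(n+1) of a* each
time. Thus the vacuum is cyclic for the extended tensors when D is dense. -/
theorem exists_extendedTensor_vacuum {D : Set H} (hD : ∀ h ∈ D, ∀ c : ℂ, c • h ∈ D) (n : ℕ)
    (g : Fin n → H) (hg : ∀ i, g i ∈ D) :
    ∃ C, IsExtendedTensor D n C ∧ C (vacuum H) = inSector n (symTensor g) := by
  induction n with
  | zero =>
    refine ⟨1, isExtendedTensor_of_mem ⟨one_mem _, isTensor_one⟩, ?_⟩
    rw [Subsingleton.elim g Fin.elim0]
    rfl
  | succ n ih =>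
    obtain ⟨C, hC, hC'⟩ := ih (Fin.tail g) fun i => hg i.succ
    obtain ⟨R, hR, hRk⟩ := exists_tensor_creation hD (hg 0) n
    have hRC := (isExtendedTensor_of_mem hR).mul hC
    have hs : ((√(n + 1 : ℝ) : ℝ) : ℂ) ≠ 0 := by
      rw [Complex.ofReal_ne_zero]
      positivity
    refine ⟨((√(n + 1 : ℝ) : ℝ) : ℂ)⁻¹ • (R * C), ?_, ?_⟩
    · have := hRC.smul ((√(n + 1 : ℝ) : ℝ) : ℂ)⁻¹
      rwa [add_comm] at this
    · rw [smul_apply, mul_apply_eq_comp, hC', hRk n le_rfl, creation_symTensor, inSector_smul,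
        smul_smul, inv_mul_cancel₀ hs, one_smul, Fin.cons_self_tail]

/-- Put x = WⁿΩ, and let C create a symmetric tensor t with factors in D from the vacuum Ω. Then C
(Wⁿ)* is an observable acting on the n-particle space as |t⟩⟨x|. Commuting it with Y and evaluating
at x gives Y t = ⟨x, Y x⟩ t, and such tensors t are total. -/
theorem isSectorScalar_of_commute {D : Set H} (hD : ∀ h ∈ D, ∀ c : ℂ, c • h ∈ D)
    (hdense : Dense D) {f : H} (hf : f ∈ D) (hf1 : ‖f‖ = 1) {Y : Operators H} (hY : IsTensor 0 Y)
    (hYA : ∀ A ∈ observables D, Y * A = A * Y) : IsSectorScalar Y := fun n => by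
  obtain ⟨x, hx, hx1⟩ := exists_isometryW_pow_vacuum f hf1 n
  have hW := (isExtendedTensor_isometryW hD hf hf1).pow n
  rw [mul_one] at hW
  have hrank : ∀ C : Operators H, ∀ y : NParticle n H, (C * star (isometryW f hf1 ^ n))
      (inSector n y) = ⟪inSector n x, inSector n y⟫_ℂ • C (vacuum H) := fun C y => by
    have h1 : star (isometryW f hf1 ^ n) (inSector n y) =
        inSector 0 ((star (isometryW f hf1 ^ n) (inSector n y)).sector 0) := Fock.ext fun k => by
      by_cases hk : k = 0
      · subst hk
        rw [inSector_self]
      · rw [inSector_ne _ hk, hW.isTensor.star.sector_inSector_eq_zero (by omega)]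
    rw [mul_apply_eq_comp, h1, inSector_zero_eq, ← h1, inner_star_right, hx, map_smul]
  refine ⟨⟪inSector n x, Y (inSector n x)⟫_ℂ, fun y => ?_⟩
  have hYx : Y (inSector n x) = inSector n ((Y (inSector n x)).sector n) := Fock.ext fun k => by
    by_cases hk : k = n
    · subst hk
      rw [inSector_self]
    · rw [inSector_ne _ hk, hY.sector_inSector_eq_zero (by omega)]
  have h : Y ∘L inSectorCLM n = ⟪inSector n x, Y (inSector n x)⟫_ℂ • inSectorCLM n :=
    eq_of_symTensor_dense hdense fun g hg => by
      obtain ⟨C, hC, hC'⟩ := exists_extendedTensor_vacuum hD n g hg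
      have hmem := hC.mul hW.star
      rw [add_neg_cancel, ← mem_observables_iff] at hmem
      have h1 := DFunLike.congr_fun (hYA _ hmem) (inSector n x)
      change Y ((C * _) (inSector n x)) = (C * _) (Y (inSector n x)) at h1
      rw [hYx, hrank, hrank, ← hYx, hC', map_smul, inner_self_eq_ofReal, norm_inSector, hx1] at h1
      simpa using h1
  exact DFunLike.congr_fun h y

/-! ### Isometries of orthogonal modes -/

section orthogonal

variable {g h : H}

theorem annihilation_creation_zero_of_orthogonal (hgh : ⟪h, g⟫_ℂ = 0) :
    annihilation 0 h ∘L creation 0 g = 0 := ContinuousLinearMap.ext fun x => by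
  rw [ContinuousLinearMap.comp_apply, annihilation_creation_zero, hgh, zero_smul, zero_apply]

theorem annihilation_creation_of_orthogonal (hgh : ⟪h, g⟫_ℂ = 0) (n : ℕ) :
    annihilation (n + 1) h ∘L creation (n + 1) g = creation n g ∘L annihilation n h :=
  ContinuousLinearMap.ext fun x => by
    rw [ContinuousLinearMap.comp_apply, annihilation_creation_succ, hgh, zero_smul, zero_add,
      ContinuousLinearMap.comp_apply]

theorem modeNumber_succ (h : H) (n : ℕ) :
    modeNumber h (n + 1) = creation n h ∘L annihilation n h := rfl

theorem modeNumber_zero (h : H) : modeNumber h 0 = 0 := rfl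

theorem creation_modeNumber (hgh : ⟪g, h⟫_ℂ = 0) (n : ℕ) :
    creation n h ∘L modeNumber g n = modeNumber g (n + 1) ∘L creation n h := by
  rcases n with _ | n
  · rw [modeNumber_zero, modeNumber_succ, ContinuousLinearMap.comp_assoc,
      annihilation_creation_zero_of_orthogonal hgh, ContinuousLinearMap.comp_zero,
      ContinuousLinearMap.comp_zero]
  · rw [modeNumber_succ, modeNumber_succ, ContinuousLinearMap.comp_assoc,
      annihilation_creation_of_orthogonal hgh, ← ContinuousLinearMap.comp_assoc, creation_comm,
      ContinuousLinearMap.comp_assoc]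

theorem annihilation_modeNumber (hgh : ⟪h, g⟫_ℂ = 0) (n : ℕ) :
    annihilation n h ∘L modeNumber g (n + 1) = modeNumber g n ∘L annihilation n h := by
  rcases n with _ | n
  · rw [modeNumber_zero, modeNumber_succ, ← ContinuousLinearMap.comp_assoc,
      annihilation_creation_zero_of_orthogonal hgh, ContinuousLinearMap.zero_comp,
      ContinuousLinearMap.zero_comp]
  · rw [modeNumber_succ, modeNumber_succ, ← ContinuousLinearMap.comp_assoc,
      annihilation_creation_of_orthogonal hgh, ContinuousLinearMap.comp_assoc, annihilation_comm,
      ContinuousLinearMap.comp_assoc]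

theorem intertwine_invSqrtModeNumber {m n : ℕ} {T : NParticle m H →L[ℂ] NParticle n H}
    (hT : T ∘L modeNumber g m = modeNumber g n ∘L T) :
    T ∘L invSqrtModeNumber g m = invSqrtModeNumber g n ∘L T := by
  rw [invSqrtModeNumber_eq, invSqrtModeNumber_eq]
  exact intertwine_cfc (modeNumber_nonneg g m).isSelfAdjoint (modeNumber_nonneg g n).isSelfAdjoint
    hT _ continuous_invSqrt

theorem raising_creation (hgh : ⟪g, h⟫_ℂ = 0) (n : ℕ) :
    raising g (n + 1) ∘L creation n h = creation (n + 1) h ∘L raising g n := by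
  rw [raising, raising, ContinuousLinearMap.comp_assoc,
    ← intertwine_invSqrtModeNumber (creation_modeNumber hgh n), ← ContinuousLinearMap.comp_assoc,
    creation_comm, ContinuousLinearMap.comp_assoc]

theorem annihilation_raising (hgh : ⟪h, g⟫_ℂ = 0) (n : ℕ) :
    annihilation (n + 1) h ∘L raising g (n + 1) = raising g n ∘L annihilation n h := by
  rw [raising, raising, ContinuousLinearMap.comp_assoc (creation n g),
    ← intertwine_invSqrtModeNumber (annihilation_modeNumber hgh n),
    ← ContinuousLinearMap.comp_assoc, annihilation_creation_of_orthogonal hgh,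
    ContinuousLinearMap.comp_assoc]

theorem annihilation_raising_zero (hgh : ⟪h, g⟫_ℂ = 0) :
    annihilation 0 h ∘L raising g 0 = 0 := by
  rw [raising, ← ContinuousLinearMap.comp_assoc, annihilation_creation_zero_of_orthogonal hgh,
    ContinuousLinearMap.zero_comp]

theorem raising_modeNumber (hgh : ⟪g, h⟫_ℂ = 0) (n : ℕ) :
    raising g n ∘L modeNumber h n = modeNumber h (n + 1) ∘L raising g n := by
  have hhg : ⟪h, g⟫_ℂ = 0 := inner_eq_zero_symm.1 hgh
  rcases n with _ | n
  · rw [modeNumber_zero, modeNumber_succ, ContinuousLinearMap.comp_assoc,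
      annihilation_raising_zero hhg, ContinuousLinearMap.comp_zero, ContinuousLinearMap.comp_zero]
  · rw [modeNumber_succ, modeNumber_succ, ContinuousLinearMap.comp_assoc,
      annihilation_raising hhg, ← ContinuousLinearMap.comp_assoc, raising_creation hgh,
      ContinuousLinearMap.comp_assoc]

theorem raising_comm (hgh : ⟪g, h⟫_ℂ = 0) (n : ℕ) :
    raising g (n + 1) ∘L raising h n = raising h (n + 1) ∘L raising g n := by
  rw [raising.eq_1 h, raising.eq_1 h, ← ContinuousLinearMap.comp_assoc, raising_creation hgh,
    ContinuousLinearMap.comp_assoc, intertwine_invSqrtModeNumber (raising_modeNumber hgh n),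
    ContinuousLinearMap.comp_assoc]

/-- For orthogonal modes the creation operators and number operators of one mode commute with those
of the other, and functional calculus extends this to the factors (1 + N)^{-1/2} of the modes. -/
theorem isometryW_comm (hg : ‖g‖ = 1) (hh : ‖h‖ = 1) (hgh : ⟪g, h⟫_ℂ = 0) :
    isometryW g hg * isometryW h hh = isometryW h hh * isometryW g hg :=
  clm_eq_of_inSector fun n x => by
    rw [mul_apply_eq_comp, mul_apply_eq_comp, isometryW_inSector, isometryW_inSector,
      isometryW_inSector, isometryW_inSector]
    exact congrArg _ (DFunLike.congr_fun (raising_comm hgh n) x)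

theorem isometryW_mem_finite (hg : ‖g‖ = 1) (ψ : finiteParticles H) :
    isometryW g hg (ψ : Fock H) ∈ finiteParticles H := by
  obtain ⟨ψ, n, hn⟩ := ψ
  refine ⟨n + 1, fun k hk => ?_⟩
  rcases k with _ | k
  · omega
  · change raising g k (ψ.sector k) = 0
    rw [hn k (by omega), map_zero]

theorem fieldMap_isometryW (hg : ‖g‖ = 1) (hgh : ⟪g, h⟫_ℂ = 0) (ψ : finiteParticles H) :
    fieldMap h ⟨_, isometryW_mem_finite hg ψ⟩ = isometryW g hg (fieldMap h ψ) := by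
  have hhg : ⟪h, g⟫_ℂ = 0 := inner_eq_zero_symm.1 hgh
  refine Fock.ext fun n => ?_
  have hW : ∀ (χ : Fock H) k, (isometryW g hg χ).sector (k + 1) = raising g k (χ.sector k) :=
    fun _ _ => rfl
  have hW0 : ∀ χ : Fock H, (isometryW g hg χ).sector 0 = 0 := fun _ => rfl
  have h1 : ∀ k x, raising g (k + 1) (creation k h x) = creation (k + 1) h (raising g k x) :=
    fun k => DFunLike.congr_fun (raising_creation hgh k)
  have h2 : ∀ k x, annihilation (k + 1) h (raising g (k + 1) x) =
    raising g k (annihilation k h x) := fun k => DFunLike.congr_fun (annihilation_raising hhg k)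
  have h3 : ∀ x, annihilation 0 h (raising g 0 x) = 0 :=
    DFunLike.congr_fun (annihilation_raising_zero hhg)
  rcases n with _ | _ | n
  · rw [fieldMap_zero, hW, hW0, h3]
  · rw [fieldMap_succ, hW, hW, hW0, h2, fieldMap_zero, map_zero]
    exact zero_add _
  · rw [fieldMap_succ, hW, hW, hW, fieldMap_succ, h2, map_add, h1]

/-- W_g commutes with φ(h) on finite-particle vectors if g ⊥ h, and the range of iλ + φ(h) on these
vectors is dense. -/
theorem commute_isometryW_fieldResolvent (hg : ‖g‖ = 1) (hgh : ⟪g, h⟫_ℂ = 0) (lam : ℝ)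
    (hlam : lam ≠ 0) : Commute (isometryW g hg) (fieldResolvent lam hlam h) :=
  clm_eq_of_resolvent_range lam hlam h fun ψ => by
    have := fieldResolvent_apply lam hlam h ⟨_, isometryW_mem_finite hg ψ⟩
    rw [mul_apply_eq_comp, mul_apply_eq_comp, fieldResolvent_apply, map_add, map_smul,
      ← fieldMap_isometryW hg hgh, this]

theorem commute_star_isometryW_fieldResolvent (hg : ‖g‖ = 1) (hgh : ⟪g, h⟫_ℂ = 0) (lam : ℝ)
    (hlam : lam ≠ 0) : Commute (star (isometryW g hg)) (fieldResolvent lam hlam h) := by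
  have := (commute_isometryW_fieldResolvent hg hgh (-lam) (neg_ne_zero.2 hlam)).star_star
  rw [star_fieldResolvent] at this
  simpa only [neg_neg] using this

end orthogonal

/-! ### Rigidity of the phases -/

/-- The operators `W_g* R W_g` converge to `R` in the resolvent algebra as `g` tends to infinity. -/
theorem tendsto_star_isometryW_mul {D : Set H} {g : ℕ → H} (hg : ∀ j, ‖g j‖ = 1)
    (hgD : ∀ h ∈ D, ∀ᶠ j in Filter.atTop, ⟪g j, h⟫_ℂ = 0) {R : Operators H}
    (hR : R ∈ resolventAlgebra D) :
    Filter.Tendsto (fun j => star (isometryW (g j) (hg j)) * R * isometryW (g j) (hg j))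
      Filter.atTop (nhds R) := by
  -- A polynomial in resolvents involves finitely many test functions, so it commutes exactly with
  -- W_{g_j} and its adjoint for large j. Only the norm closure turns this into a limit.
  have key : ∀ T ∈ StarAlgebra.adjoin ℂ {R : Operators H | ∃ (lam : ℝ) (hlam : lam ≠ 0),
      ∃ h ∈ D, R = fieldResolvent lam hlam h}, ∀ᶠ j in Filter.atTop,
      Commute (isometryW (g j) (hg j)) T ∧ Commute (star (isometryW (g j) (hg j))) T := by
    intro T hT
    induction hT using StarAlgebra.adjoin_induction with
    | mem T hT =>
      obtain ⟨lam, hlam, h, hh, rfl⟩ := hT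
      filter_upwards [hgD h hh] with j hj
      exact ⟨commute_isometryW_fieldResolvent (hg j) hj lam hlam,
        commute_star_isometryW_fieldResolvent (hg j) hj lam hlam⟩
    | algebraMap c =>
      exact Filter.Eventually.of_forall fun j =>
        ⟨Algebra.commute_algebraMap_right c _, Algebra.commute_algebraMap_right c _⟩
    | add S T _ _ hS hT =>
      filter_upwards [hS, hT] with j h1 h2
      exact ⟨h1.1.add_right h2.1, h1.2.add_right h2.2⟩
    | mul S T _ _ hS hT =>
      filter_upwards [hS, hT] with j h1 h2
      exact ⟨h1.1.mul_right h2.1, h1.2.mul_right h2.2⟩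
    | star T _ hT =>
      filter_upwards [hT] with j h1
      exact ⟨by simpa only [star_star] using h1.2.star_star, h1.1.star_star⟩
  have hW : ∀ j, ‖isometryW (g j) (hg j)‖ ≤ 1 := fun j =>
    ContinuousLinearMap.opNorm_le_bound _ zero_le_one fun ψ => by
      rw [norm_isometryW_apply, one_mul]
  refine Metric.tendsto_atTop'.2 fun ε hε => ?_
  have hR' : R ∈ closure (StarAlgebra.adjoin ℂ {R : Operators H | ∃ (lam : ℝ) (hlam : lam ≠ 0),
      ∃ h ∈ D, R = fieldResolvent lam hlam h} : Set (Operators H)) := hR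
  obtain ⟨T, hT, hRT⟩ := Metric.mem_closure_iff.1 hR' (ε / 2) (half_pos hε)
  obtain ⟨N, hN⟩ := Filter.eventually_atTop.1 (key T hT)
  refine ⟨N, fun j hj => ?_⟩
  have h1 : star (isometryW (g j) (hg j)) * T * isometryW (g j) (hg j) = T := by
    rw [mul_assoc, ← (hN j hj.le).1.eq, ← mul_assoc, star_isometryW_mul_self, one_mul]
  have h2 : star (isometryW (g j) (hg j)) * R * isometryW (g j) (hg j) - R =
      star (isometryW (g j) (hg j)) * (R - T) * isometryW (g j) (hg j) - (R - T) := by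
    rw [mul_sub, sub_mul, h1]
    abel
  have h3 : ‖star (isometryW (g j) (hg j)) * (R - T) * isometryW (g j) (hg j)‖ ≤ ‖R - T‖ := by
    refine (norm_mul_le _ _).trans (mul_le_of_le_one_right (norm_nonneg _) (hW j) |>.trans ?_)
    refine (norm_mul_le _ _).trans (mul_le_of_le_one_left (norm_nonneg _) ?_)
    rw [norm_star]
    exact hW j
  rw [dist_eq_norm] at hRT ⊢
  rw [h2]
  refine (norm_sub_le _ _).trans_lt ?_
  linarith

/-- Let B in the resolvent algebra agree with z(N) W_f W_f* on at most n + 2 particles, and let x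
have n particles. Then B acts on W_f x as z(n+1). Conjugation by W_{g_j} inserts one more particle
in a mode orthogonal to f, so W_{g_j}* B W_{g_j} acts on W_f x as z(n+2); but these operators
converge to B. -/
theorem eq_of_phase_mul_mem_observables {D : Set H} {g : ℕ → H} (hg : ∀ j, ‖g j‖ = 1)
    (hgD : ∀ h ∈ D, ∀ᶠ j in Filter.atTop, ⟪g j, h⟫_ℂ = 0) {f : H} (hf : f ∈ D) (hf1 : ‖f‖ = 1)
    {z : ℕ → Circle}
    (hz : phase z H * (isometryW f hf1 * star (isometryW f hf1)) ∈ observables D) (n : ℕ) :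
    z (n + 1) = z (n + 2) := by
  obtain ⟨B, hB, -, hBX⟩ := hz (n + 2)
  obtain ⟨x, hx, hx1⟩ := exists_isometryW_pow_vacuum f hf1 n
  have hWW : ∀ ψ, (phase z H * (isometryW f hf1 * star (isometryW f hf1))) (isometryW f hf1 ψ) =
      phase z H (isometryW f hf1 ψ) := fun ψ => by
    have h1 : star (isometryW f hf1) (isometryW f hf1 ψ) = ψ :=
      DFunLike.congr_fun (star_isometryW_mul_self f hf1) ψ
    rw [mul_apply_eq_comp, mul_apply_eq_comp, h1]
  have hlow : ∀ (k : ℕ) (y : NParticle k H), k ≤ n + 2 → inSector k y ∈ lowParticles (n + 2) H :=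
    fun k y hk l hl => inSector_ne _ (by omega)
  have hBy : ∀ (k : ℕ) (y : NParticle k H), k + 1 ≤ n + 2 →
      B (isometryW f hf1 (inSector k y)) = (z (k + 1) : ℂ) • isometryW f hf1 (inSector k y) := by
    intro k y hk
    have h1 := hBX (inSector (k + 1) (raising f k y)) (hlow _ _ hk)
    rw [← isometryW_inSector f hf1, hWW] at h1
    rw [← h1, isometryW_inSector, phase_inSector]
  have ht := tendsto_star_isometryW_mul hg hgD hB
  have ht' := ((ContinuousLinearMap.apply ℂ (Fock H)
    (isometryW f hf1 (inSector n x))).continuous.tendsto B).comp ht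
  have hev : ∀ᶠ j in Filter.atTop, ((ContinuousLinearMap.apply ℂ (Fock H)
      (isometryW f hf1 (inSector n x))) ∘
      fun j => star (isometryW (g j) (hg j)) * B * isometryW (g j) (hg j)) j =
        (z (n + 2) : ℂ) • isometryW f hf1 (inSector n x) := by
    filter_upwards [hgD f hf] with j hj
    have h1 : isometryW (g j) (hg j) (isometryW f hf1 (inSector n x)) =
        isometryW f hf1 (inSector (n + 1) (raising (g j) n x)) := by
      rw [← isometryW_inSector (g j) (hg j)]
      exact DFunLike.congr_fun (isometryW_comm (hg j) hf1 hj) _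
    change star (isometryW (g j) (hg j)) (B (isometryW (g j) (hg j)
      (isometryW f hf1 (inSector n x)))) = _
    rw [h1, hBy _ _ le_rfl, ← h1, map_smul]
    congr 1
    exact DFunLike.congr_fun (star_isometryW_mul_self (g j) (hg j)) _
  have h1 := tendsto_nhds_unique ht' (tendsto_const_nhds.congr' (hev.mono fun _ h => h.symm))
  have h2 : (z (n + 1) : ℂ) • isometryW f hf1 (inSector n x) =
      (z (n + 2) : ℂ) • isometryW f hf1 (inSector n x) := (hBy n x (by omega)).symm.trans h1
  refine Circle.coe_injective (smul_left_injective ℂ (?_ : isometryW f hf1 (inSector n x) ≠ 0) h2)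
  rw [← norm_ne_zero_iff, norm_isometryW_apply, norm_inSector, hx1]
  exact one_ne_zero

/-! ### Adjoint actions -/

section adjoint

variable {u v S T : Operators H}

theorem Ad_comp (u v T : Operators H) : Ad (u * v) T = Ad u (Ad v T) := by
  simp only [Ad, star_mul, mul_assoc]

theorem Ad_one_left (T : Operators H) : Ad 1 T = T := by
  rw [Ad, star_one, one_mul, mul_one]

theorem Ad_star (u T : Operators H) : Ad u (star T) = star (Ad u T) := by
  simp only [Ad, star_mul, star_star, mul_assoc]

theorem Ad_one (hu : u ∈ unitary (Operators H)) : Ad u 1 = 1 := by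
  rw [Ad, mul_one, Unitary.mul_star_self_of_mem hu]

theorem Ad_mul (hu : u ∈ unitary (Operators H)) (S T : Operators H) :
    Ad u (S * T) = Ad u S * Ad u T := by
  have h : star u * (u * (T * star u)) = T * star u := by
    rw [← mul_assoc, Unitary.star_mul_self_of_mem hu, one_mul]
  simp only [Ad, mul_assoc, h]

theorem Ad_pow (hu : u ∈ unitary (Operators H)) (T : Operators H) (n : ℕ) :
    Ad u (T ^ n) = Ad u T ^ n := by
  induction n with
  | zero => rw [pow_zero, pow_zero, Ad_one hu]
  | succ n ih => rw [pow_succ, pow_succ, Ad_mul hu, ih]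

theorem Ad_sum {ι : Type*} (u : Operators H) (s : Finset ι) (T : ι → Operators H) :
    Ad u (∑ i ∈ s, T i) = ∑ i ∈ s, Ad u (T i) := by
  simp only [Ad, Finset.mul_sum, Finset.sum_mul]

theorem continuous_Ad (u : Operators H) : Continuous (Ad u) := by
  unfold Ad
  fun_prop

theorem IsTensor.Ad {m : ℤ} (hu : IsTensor 0 u) (hT : IsTensor m T) : IsTensor m (Ad u T) := by
  have h := (hu.mul hT).mul hu.star
  rwa [zero_add, neg_zero, add_zero] at h

theorem Ad_phase_of_isTensor (w : ℕ → Circle) (hT : IsTensor 0 T) : Ad (phase w H) T = T := by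
  rw [BoseFock.Ad, hT.commute_phase, mul_assoc,
    Unitary.mul_star_self_of_mem (phase_mem_unitary w), mul_one]

theorem IsTensor.phase_mul_eq (hT : IsTensor 1 T) {y z : ℕ → Circle}
    (hyz : ∀ n, z (n + 1) = y n) : phase z H * T = T * phase y H :=
  clm_eq_of_inSector fun n x => by
    rw [mul_apply_eq_comp, mul_apply_eq_comp, phase_inSector, map_smul]
    refine Fock.ext fun k => ?_
    rw [sector_phase, Fock.sector_smul]
    by_cases hk : k = n + 1
    · subst hk
      rw [hyz]
    · rw [hT.sector_inSector_eq_zero (by omega), smul_zero, smul_zero]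

theorem phase_mul_const (y : ℕ → Circle) (c : Circle) :
    phase (fun n => y n * c) H = (c : ℂ) • phase y H := operator_ext fun ψ n => by
  rw [sector_phase, smul_apply, Fock.sector_smul, sector_phase, smul_smul, Circle.coe_mul,
    mul_comm]

end adjoint

/-! ### Equivalence of morphisms in terms of phases -/

section observables

variable {D : Set H} {A B : Operators H}

theorem observables_mul (hA : A ∈ observables D) (hB : B ∈ observables D) :
    A * B ∈ observables D := by
  rw [mem_observables_iff] at *
  have h := hA.mul hB
  rwa [add_zero] at h

theorem observables_star (hA : A ∈ observables D) : star A ∈ observables D := by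
  rw [mem_observables_iff] at *
  have h := hA.star
  rwa [neg_zero] at h

theorem isTensor_of_mem_observables (hA : A ∈ observables D) : IsTensor 0 A :=
  (mem_observables_iff.1 hA).isTensor

theorem transformed_rho (u : Operators H) {f : H} (hf1 : ‖f‖ = 1) (A : Operators H) :
    transformed u (rho f hf1) A = Ad u (isometryW f hf1) * A * star (Ad u (isometryW f hf1)) := by
  simp only [transformed, Ad, rho, Function.comp_apply, star_mul, star_star, mul_assoc]

theorem star_Ad_mul_Ad_isometryW {u : Operators H} (hu : u ∈ unitary (Operators H)) {f : H}
    (hf1 : ‖f‖ = 1) : star (Ad u (isometryW f hf1)) * Ad u (isometryW f hf1) = 1 := by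
  rw [← Ad_star, ← Ad_mul hu, star_isometryW_mul_self, Ad_one hu]

/-- A partial isometry `X` which intertwines two morphisms implemented by isometries `V` and `W`
is of the form `V Y W*` for a unitary `Y` commuting with the observables. -/
theorem exists_unitary_of_intertwiner {V W X : Operators H} (hV : star V * V = 1)
    (hW : star W * W = 1) (h1 : X * star X * X = X) (h2 : X * star X = V * star V)
    (h3 : star X * X = W * star W)
    (h4 : ∀ A ∈ observables D, V * A * star V * X = X * (W * A * star W)) :
    star (star V * X * W) * (star V * X * W) = 1 ∧ V * (star V * X * W) * star W = X ∧
      ∀ A ∈ observables D, star V * X * W * A = A * (star V * X * W) := by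
  have hVX : V * star V * X = X := by rw [← h2, h1]
  have hXW : X * (W * star W) = X := by rw [← h3, ← mul_assoc, h1]
  refine ⟨?_, ?_, fun A hA => ?_⟩
  · calc star (star V * X * W) * (star V * X * W) = star W * star X * (V * star V * X) * W := by
          simp only [star_mul, star_star, mul_assoc]
      _ = star W * (star X * X) * W := by rw [hVX]; simp only [mul_assoc]
      _ = (star W * W) * (star W * W) := by rw [h3]; simp only [mul_assoc]
      _ = 1 := by rw [hW, one_mul]
  · calc V * (star V * X * W) * star W = V * star V * X * (W * star W) := by
          simp only [mul_assoc]
      _ = X := by rw [hVX, hXW]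
  · calc star V * X * W * A = star V * (X * W * A * 1) := by simp only [mul_assoc, mul_one]
      _ = star V * (X * (W * A * star W)) * W := by rw [← hW]; simp only [mul_assoc]
      _ = (star V * V) * A * (star V * X * W) := by rw [← h4 A hA]; simp only [mul_assoc]
      _ = A * (star V * X * W) := by rw [hV, one_mul]

/-- An intertwiner is V y(N) W* with V = Ad u(W). Moving y through V shifts its argument, which
gives z(N) V W* with z(n+1) = y(n). Dividing by y(0) achieves z(1) = 1, and z(0) has no effect and
is set to 1. This normalization makes z unique. -/
theorem exists_phase_of_morphismEquiv (hD : ∀ h ∈ D, ∀ c : ℂ, c • h ∈ D) (hdense : Dense D)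
    {f : H} (hf : f ∈ D) (hf1 : ‖f‖ = 1) {u : Operators H} (hu : u ∈ unitary (Operators H))
    (hu0 : IsTensor 0 u) (hX : MorphismEquiv D (transformed u (rho f hf1)) (rho f hf1)) :
    ∃ z : ℕ → Circle, z 0 = 1 ∧ z 1 = 1 ∧
      phase z H * Ad u (isometryW f hf1) * star (isometryW f hf1) ∈ observables D := by
  obtain ⟨X, hXA, h1, h2, h3, h4⟩ := hX
  have hV1 := hu0.Ad (isTensor_isometryW f hf1)
  simp only [transformed_rho, rho, mul_one] at h2 h3 h4
  obtain ⟨e1, e2, e3⟩ := exists_unitary_of_intertwiner (star_Ad_mul_Ad_isometryW hu hf1)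
    (star_isometryW_mul_self f hf1) h1 h2 h3 h4
  have hY0 := (hV1.star.mul (isTensor_of_mem_observables hXA)).mul (isTensor_isometryW f hf1)
  rw [add_zero, neg_add_cancel] at hY0
  obtain ⟨y, hy⟩ := (isSectorScalar_of_commute hD hdense hf hf1 hY0 e3).exists_phase e1
  rw [hy] at e2
  refine ⟨fun n => Nat.casesOn n 1 fun k => y k * (y 0)⁻¹, rfl, mul_inv_cancel (y 0), ?_⟩
  rw [hV1.phase_mul_eq (y := fun k => y k * (y 0)⁻¹) fun n => rfl, phase_mul_const, mul_smul_comm,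
    smul_mul_assoc, e2, mem_observables_iff]
  exact (mem_observables_iff.1 hXA).smul _

/-- The given observable z(N) V W* is itself the intertwiner: z(N) commutes with the operators V A
V* of degree 0, and V, W are isometries. -/
theorem morphismEquiv_of_phase {f : H} (hf1 : ‖f‖ = 1) {u : Operators H}
    (hu : u ∈ unitary (Operators H)) (hu0 : IsTensor 0 u) {z : ℕ → Circle}
    (hz : phase z H * Ad u (isometryW f hf1) * star (isometryW f hf1) ∈ observables D) :
    MorphismEquiv D (transformed u (rho f hf1)) (rho f hf1) := by
  have hV1 := hu0.Ad (isTensor_isometryW f hf1)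
  have hV := star_Ad_mul_Ad_isometryW hu hf1
  have hW := star_isometryW_mul_self f hf1
  have hZ := phase_mem_unitary (H := H) z
  simp only [MorphismEquiv, transformed_rho, rho, mul_one]
  generalize Ad u (isometryW f hf1) = V at *
  generalize isometryW f hf1 = W at *
  have hZZ := Unitary.star_mul_self_of_mem hZ
  have hVV : IsTensor 0 (V * star V) := by
    have := hV1.mul hV1.star
    rwa [add_neg_cancel] at this
  have hXX : star (phase z H * V * star W) * (phase z H * V * star W) = W * star W := by
    calc star (phase z H * V * star W) * (phase z H * V * star W)
        = W * (star V * ((star (phase z H) * phase z H) * V)) * star W := by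
          simp only [star_mul, star_star, mul_assoc]
      _ = W * star W := by rw [hZZ, one_mul, hV, mul_one]
  refine ⟨_, hz, ?_, ?_, hXX, fun A hA => ?_⟩
  · rw [mul_assoc _ (star _), hXX]
    calc phase z H * V * star W * (W * star W) = phase z H * V * (star W * W) * star W := by
          simp only [mul_assoc]
      _ = _ := by rw [hW, mul_one]
  · calc phase z H * V * star W * star (phase z H * V * star W)
        = phase z H * V * (star W * W) * star V * star (phase z H) := by
          simp only [star_mul, star_star, mul_assoc]
      _ = phase z H * (V * star V) * star (phase z H) := by rw [hW, mul_one]; simp only [mul_assoc]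
      _ = V * star V := Ad_phase_of_isTensor z hVV
  · have hVA : IsTensor 0 (V * A * star V) := by
      have := (hV1.mul (isTensor_of_mem_observables hA)).mul hV1.star
      rwa [add_zero, add_neg_cancel] at this
    calc V * A * star V * (phase z H * V * star W)
        = (V * A * star V * phase z H) * V * star W := by simp only [mul_assoc]
      _ = phase z H * V * A * (star V * V) * star W := by
          rw [← hVA.commute_phase]; simp only [mul_assoc]
      _ = phase z H * V * 1 * A * star W := by rw [hV, mul_one, mul_one]
      _ = phase z H * V * star W * (W * A * star W) := by rw [← hW]; simp only [mul_assoc]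

variable {g : ℕ → H} {f : H}

/-- The first observable times the adjoint of the second is (y z⁻¹)(N) V V*, with V = Ad u(W).
Conjugation by u* turns it into (y z⁻¹)(N) W W*, whence y z⁻¹ is constant on n ≥ 1; the
normalization settles the rest. -/
theorem eq_of_phase_mem_observables (hg : ∀ j, ‖g j‖ = 1)
    (hgD : ∀ h ∈ D, ∀ᶠ j in Filter.atTop, ⟪g j, h⟫_ℂ = 0) (hf : f ∈ D) (hf1 : ‖f‖ = 1)
    {u : Operators H} (hu : u ∈ unitary (Operators H)) (hu0 : IsTensor 0 u)
    (huA : ∀ A ∈ observables D, Ad (star u) A ∈ observables D) {y z : ℕ → Circle}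
    (hy0 : y 0 = 1) (hy1 : y 1 = 1) (hz0 : z 0 = 1) (hz1 : z 1 = 1)
    (hy : phase y H * Ad u (isometryW f hf1) * star (isometryW f hf1) ∈ observables D)
    (hz : phase z H * Ad u (isometryW f hf1) * star (isometryW f hf1) ∈ observables D) :
    y = z := by
  have hW := star_isometryW_mul_self f hf1
  have hWt := isTensor_isometryW f hf1
  have hVt := hu0.Ad hWt
  have hVV : IsTensor 0 (Ad u (isometryW f hf1) * star (Ad u (isometryW f hf1))) := by
    have := hVt.mul hVt.star
    rwa [add_neg_cancel] at this
  have h1 := huA _ (observables_mul hy (observables_star hz))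
  have hus := Unitary.star_mem hu
  have hs0 : IsTensor 0 (star u) := by
    have := hu0.star
    rwa [neg_zero] at this
  have e1 : phase y H * Ad u (isometryW f hf1) * star (isometryW f hf1) *
      star (phase z H * Ad u (isometryW f hf1) * star (isometryW f hf1)) =
      phase (y * z⁻¹) H * (Ad u (isometryW f hf1) * star (Ad u (isometryW f hf1))) := by
    calc _ = phase y H * Ad u (isometryW f hf1) * (star (isometryW f hf1) * isometryW f hf1) *
          star (Ad u (isometryW f hf1)) * star (phase z H) := by
          simp only [star_mul, star_star, mul_assoc]
      _ = phase y H * ((Ad u (isometryW f hf1) * star (Ad u (isometryW f hf1))) *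
          star (phase z H)) := by rw [hW, mul_one]; simp only [mul_assoc]
      _ = _ := by rw [star_phase, ← hVV.commute_phase, phase_mul, mul_assoc]
  have e2 : Ad (star u) (phase (y * z⁻¹) H) = phase (y * z⁻¹) H := by
    rw [Ad, ← hs0.commute_phase, mul_assoc, Unitary.mul_star_self_of_mem hus, mul_one]
  have e3 : ∀ T, Ad (star u) (Ad u T) = T := fun T => by
    rw [← Ad_comp, Unitary.star_mul_self_of_mem hu, Ad_one_left]
  rw [e1, Ad_mul hus, Ad_mul hus, e2, Ad_star, e3] at h1
  have h2 := eq_of_phase_mul_mem_observables hg hgD hf hf1 h1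
  have h3 : ∀ n, (y * z⁻¹) (n + 1) = 1 := fun n => by
    induction n with
    | zero => rw [zero_add, Pi.mul_apply, Pi.inv_apply, hy1, hz1, inv_one, one_mul]
    | succ n ih => rw [← h2, ih]
  funext n
  rcases n with _ | n
  · rw [hy0, hz0]
  · exact mul_inv_eq_one.1 (h3 n)

/-- A cocycle relation: apply Ad u to the observable of v and multiply by that of u. The adjacent
factors Ad u(W)* and Ad u(W) cancel after the phase between them has been moved past an operator of
degree 0. -/
theorem phase_mul_mem_observables (hf1 : ‖f‖ = 1) {u v : Operators H}
    (hu : u ∈ unitary (Operators H)) (hu0 : IsTensor 0 u) (hv0 : IsTensor 0 v)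
    (huA : ∀ A ∈ observables D, Ad u A ∈ observables D) {y z : ℕ → Circle}
    (hy : phase y H * Ad u (isometryW f hf1) * star (isometryW f hf1) ∈ observables D)
    (hz : phase z H * Ad v (isometryW f hf1) * star (isometryW f hf1) ∈ observables D) :
    phase (y * z) H * Ad (u * v) (isometryW f hf1) * star (isometryW f hf1) ∈ observables D := by
  have hWt := isTensor_isometryW f hf1
  have hV := star_Ad_mul_Ad_isometryW hu hf1
  have hVt := hu0.Ad hWt
  have hVt' := hu0.Ad (hv0.Ad hWt)
  have h1 := observables_mul (huA _ hz) hy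
  have e1 : Ad u (phase z H) = phase z H := by
    rw [Ad, ← hu0.commute_phase, mul_assoc, Unitary.mul_star_self_of_mem hu, mul_one]
  rw [Ad_mul hu, Ad_mul hu, e1, Ad_star, ← mul_assoc, ← mul_assoc] at h1
  rw [Ad_comp]
  have h0 : IsTensor 0 (Ad u (Ad v (isometryW f hf1)) * star (Ad u (isometryW f hf1))) := by
    have := hVt'.mul hVt.star
    rwa [add_neg_cancel] at this
  convert h1 using 1
  generalize Ad u (Ad v (isometryW f hf1)) = V' at *
  generalize Ad u (isometryW f hf1) = V at *
  calc phase (y * z) H * V' * star (isometryW f hf1)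
      = phase z H * (phase y H * (V' * 1)) * star (isometryW f hf1) := by
        rw [mul_comm y z, phase_mul]; simp only [mul_assoc, mul_one]
    _ = phase z H * (phase y H * (V' * star V)) * V * star (isometryW f hf1) := by
        rw [← hV]; simp only [mul_assoc]
    _ = _ := by rw [h0.commute_phase]; simp only [mul_assoc]

end observables

/-! ### Extending the action to the field algebra -/

section extension

variable {D : Set H} {f : H}

theorem star_isometryW_pow_mul_self (f : H) (hf1 : ‖f‖ = 1) (m : ℕ) :
    star (isometryW f hf1 ^ m) * isometryW f hf1 ^ m = 1 := by
  induction m with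
  | zero => rw [pow_zero, star_one, one_mul]
  | succ m ih =>
    rw [pow_succ', star_mul, mul_assoc, ← mul_assoc (star (isometryW f hf1)),
      star_isometryW_mul_self, one_mul, ih]

/-- An extended tensor of nonnegative degree is the product of an observable and a power of an
isometry. -/
theorem isExtendedTensor_Ad_of_nonneg (hD : ∀ h ∈ D, ∀ c : ℂ, c • h ∈ D) (hf : f ∈ D)
    (hf1 : ‖f‖ = 1) {v : Operators H} (hv : v ∈ unitary (Operators H))
    (hvA : ∀ A ∈ observables D, Ad v A ∈ observables D)
    (hvW : IsExtendedTensor D 1 (Ad v (isometryW f hf1))) {m : ℕ} {T : Operators H}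
    (hT : IsExtendedTensor D m T) : IsExtendedTensor D m (Ad v T) := by
  have hWm := (isExtendedTensor_isometryW hD hf hf1).pow m
  rw [mul_one] at hWm
  have h1 := hT.mul hWm.star
  rw [add_neg_cancel, ← mem_observables_iff] at h1
  have hWW := star_isometryW_pow_mul_self f hf1 m
  have e : T = T * star (isometryW f hf1 ^ m) * isometryW f hf1 ^ m := by
    rw [mul_assoc, hWW, mul_one]
  rw [e, Ad_mul hv, Ad_pow hv]
  have h2 := (mem_observables_iff.1 (hvA _ h1)).mul (hvW.pow m)
  rwa [zero_add, mul_one] at h2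

theorem isExtendedTensor_Ad (hD : ∀ h ∈ D, ∀ c : ℂ, c • h ∈ D) (hf : f ∈ D)
    (hf1 : ‖f‖ = 1) {v : Operators H} (hv : v ∈ unitary (Operators H))
    (hvA : ∀ A ∈ observables D, Ad v A ∈ observables D)
    (hvW : IsExtendedTensor D 1 (Ad v (isometryW f hf1))) {m : ℤ} {T : Operators H}
    (hT : IsExtendedTensor D m T) : IsExtendedTensor D m (Ad v T) := by
  obtain ⟨k, rfl | rfl⟩ := m.eq_nat_or_neg
  · exact isExtendedTensor_Ad_of_nonneg hD hf hf1 hv hvA hvW hT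
  · have h1 := hT.star
    rw [neg_neg] at h1
    have h2 := (isExtendedTensor_Ad_of_nonneg hD hf hf1 hv hvA hvW h1).star
    rwa [Ad_star, star_star] at h2

/-- On a dense subset, an element is the finite sum of its homogeneous components, which are
extended tensors, and Ad v preserves extended tensors of each degree. -/
theorem Ad_mem_fieldAlgebra (hD : ∀ h ∈ D, ∀ c : ℂ, c • h ∈ D) (hf : f ∈ D)
    (hf1 : ‖f‖ = 1) {v : Operators H} (hv : v ∈ unitary (Operators H))
    (hvA : ∀ A ∈ observables D, Ad v A ∈ observables D)
    (hvW : IsExtendedTensor D 1 (Ad v (isometryW f hf1))) {T : Operators H}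
    (hT : T ∈ fieldAlgebra D) : Ad v T ∈ fieldAlgebra D := by
  rw [fieldAlgebra_eq] at hT ⊢
  refine map_mem_closure (continuous_Ad v) hT ?_
  rintro F ⟨M, hF⟩
  refine ⟨M, ?_⟩
  rw [← sum_gaugeAverage_extended hF, Ad_sum]
  refine Submodule.sum_mem _ fun m hm => ?_
  have hm' := abs_le.2 (Finset.mem_Icc.1 hm)
  exact (isExtendedTensor_Ad hD hf hf1 hv hvA hvW
    (isExtendedTensor_gaugeAverage hm' hF)).mem_extendedTensorSpace hm'

theorem isometryW_mem_fieldAlgebra (hD : ∀ h ∈ D, ∀ c : ℂ, c • h ∈ D) (hf : f ∈ D)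
    (hf1 : ‖f‖ = 1) : isometryW f hf1 ∈ fieldAlgebra D := by
  rw [fieldAlgebra_eq]
  exact subset_closure ⟨1, (isExtendedTensor_isometryW hD hf hf1).mem_extendedTensorSpace (by simp)⟩

theorem Ad_mul_phase_of_isTensor (u : Operators H) (w : ℕ → Circle) {T : Operators H}
    (hT : IsTensor 0 T) : Ad (u * phase w H) T = Ad u T := by
  rw [Ad_comp, Ad_phase_of_isTensor w hT]

/-- As W raises N by one, w(N) W w(N)* = (w(N)/w(N − 1)) W; the hypothesis on z spells out this
ratio on n ≥ 1, where the range of W lives. -/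
theorem Ad_mul_phase_isometryW {u : Operators H} (hu0 : IsTensor 0 u) (hf1 : ‖f‖ = 1)
    {w z : ℕ → Circle} (hwz : ∀ n, z (n + 1) * w n = w (n + 1)) :
    Ad (u * phase w H) (isometryW f hf1) = phase z H * Ad u (isometryW f hf1) := by
  have hWt := isTensor_isometryW f hf1
  have e : Ad (phase w H) (isometryW f hf1) = phase z H * isometryW f hf1 := by
    have h1 : phase w H * isometryW f hf1 =
        isometryW f hf1 * phase (fun n => z (n + 1) * w n) H :=
      hWt.phase_mul_eq fun n => (hwz n).symm
    have h2 : phase z H * isometryW f hf1 = isometryW f hf1 * phase (fun n => z (n + 1)) H :=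
      hWt.phase_mul_eq fun n => rfl
    rw [Ad, h1, h2, mul_assoc, star_phase, ← phase_mul]
    congr 2
    funext n
    simp
  rw [Ad_comp, e]
  simp only [Ad, ← mul_assoc]
  rw [hu0.commute_phase]

end extension

/-! ### Covariance -/

section covariance

variable {D : Set H} {f : H} {G : Type*} [Group G] (U : G →* unitary (Operators H))

theorem Ad_mem_of_image_eq {K : Set (Operators H)} (hU : ∀ a, Ad (U a : Operators H) '' K = K)
    (a : G) : ∀ A ∈ K, Ad (U a : Operators H) A ∈ K := fun A hA => by
  rw [← hU a]
  exact ⟨A, hA, rfl⟩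

/-- Invariance under all group elements includes their inverses, so the inclusion is an equality. -/
theorem image_eq_of_Ad_mem {K : Set (Operators H)}
    (hU : ∀ a, ∀ A ∈ K, Ad (U a : Operators H) A ∈ K) (a : G) :
    Ad (U a : Operators H) '' K = K := by
  refine Set.Subset.antisymm (Set.image_subset_iff.2 (hU a)) fun A hA => ⟨_, hU a⁻¹ A hA, ?_⟩
  rw [← Ad_comp, ← Submonoid.coe_mul, ← map_mul, mul_inv_cancel, map_one, Submonoid.coe_one,
    Ad_one_left]

theorem coe_map_inv (a : G) : (U a⁻¹ : Operators H) = star (U a : Operators H) := by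
  rw [map_inv]
  rfl

theorem mul_Ad_star_mul_star_mem_iff (u : Operators H) (hf1 : ‖f‖ = 1) (z : ℕ → Circle) :
    isometryW f hf1 * Ad u (star (isometryW f hf1)) * star (phase z H) ∈ observables D ↔
      phase z H * Ad u (isometryW f hf1) * star (isometryW f hf1) ∈ observables D := by
  have e : isometryW f hf1 * Ad u (star (isometryW f hf1)) * star (phase z H) =
      star (phase z H * Ad u (isometryW f hf1) * star (isometryW f hf1)) := by
    simp only [Ad_star, star_mul, star_star, mul_assoc]
  rw [e]
  exact ⟨fun h => by simpa only [star_star] using observables_star h, observables_star⟩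

variable {U}

/-- By the cocycle relation z(a) z(b) is a normalized solution for ab; by rigidity it is the only
one, so it equals z(ab). -/
theorem exists_representation_of_covariant (hD : ∀ h ∈ D, ∀ c : ℂ, c • h ∈ D) (hdense : Dense D)
    {g : ℕ → H} (hg : ∀ j, ‖g j‖ = 1) (hgD : ∀ h ∈ D, ∀ᶠ j in Filter.atTop, ⟪g j, h⟫_ℂ = 0)
    (hf : f ∈ D) (hf1 : ‖f‖ = 1) (hU0 : ∀ a, IsTensor 0 (U a : Operators H))
    (hUA : ∀ a, ∀ A ∈ observables D, Ad (U a : Operators H) A ∈ observables D)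
    (h : ∀ a, MorphismEquiv D (transformed (U a : Operators H) (rho f hf1)) (rho f hf1)) :
    ∃ z : G →* (ℕ → Circle), ∀ a, phase (z a) H * Ad (U a : Operators H) (isometryW f hf1) *
      star (isometryW f hf1) ∈ observables D := by
  choose z hz0 hz1 hz using fun a =>
    exists_phase_of_morphismEquiv hD hdense hf hf1 (U a).2 (hU0 a) (h a)
  refine ⟨MonoidHom.mk' z fun a b => ?_, hz⟩
  refine eq_of_phase_mem_observables hg hgD hf hf1 (U (a * b)).2 (hU0 _)
    (by rw [← coe_map_inv]; exact hUA _) (hz0 _) (hz1 _) ?_ ?_ (hz (a * b)) ?_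
  · rw [Pi.mul_apply, hz0, hz0, one_mul]
  · rw [Pi.mul_apply, hz1, hz1, one_mul]
  · rw [map_mul, Submonoid.coe_mul]
    exact phase_mul_mem_observables hf1 (U a).2 (hU0 a) (hU0 b) (hUA a) (hz a) (hz b)

theorem exists_extension_of_representation (hD : ∀ h ∈ D, ∀ c : ℂ, c • h ∈ D)
    (hf : f ∈ D) (hf1 : ‖f‖ = 1) (hU0 : ∀ a, IsTensor 0 (U a : Operators H))
    (hUA : ∀ a, ∀ A ∈ observables D, Ad (U a : Operators H) A ∈ observables D)
    (z : G →* (ℕ → Circle)) (hz : ∀ a, phase (z a) H * Ad (U a : Operators H) (isometryW f hf1) *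
      star (isometryW f hf1) ∈ observables D) :
    ∃ (w : G →* (ℕ → Circle)) (V : G →* unitary (Operators H)),
      (∀ a, V a = U a * phaseHom H (w a)) ∧
      ∀ a, Ad (V a : Operators H) '' fieldAlgebra D = fieldAlgebra D := by
  -- The solution of w(n+1) = z(n+1) w(n) with w(0) = 1, multiplicative in a because z is.
  let w : G →* (ℕ → Circle) := MonoidHom.mk' (fun a n => ∏ k ∈ Finset.range n, z a (k + 1))
    fun a b => funext fun n => by
      simp only [map_mul, Pi.mul_apply, Finset.prod_mul_distrib]
  have hw : ∀ a n, z a (n + 1) * w a n = w a (n + 1) := fun a n => by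
    change _ * ∏ k ∈ Finset.range n, z a (k + 1) = ∏ k ∈ Finset.range (n + 1), z a (k + 1)
    rw [Finset.prod_range_succ, mul_comm]
  let V : G →* unitary (Operators H) := MonoidHom.mk' (fun a => U a * phaseHom H (w a))
    fun a b => Subtype.ext <| by
      simp only [map_mul, Submonoid.coe_mul, coe_phaseHom]
      rw [mul_assoc, mul_assoc, ← mul_assoc _ (phase (w a) H), ← (hU0 b).commute_phase, mul_assoc]
  refine ⟨w, V, fun a => rfl, image_eq_of_Ad_mem V fun a T hT => ?_⟩
  have hVW : Ad (V a : Operators H) (isometryW f hf1) =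
      phase (z a) H * Ad (U a : Operators H) (isometryW f hf1) :=
    Ad_mul_phase_isometryW (hU0 a) hf1 (hw a)
  refine Ad_mem_fieldAlgebra hD hf hf1 (V a).2 (fun A hA => ?_) ?_ hT
  · have : Ad (V a : Operators H) A = Ad (U a : Operators H) A :=
      Ad_mul_phase_of_isTensor _ _ (isTensor_of_mem_observables hA)
    rw [this]
    exact hUA a A hA
  -- Ad V(a)(W) = (z(N) Ad U(a)(W) W*) W is an observable times W, hence an extended tensor of
  -- degree 1.
  · have h1 := (mem_observables_iff.1 (hz a)).mul (isExtendedTensor_isometryW hD hf hf1)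
    rwa [zero_add, mul_assoc, star_isometryW_mul_self, mul_one, ← hVW] at h1

theorem exists_representation_of_extension (hD : ∀ h ∈ D, ∀ c : ℂ, c • h ∈ D)
    (hf : f ∈ D) (hf1 : ‖f‖ = 1) (hU0 : ∀ a, IsTensor 0 (U a : Operators H))
    (w : G →* (ℕ → Circle)) (hw : ∀ a, ∀ T ∈ fieldAlgebra D,
      Ad ((U a : Operators H) * phase (w a) H) T ∈ fieldAlgebra D) :
    ∃ z : G →* (ℕ → Circle), ∀ a, phase (z a) H * Ad (U a : Operators H) (isometryW f hf1) *
      star (isometryW f hf1) ∈ observables D := by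
  -- Truncated subtraction gives z(0) = 1, a harmless value since Ad U(a)(W) has no vacuum
  -- component.
  let z : G →* (ℕ → Circle) := MonoidHom.mk' (fun a n => w a n * (w a (n - 1))⁻¹)
    fun a b => funext fun n => by
      simp only [map_mul, Pi.mul_apply, mul_inv]
      exact mul_mul_mul_comm _ _ _ _
  have hz : ∀ a n, z a (n + 1) * w a n = w a (n + 1) := fun a n => inv_mul_cancel_right _ _
  refine ⟨z, fun a => ?_⟩
  have h1 := hw a _ (isometryW_mem_fieldAlgebra hD hf hf1)
  rw [Ad_mul_phase_isometryW (hU0 a) hf1 (hz a)] at h1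
  have ht : IsTensor 1 (phase (z a) H * Ad (U a : Operators H) (isometryW f hf1)) := by
    have := (isTensor_phase (H := H) (z a)).mul ((hU0 a).Ad (isTensor_isometryW f hf1))
    rwa [zero_add] at this
  have h2 := (isExtendedTensor_of_mem_fieldAlgebra h1 ht).mul
    (isExtendedTensor_isometryW hD hf hf1).star
  rwa [add_neg_cancel, ← mem_observables_iff] at h2

theorem covariance_tfae (hD : ∀ h ∈ D, ∀ c : ℂ, c • h ∈ D) (hdense : Dense D)
    {g : ℕ → H} (hg : ∀ j, ‖g j‖ = 1) (hgD : ∀ h ∈ D, ∀ᶠ j in Filter.atTop, ⟪g j, h⟫_ℂ = 0)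
    (hf : f ∈ D) (hf1 : ‖f‖ = 1) (hUN : ∀ a, CommutesWithNumber (U a : Operators H))
    (hUA : ∀ a, Ad (U a : Operators H) '' observables D = observables D) :
    List.TFAE
      [∀ a, MorphismEquiv D (transformed (U a : Operators H) (rho f hf1)) (rho f hf1),
        ∃ Z : G →* unitary (Operators H), (∀ a, (Z a : Operators H) ∈ numberVN H) ∧
          ∀ a, isometryW f hf1 * Ad (U a : Operators H) (star (isometryW f hf1)) *
            star (Z a : Operators H) ∈ observables D,
        ∃ UN V : G →* unitary (Operators H), (∀ a, (UN a : Operators H) ∈ numberVN H) ∧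
          (∀ a, V a = U a * UN a) ∧
          ∀ a, Ad (V a : Operators H) '' fieldAlgebra D = fieldAlgebra D] := by
  have hU0 := fun a => (hUN a).isTensor
  have hUA' := Ad_mem_of_image_eq U hUA
  tfae_have 1 → 2 := fun h => by
    obtain ⟨z, hz⟩ := exists_representation_of_covariant hD hdense hg hgD hf hf1 hU0 hUA' h
    exact ⟨(phaseHom H).comp z, fun a => phase_mem_numberVN _, fun a =>
      (mul_Ad_star_mul_star_mem_iff _ hf1 _).2 (hz a)⟩
  tfae_have 2 → 1 := fun ⟨Z, hZ, h⟩ a => by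
    obtain ⟨z, hz⟩ := exists_phaseHom hf1 Z hZ
    have h1 := h a
    rw [hz] at h1
    exact morphismEquiv_of_phase hf1 (U a).2 (hU0 a) ((mul_Ad_star_mul_star_mem_iff _ hf1 _).1 h1)
  tfae_have 2 → 3 := fun ⟨Z, hZ, h⟩ => by
    obtain ⟨z, hz⟩ := exists_phaseHom hf1 Z hZ
    obtain ⟨w, V, hV, hVF⟩ := exists_extension_of_representation hD hf hf1 hU0 hUA' z fun a => by
      have h1 := h a
      rw [hz] at h1
      exact (mul_Ad_star_mul_star_mem_iff _ hf1 _).1 h1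
    exact ⟨(phaseHom H).comp w, V, fun a => phase_mem_numberVN _, hV, hVF⟩
  tfae_have 3 → 2 := fun ⟨UN, V, hN, hV, hVF⟩ => by
    obtain ⟨w, hw⟩ := exists_phaseHom hf1 UN hN
    obtain ⟨z, hz⟩ := exists_representation_of_extension hD hf hf1 hU0 w fun a T hT => by
      have h1 := Ad_mem_of_image_eq V hVF a T hT
      rwa [hV, hw] at h1
    exact ⟨(phaseHom H).comp z, fun a => phase_mem_numberVN _, fun a =>
      (mul_Ad_star_mul_star_mem_iff _ hf1 _).2 (hz a)⟩
  tfae_finish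

theorem Ad_mul_eq_of_mem_numberVN (hf1 : ‖f‖ = 1) (UN : G →* unitary (Operators H))
    (hN : ∀ a, (UN a : Operators H) ∈ numberVN H) (a : G) {A : Operators H}
    (hA : A ∈ observables D) : Ad ((U a * UN a : unitary (Operators H)) : Operators H) A =
      Ad (U a : Operators H) A := by
  obtain ⟨w, hw⟩ := exists_phaseHom hf1 UN hN
  rw [hw]
  exact Ad_mul_phase_of_isTensor _ _ (isTensor_of_mem_observables hA)

end covariance

/-! ### Test functions -/

theorem testVectors_smul {s : ℕ} : ∀ h ∈ testVectors s, ∀ c : ℂ, c • h ∈ testVectors s := by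
  rintro _ ⟨φ, rfl⟩ c
  refine ⟨c • φ, ?_⟩
  rw [testVector, testVector, ← MeasureTheory.MemLp.toLp_const_smul]
  rfl

theorem dense_testVectors (s : ℕ) : Dense (testVectors s) := by
  have h := MeasureTheory.Lp.dense_hasCompactSupport_contDiff (F := ℂ) (p := 2)
    (μ := (MeasureTheory.volume : MeasureTheory.Measure (EuclideanSpace ℝ (Fin s)))) (by simp)
  refine h.mono ?_
  rintro ψ ⟨φ, hφ, hc, hs⟩
  refine ⟨⟨φ, hs, hc, by simp⟩, ?_⟩
  refine MeasureTheory.Lp.ext ?_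
  exact (MeasureTheory.MemLp.coeFn_toLp _).trans hφ.symm

/-- Unit vectors in `L²(ℝˢ)` which are eventually orthogonal to any given test function. -/
theorem exists_unit_orthogonal {s : ℕ} (hs : 0 < s) : ∃ g : ℕ → OneParticle s, (∀ j, ‖g j‖ = 1) ∧
    ∀ h ∈ testVectors s, ∀ᶠ j in Filter.atTop, ⟪g j, h⟫_ℂ = 0 := by
  let e : EuclideanSpace ℝ (Fin s) := EuclideanSpace.single ⟨0, hs⟩ 1
  have he : ‖e‖ = 1 := by simp [e]
  -- Balls moving off along a coordinate axis, which exists because s > 0. They leave the support of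
  -- any given test function, and their normalized indicator functions are the required vectors.
  let B : ℕ → Set (EuclideanSpace ℝ (Fin s)) := fun j => Metric.ball ((j : ℝ) • e) 1
  have hB : ∀ j, MeasurableSet (B j) := fun j => measurableSet_ball
  have hμ : ∀ j, MeasureTheory.volume (B j) ≠ ⊤ := fun j => MeasureTheory.measure_ball_lt_top.ne
  have hμ0 : ∀ j, MeasureTheory.volume (B j) ≠ 0 := fun j => (Metric.measure_ball_pos _ _ one_pos).ne'
  let k : ℕ → OneParticle s := fun j => MeasureTheory.indicatorConstLp 2 (hB j) (hμ j) (1 : ℂ)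
  have hk : ∀ j, ‖k j‖ ≠ 0 := fun j => by
    rw [MeasureTheory.norm_indicatorConstLp (by simp) (by simp)]
    have : 0 < MeasureTheory.volume.real (B j) := ENNReal.toReal_pos (hμ0 j) (hμ j)
    rw [norm_one, one_mul]
    positivity
  refine ⟨fun j => ((‖k j‖⁻¹ : ℝ) : ℂ) • k j, fun j => ?_, ?_⟩
  · rw [norm_smul, Complex.norm_real, norm_inv, norm_norm, inv_mul_cancel₀ (hk j)]
  · rintro _ ⟨φ, rfl⟩
    obtain ⟨r, hr⟩ := φ.hasCompactSupport.isCompact.isBounded.subset_closedBall 0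
    obtain ⟨N, hN⟩ := exists_nat_gt (r + 1)
    filter_upwards [Filter.eventually_ge_atTop N] with j hj
    rw [inner_smul_left, MeasureTheory.L2.inner_indicatorConstLp_one]
    have hz : ∫ x in B j, (testVector φ : EuclideanSpace ℝ (Fin s) → ℂ) x = 0 := by
      refine MeasureTheory.setIntegral_eq_zero_of_ae_eq_zero ?_
      filter_upwards [MeasureTheory.MemLp.coeFn_toLp
        (φ.continuous.memLp_of_hasCompactSupport (p := 2) (μ := MeasureTheory.volume)
          φ.hasCompactSupport)] with x hx hxB
      refine hx.trans ?_
      by_contra hne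
      have h1 : ‖x‖ ≤ r := by
        simpa using hr (subset_tsupport _ hne)
      have h2 : ‖x - (j : ℝ) • e‖ < 1 := by
        simpa [B, dist_eq_norm] using hxB
      have h3 : ‖(j : ℝ) • e‖ = j := by
        rw [norm_smul, he]
        simp
      have h4 : ‖(j : ℝ) • e‖ ≤ ‖x‖ + ‖x - (j : ℝ) • e‖ := by
        have := norm_sub_le x (x - (j : ℝ) • e)
        rwa [sub_sub_cancel] at this
      have h5 : (N : ℝ) ≤ j := by exact_mod_cast hj
      linarith
    rw [hz, mul_zero]

end BoseFock

end

/-! ### Covariance over L²(ℝˢ) -/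

theorem lemma4p1 {s : ℕ} (hs : 0 < s) {G : Type*} [Group G]
    (f : TestFunctions s) (hf : ‖testVector f‖ = 1)
    (U : G →* unitary (Operators (OneParticle s)))
    (hUN : ∀ g, CommutesWithNumber (U g : Operators (OneParticle s)))
    (hUA : ∀ g, Ad (U g : Operators (OneParticle s)) '' observables (testVectors s) =
      observables (testVectors s)) :
    List.TFAE
      [∀ g, MorphismEquiv (testVectors s)
          (transformed (U g : Operators (OneParticle s)) (rho (testVector f) hf))
          (rho (testVector f) hf),
        ∃ Z : G →* unitary (Operators (OneParticle s)),
          (∀ g, (Z g : Operators (OneParticle s)) ∈ numberVN (OneParticle s)) ∧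
          ∀ g, isometryW (testVector f) hf *
              Ad (U g : Operators (OneParticle s)) (star (isometryW (testVector f) hf)) *
              star (Z g : Operators (OneParticle s)) ∈ observables (testVectors s),
        ∃ UN V : G →* unitary (Operators (OneParticle s)),
          (∀ g, (UN g : Operators (OneParticle s)) ∈ numberVN (OneParticle s)) ∧
          (∀ g, V g = U g * UN g) ∧
          ∀ g, Ad (V g : Operators (OneParticle s)) '' fieldAlgebra (testVectors s) =
            fieldAlgebra (testVectors s)] ∧
    ∀ UN : G →* unitary (Operators (OneParticle s)),
      (∀ g, (UN g : Operators (OneParticle s)) ∈ numberVN (OneParticle s)) →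
      ∀ g, ∀ A ∈ observables (testVectors s),
        Ad ((U g * UN g : unitary (Operators (OneParticle s))) : Operators (OneParticle s)) A =
          Ad (U g : Operators (OneParticle s)) A := by
  obtain ⟨k, hk, hkD⟩ := exists_unit_orthogonal hs
  exact ⟨covariance_tfae testVectors_smul (dense_testVectors s) hk hkD ⟨f, rfl⟩ hf hUN hUA,
    fun UN hN g _ hA => Ad_mul_eq_of_mem_numberVN hf UN hN g hA⟩
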